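/- Let $n,m\ge 1$, let $\mu$ be a Haar measure on $\mathrm{SO}(n)$ and let $A\in\mathbb R$. Let $\psi:\mathbb R^n\to\mathbb C$ be a $C^2$ wavelet, i.e. $\int_{\mathbb R^n}\psi=0$, such that $\psi$ and all its first and second partial derivatives are bounded in absolute value by $A(1+|x|)^{-n-2}$. For $\lambda>0$ and $R\in\mathrm{SO}(n)$ put $\psi_{\lambda,R}(x)=\lambda^{-n/2}\psi(\lambda^{-1}R^{-1}x)$, and for $f\in L^2(\mathbb R^n)$ (complex-valued), $\lambda_1,\dots,\lambda_m>0$ and $R_2,\dots,R_m\in\mathrm{SO}(n)$ define $$\mathscr S^m_{\mathrm{cont},2}f(\lambda_1,\dots,\lambda_m,R_2,\dots,R_m)=\int_{\mathrm{SO}(n)}\big\|\,|\cdots||f*\psi_{\lambda_1,R_1}|*\psi_{\lambda_2,R_2R_1}|*\cdots|*\psi_{\lambda_m,R_mR_1}\big\|_{L^2(\mathbb R^n)}^2\,d\mu(R_1).$$ For a function $F$ of $(\lambda_1,\dots,\lambda_m,R_2,\dots,R_m)$ let $$\|F\|=\int_{(0,\infty)^m}\int_{\mathrm{SO}(n)^{m-1}}|F|\;d\mu(R_2)\cdots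 d\mu(R_m)\,\frac{d\lambda_1}{\lambda_1^{n+1}}\cdots\frac{d\lambda_m}{\lambda_m^{n+1}} .$$ For $\tau\in C^2(\mathbb R^n;\mathbb R^n)$ put $L_\tau f(x)=f(x-\tau(x))$, and let $\|D\tau\|_\infty$ and $\|D^2\tau\|_\infty$ be the suprema over $\mathbb R^n$ of the absolute values of the entries of the first and second derivatives of $\tau$, and $\|\Delta\tau\|_\infty=\sup_{x,y}|\tau(x)-\tau(y)|$. Then there is a constant $C_{m,n}>0$, depending only on $m$, $n$, $\mu(\mathrm{SO}(n))$ and $A$, such that for all such $\psi$, all $\tau\in C^2(\mathbb R^n;\mathbb R^n)$ with $\|D\tau\|_\infty<\frac1{2n}$ and $\|\Delta\tau\|_\infty,\|D^2\tau\|_\infty<\infty$ (otherwise the right-hand side is infinite), and all $f\in L^2(\mathbb R^n)$, $$\big\|\mathscr S^m_{\mathrm{cont},2}f-\mathscr S^m_{\mathrm{cont},2}L_\tau f\big\|\le C_{m,n}\left(\|D\tau\|_\infty+\Big(\|D\tau\|_\infty\Big(\log\frac{\|\Delta\tau\|_\infty}{\|D\tau\|_\infty}\vee 1\Big)+\|D^2\tau\|_\infty\Big)^2\right)\|f\|_2^2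 ,$$ where $\|D\tau\|_\infty(\log\frac{\|\Delta\tau\|_\infty}{\|D\tau\|_\infty}\vee1)$ is read as $0$ if $\|D\tau\|_\infty=0$. -/

import Mathlib

open MeasureTheory

noncomputable section

/-- Euclidean space `ℝⁿ`. -/
abbrev Eucl (n : ℕ) : Type := EuclideanSpace ℝ (Fin n)

/-- The rotation group `SO(n)`, with the topology induced from the matrices. -/
abbrev RotGroup (n : ℕ) : Type := Matrix.specialOrthogonalGroup (Fin n) ℝ

/-- `SO(n)` carries its Borel σ-algebra. -/
instance instMeasurableSpaceRotGroup (n : ℕ) : MeasurableSpace (RotGroup n) :=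
  borel (RotGroup n)

instance instBorelSpaceRotGroup (n : ℕ) : BorelSpace (RotGroup n) := ⟨rfl⟩

/-- The action of a rotation on `ℝⁿ`, `x ↦ R x`. -/
def rotAct {n : ℕ} (R : RotGroup n) (x : Eucl n) : Eucl n :=
  Matrix.toEuclideanLin (R : Matrix (Fin n) (Fin n) ℝ) x

/-- The partial derivative `∂ᵢ g`. -/
def partialDeriv {n : ℕ} {F : Type*} [NormedAddCommGroup F] [NormedSpace ℝ F]
    (i : Fin n) (g : Eucl n → F) (x : Eucl n) : F :=
  fderiv ℝ g x (EuclideanSpace.single i (1 : ℝ))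

/-- `ψ` is a `C²` function with zero average which, together with all its first and second partial
derivatives, is bounded by `A (1 + |x|)^(-n-2)`. -/
structure IsDecayingWavelet (n : ℕ) (A : ℝ) (ψ : Eucl n → ℂ) : Prop where
  contDiff : ContDiff ℝ 2 ψ
  integral_eq_zero : ∫ x, ψ x = 0
  decay : ∀ x, ‖ψ x‖ ≤ A / (1 + ‖x‖) ^ (n + 2)
  decay_first : ∀ i x, ‖partialDeriv i ψ x‖ ≤ A / (1 + ‖x‖) ^ (n + 2)
  decay_second : ∀ i j x, ‖partialDeriv i (partialDeriv j ψ) x‖ ≤ A / (1 + ‖x‖) ^ (n + 2)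

/-- The dilated and rotated wavelet `ψ_{l,R}(x) = l^(-n/2) ψ(l⁻¹ R⁻¹ x)`. -/
def dilRotWavelet {n : ℕ} (ψ : Eucl n → ℂ) (l : ℝ) (R : RotGroup n) (x : Eucl n) : ℂ :=
  ((l ^ (-(n : ℝ) / 2) : ℝ) : ℂ) * ψ (l⁻¹ • rotAct R⁻¹ x)

/-- The convolution `(f ∗ g)(x) = ∫ f(y) g(x - y) dy` on `ℝⁿ`. -/
def convC {n : ℕ} (f g : Eucl n → ℂ) : Eucl n → ℂ :=
  convolution f g (ContinuousLinearMap.mul ℝ ℂ) volume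

/-- The cascade `|⋯||f ∗ ψ_{l₁,R₁}| ∗ ψ_{l₂,R₂}| ⋯ ∗ ψ_{l_m,R_m}|`. -/
def cascade {n : ℕ} (ψ : Eucl n → ℂ) :
    (m : ℕ) → (Fin m → ℝ) → (Fin m → RotGroup n) → (Eucl n → ℂ) → (Eucl n → ℂ)
  | 0, _, _, f => f
  | m + 1, l, R, f =>
      cascade ψ m (Fin.tail l) (Fin.tail R)
        (fun x => ((‖convC f (dilRotWavelet ψ (l 0) (R 0)) x‖ : ℝ) : ℂ))

/-- The squared `L²(ℝⁿ)` norm. -/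
def normSqL2 {n : ℕ} (g : Eucl n → ℂ) : ℝ := ∫ x, ‖g x‖ ^ 2

/-- The rotation-invariant scattering transform with `m = k + 1` layers and `q = 2`:
`𝒮f(l₁,…,l_m,R₂,…,R_m)
  = ∫_{SO(n)} ‖ |⋯|f ∗ ψ_{l₁,R₁}| ∗ ψ_{l₂,R₂R₁}| ⋯ ∗ ψ_{l_m,R_mR₁} ‖₂² dμ(R₁)`.
The outermost modulus in `cascade` does not change the `L²` norm. -/
def rotInvScattering {n : ℕ} (μ : Measure (RotGroup n)) (ψ : Eucl n → ℂ) (k : ℕ)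
    (f : Eucl n → ℂ) (l : Fin (k + 1) → ℝ) (R : Fin k → RotGroup n) : ℝ :=
  ∫ R₁, normSqL2 (cascade ψ (k + 1) l (Fin.cons R₁ (fun i => R i * R₁)) f) ∂μ

/-- The measure `dl / l^(n+1)` on `(0,∞)`. -/
def scaleMeasure (n : ℕ) : Measure ℝ :=
  (volume.restrict (Set.Ioi 0)).withDensity (fun l => ENNReal.ofReal (1 / l ^ (n + 1)))

/-- The (possibly infinite) `L¹((0,∞)^m × SO(n)^(m-1))` norm, `m = k + 1`, with respect to
the weights `dl / l^(n+1)` and the measure `μ` on `SO(n)`. -/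
def normL1 {n : ℕ} (μ : Measure (RotGroup n)) (k : ℕ)
    (F : (Fin (k + 1) → ℝ) → (Fin k → RotGroup n) → ℝ) : ENNReal :=
  ∫⁻ l, ∫⁻ R, ‖F l R‖ₑ ∂(Measure.pi fun _ : Fin k => μ)
    ∂(Measure.pi fun _ : Fin (k + 1) => scaleMeasure n)

/-- `L_τ f(x) = f(x - τ(x))`. -/
def deform {n : ℕ} (τ : Eucl n → Eucl n) (f : Eucl n → ℂ) : Eucl n → ℂ :=
  fun x => f (x - τ x)

/-- `‖Dτ‖∞`, the supremum of the absolute values of the entries of the Jacobian. -/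
def supD {n : ℕ} (τ : Eucl n → Eucl n) : ENNReal :=
  ⨆ (x : Eucl n) (i : Fin n) (j : Fin n), ‖partialDeriv j (fun y => τ y i) x‖ₑ

/-- `‖D²τ‖∞`, the supremum of the absolute values of the second partial derivatives. -/
def supD2 {n : ℕ} (τ : Eucl n → Eucl n) : ENNReal :=
  ⨆ (x : Eucl n) (i : Fin n) (j : Fin n) (k : Fin n),
    ‖partialDeriv k (partialDeriv j (fun y => τ y i)) x‖ₑ

/-- `‖Δτ‖∞ = sup_{x,y} |τ(x) - τ(y)|`. -/
def supDelta {n : ℕ} (τ : Eucl n → Eucl n) : ENNReal :=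
  ⨆ (x : Eucl n) (y : Eucl n), ‖τ x - τ y‖ₑ

/-- `‖Dτ‖∞ + (‖Dτ‖∞ (log(‖Δτ‖∞ / ‖Dτ‖∞) ∨ 1) + ‖D²τ‖∞)²`, for finite suprema. -/
def deformationSize {n : ℕ} (τ : Eucl n → Eucl n) : ℝ :=
  (supD τ).toReal +
    ((supD τ).toReal * max (Real.log ((supDelta τ).toReal / (supD τ).toReal)) 1 +
      (supD2 τ).toReal) ^ 2

end

open scoped ENNReal ComplexConjugate

/-! ### Schur's test and a T T* bound for integral operators -/

section AbstractSchur

variable {X Y : Type*} [MeasurableSpace X] [MeasurableSpace Y]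

/-! The proof gives more than is claimed: the left side is at most `C ‖Dτ‖∞ ‖f‖₂²`. The squared term
in `deformationSize`, with the logarithm and `D²τ`, is nonnegative and is only added at the very
end.

Everything rests on one linear estimate, `lintegral_commutator_sq_le`. Write `L f(x) = f(x - τ x)`,
let `δ` bound the operator norm of `Dτ`, and let `ψ_t(z) = t⁻ⁿ ψ(z/t)`. Then `∬ |ψ_t * (L f) - L(ψ_t
* f)|² dx dt/t ≤ C δ² ‖f‖₂²`. It is proved in the manner of a `T(1)` theorem for square functions.
Changing variables `y = u - τ u` writes the commutator as the integral operator with kernel `ψ_t(x -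
u) - ψ_t((x - τ x) - (u - τ u))` acting on `L f`, plus `L(ψ_t * (β f))`, where `1 + β` is the
Jacobian of the inverse map and `|β| ≤ C δ`. The kernel has size and Hölder bounds of order `δ`,
because at scale `t` it behaves like the unit-scale kernel of the displacement `t⁻¹ τ(t ·)`, whose
derivative obeys the same bound. One derivative in `u` suffices for regularity, so only `Dτ` enters.

What the kernel lacks is mean zero. Subtracting its mean times a normalised weight leaves a kernel
with cancellation, which falls under the square function estimate `IsSquareKernel.lintegral_le`: a T
T* argument in which cancellation at the finer scale yields the factor `min(√(s/t), √(t/s))`,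
integrable for `dt/t`. The mean itself equals `-(ψ_t * β)(x - τ x)`. As `β` is bounded by `C δ`, its
square is the density of a Carleson measure (`isCarlesonMeasure`), so the remaining product of the
mean with an average of `L f` is controlled by the Carleson embedding theorem
`lintegral_bumpAvg_sq_le`, obtained from a Vitali covering argument.

The rest is soft. A rotated wavelet satisfies the same bounds, so the estimate is uniform in the
rotations. The modulus is 1-Lipschitz, hence the layers are Lipschitz in `L²` after integrating over
scales, and telescoping over the layers shows that the whole cascade commutes with `L` up to `O(δ)`.
The Jacobian of `x ↦ x - τ x` is `1 + O(δ)`, so comparing squared norms by Young's inequality with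
weight `δ` turns the error `δ²` into `δ`. Integrating over rotations by Tonelli and letting `δ`
decrease to `n ‖Dτ‖∞` finishes the proof. -/

theorem ENNReal.sq_lintegral_mul_le (μ : Measure X) {f g : X → ℝ≥0∞}
    (hf : AEMeasurable f μ) (hg : AEMeasurable g μ) :
    (∫⁻ x, f x * g x ∂μ) ^ 2 ≤ (∫⁻ x, f x ^ 2 ∂μ) * ∫⁻ x, g x ^ 2 ∂μ := by
  have h := ENNReal.lintegral_mul_le_Lp_mul_Lq μ Real.HolderConjugate.two_two hf hg
  simp only [ENNReal.rpow_ofNat, Pi.mul_apply] at h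
  calc (∫⁻ x, f x * g x ∂μ) ^ 2
      ≤ ((∫⁻ x, f x ^ 2 ∂μ) ^ (1 / 2 : ℝ) * (∫⁻ x, g x ^ 2 ∂μ) ^ (1 / 2 : ℝ)) ^ 2 := by
        gcongr
    _ = _ := by
        rw [mul_pow, ← ENNReal.rpow_natCast, ← ENNReal.rpow_natCast, ← ENNReal.rpow_mul,
          ← ENNReal.rpow_mul]
        norm_num

theorem ENNReal.sq_lintegral_mul_le_weight (μ : Measure X) {k f : X → ℝ≥0∞}
    (hk : AEMeasurable k μ) (hf : AEMeasurable f μ) :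
    (∫⁻ x, k x * f x ∂μ) ^ 2 ≤ (∫⁻ x, k x ∂μ) * ∫⁻ x, k x * f x ^ 2 ∂μ := by
  have hs : ∀ a : ℝ≥0∞, (a ^ (1 / 2 : ℝ)) ^ 2 = a := fun a => by
    rw [← ENNReal.rpow_natCast, ← ENNReal.rpow_mul]; norm_num
  have h := ENNReal.sq_lintegral_mul_le μ (f := fun x => (k x) ^ (1 / 2 : ℝ))
    (g := fun x => (k x) ^ (1 / 2 : ℝ) * f x) (hk.pow_const _) ((hk.pow_const _).mul hf)
  have e1 : ∀ x, (k x) ^ (1 / 2 : ℝ) * ((k x) ^ (1 / 2 : ℝ) * f x) = k x * f x := fun x => by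
    rw [← mul_assoc, ← sq, hs]
  simpa only [e1, mul_pow, hs] using h

/-- Schur's test: Cauchy–Schwarz against the measure with density `k ξ`, then Tonelli. -/
theorem lintegral_sq_lintegral_mul_le (κ : Measure X) (ν : Measure Y) [SFinite κ] [SFinite ν]
    {k : X → Y → ℝ≥0∞} (hk : Measurable (Function.uncurry k)) {a b : ℝ≥0∞}
    (ha : ∀ᵐ ξ ∂κ, ∫⁻ u, k ξ u ∂ν ≤ a) (hb : ∀ᵐ u ∂ν, ∫⁻ ξ, k ξ u ∂κ ≤ b)
    {f : Y → ℝ≥0∞} (hf : Measurable f) :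
    ∫⁻ ξ, (∫⁻ u, k ξ u * f u ∂ν) ^ 2 ∂κ ≤ a * b * ∫⁻ u, f u ^ 2 ∂ν := by
  have hk1 : ∀ ξ, Measurable (k ξ) := fun ξ => hk.comp measurable_prodMk_left
  have hk2 : ∀ u, Measurable (fun ξ => k ξ u) := fun u => hk.comp measurable_prodMk_right
  calc ∫⁻ ξ, (∫⁻ u, k ξ u * f u ∂ν) ^ 2 ∂κ
      ≤ ∫⁻ ξ, a * ∫⁻ u, k ξ u * f u ^ 2 ∂ν ∂κ := by
        apply lintegral_mono_ae
        filter_upwards [ha] with ξ hξ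
        exact (ENNReal.sq_lintegral_mul_le_weight ν (hk1 ξ).aemeasurable hf.aemeasurable).trans
          (by gcongr)
    _ = a * ∫⁻ u, ∫⁻ ξ, k ξ u * f u ^ 2 ∂κ ∂ν := by
        rw [lintegral_const_mul, lintegral_lintegral_swap]
        · exact (hk.mul ((hf.comp measurable_snd).pow_const 2)).aemeasurable
        · exact (hk.mul ((hf.comp measurable_snd).pow_const 2)).lintegral_prod_right
    _ ≤ a * ∫⁻ u, b * f u ^ 2 ∂ν := by
        gcongr 1
        apply lintegral_mono_ae
        filter_upwards [hb] with u hu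
        rw [lintegral_mul_const _ (hk2 u)]
        gcongr
    _ = _ := by rw [lintegral_const_mul _ (hf.pow_const 2), mul_assoc]

theorem ENNReal.two_mul_mul_le_sq_add_sq (a b : ℝ≥0∞) : 2 * (a * b) ≤ a ^ 2 + b ^ 2 := by
  rcases eq_or_ne a ⊤ with rfl | ha
  · simp
  rcases eq_or_ne b ⊤ with rfl | hb
  · simp
  lift a to NNReal using ha
  lift b to NNReal using hb
  norm_cast
  have := two_mul_le_add_sq a b
  rwa [mul_assoc] at this

/-- By `2ab ≤ a² + b²` the form splits into two halves, which symmetry of `m` makes equal; each is a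
weighted `L²` norm. This is Schur's test for the symmetric kernel of T T*. -/
theorem lintegral_lintegral_mul_mul_le (κ : Measure X) [SFinite κ]
    {m : X → X → ℝ≥0∞} (hm : Measurable (Function.uncurry m)) {B : ℝ≥0∞}
    (hB : ∀ᵐ ξ ∂κ, ∫⁻ η, m ξ η ∂κ ≤ B) (hsymm : ∀ ξ η, m ξ η = m η ξ)
    {f : X → ℝ≥0∞} (hf : Measurable f) :
    ∫⁻ ξ, ∫⁻ η, m ξ η * (f ξ * f η) ∂κ ∂κ ≤ B * ∫⁻ ξ, f ξ ^ 2 ∂κ := by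
  have hm1 : ∀ ξ, Measurable (m ξ) := fun ξ => hm.comp measurable_prodMk_left
  have key : ∫⁻ ξ, ∫⁻ η, m ξ η * f ξ ^ 2 ∂κ ∂κ ≤ B * ∫⁻ ξ, f ξ ^ 2 ∂κ := by
    rw [← lintegral_const_mul _ (hf.pow_const 2)]
    apply lintegral_mono_ae
    filter_upwards [hB] with ξ hξ
    rw [lintegral_mul_const _ (hm1 ξ)]
    gcongr
  have key2 : ∫⁻ ξ, ∫⁻ η, m ξ η * f η ^ 2 ∂κ ∂κ ≤ B * ∫⁻ ξ, f ξ ^ 2 ∂κ := by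
    rw [lintegral_lintegral_swap
      (hm.mul ((hf.comp measurable_snd).pow_const 2)).aemeasurable]
    simpa only [hsymm] using key
  have h2 : 2 * ∫⁻ ξ, ∫⁻ η, m ξ η * (f ξ * f η) ∂κ ∂κ ≤ 2 * (B * ∫⁻ ξ, f ξ ^ 2 ∂κ) := by
    have hmeas1 : Measurable (fun p : X × X => m p.1 p.2 * f p.1 ^ 2) :=
      hm.mul ((hf.comp measurable_fst).pow_const 2)
    have hmeas : Measurable (fun p : X × X => m p.1 p.2 * (f p.1 * f p.2)) :=
      hm.mul ((hf.comp measurable_fst).mul (hf.comp measurable_snd))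
    calc 2 * ∫⁻ ξ, ∫⁻ η, m ξ η * (f ξ * f η) ∂κ ∂κ
        = ∫⁻ ξ, ∫⁻ η, 2 * (m ξ η * (f ξ * f η)) ∂κ ∂κ := by
          rw [← lintegral_const_mul _ hmeas.lintegral_prod_right]
          congr 1; ext ξ
          exact (lintegral_const_mul _ (hmeas.comp measurable_prodMk_left)).symm
      _ ≤ ∫⁻ ξ, ∫⁻ η, (m ξ η * f ξ ^ 2 + m ξ η * f η ^ 2) ∂κ ∂κ := by
          gcongr with ξ η
          rw [← mul_add, mul_left_comm]
          gcongr
          exact ENNReal.two_mul_mul_le_sq_add_sq _ _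
      _ = (∫⁻ ξ, ∫⁻ η, m ξ η * f ξ ^ 2 ∂κ ∂κ) + ∫⁻ ξ, ∫⁻ η, m ξ η * f η ^ 2 ∂κ ∂κ := by
          rw [← lintegral_add_left hmeas1.lintegral_prod_right]
          congr 1; ext ξ
          exact lintegral_add_left (hmeas1.comp measurable_prodMk_left) _
      _ ≤ 2 * (B * ∫⁻ ξ, f ξ ^ 2 ∂κ) := by rw [two_mul]; gcongr
  exact (ENNReal.mul_le_mul_iff_right (by simp) (by simp)).1 h2

/-- The kernel of `T T*` for the integral operator `T` with kernel `K`. -/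
noncomputable def gramKernel {Z : Type*} (ν : Measure Y) (K : Z → Y → ℂ) (ξ η : Z) : ℂ := ∫ u, K ξ u * conj (K η u) ∂ν

theorem enorm_gramKernel_symm {Z : Type*} (ν : Measure Y) (K : Z → Y → ℂ) (ξ η : Z) :
    ‖gramKernel ν K ξ η‖ₑ = ‖gramKernel ν K η ξ‖ₑ := by
  have : gramKernel ν K ξ η = conj (gramKernel ν K η ξ) := by
    rw [gramKernel, gramKernel, ← integral_conj]
    congr 1; ext u; simp [mul_comm]
  rw [this]
  simp [enorm_eq_nnnorm]

/-- A quantitative `T T*` argument for integral operators. -/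
theorem lintegral_sq_integral_le_of_gramKernel (κ : Measure X) (ν : Measure Y)
    [SigmaFinite κ] [SigmaFinite ν]
    {K : X → Y → ℂ} (hK : Measurable (Function.uncurry K)) {a b B : ℝ≥0∞}
    (ha : ∀ᵐ ξ ∂κ, ∫⁻ u, ‖K ξ u‖ₑ ∂ν ≤ a) (hb : ∀ᵐ u ∂ν, ∫⁻ ξ, ‖K ξ u‖ₑ ∂κ ≤ b)
    (ha' : a ≠ ⊤) (hb' : b ≠ ⊤)
    (hB : ∀ᵐ ξ ∂κ, ∫⁻ η, ‖gramKernel ν K ξ η‖ₑ ∂κ ≤ B)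
    {f : Y → ℂ} (hf : Measurable f) (hf2 : ∫⁻ u, ‖f u‖ₑ ^ 2 ∂ν ≠ ⊤) :
    ∫⁻ ξ, ‖∫ u, K ξ u * f u ∂ν‖ₑ ^ 2 ∂κ ≤ B * ∫⁻ u, ‖f u‖ₑ ^ 2 ∂ν := by
  -- `F = T f` and `G = T* F`. The chain is `‖F‖² = ⟨f, G⟩ ≤ ‖f‖ ‖G‖` and `‖G‖² = ⟨T T* F, F⟩ ≤ B
  -- ‖F‖²`.
  set F : X → ℂ := fun ξ => ∫ u, K ξ u * f u ∂ν with hF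
  set G : Y → ℂ := fun u => ∫ ξ, conj (K ξ u) * F ξ ∂κ with hG
  have hK1 : ∀ ξ, Measurable (K ξ) := fun ξ => hK.comp measurable_prodMk_left
  have hK2 : ∀ u, Measurable (fun ξ => K ξ u) := fun u => hK.comp measurable_prodMk_right
  have hFm : Measurable F :=
    ((hK.mul (hf.comp measurable_snd)).stronglyMeasurable.integral_prod_right).measurable
  have hconj : Measurable (fun z : ℂ => conj z) := Complex.continuous_conj.measurable
  have hKc : Measurable (fun p : Y × X => conj (K p.2 p.1)) :=
    hconj.comp (hK.comp measurable_swap)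
  have hGm : Measurable G :=
    ((hKc.mul (hFm.comp measurable_snd)).stronglyMeasurable.integral_prod_right).measurable
  have hKe : Measurable (fun p : X × Y => ‖K p.1 p.2‖ₑ) := hK.enorm
  have hKe' : Measurable (fun p : Y × X => ‖K p.2 p.1‖ₑ) := (hK.comp measurable_swap).enorm
  have enc : ∀ z : ℂ, ‖conj z‖ₑ = ‖z‖ₑ := fun z => by simp [enorm_eq_nnnorm]
  -- The Schur constants `a`, `b` serve only to make the integrals finite, which justifies Fubini
  -- and the final cancellation; they do not enter the bound.
  have hT : ∫⁻ ξ, (∫⁻ u, ‖K ξ u‖ₑ * ‖f u‖ₑ ∂ν) ^ 2 ∂κ ≤ a * b * ∫⁻ u, ‖f u‖ₑ ^ 2 ∂ν :=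
    lintegral_sq_lintegral_mul_le κ ν (k := fun ξ u => ‖K ξ u‖ₑ) hKe ha hb hf.enorm
  have hFle : ∀ ξ, ‖F ξ‖ₑ ≤ ∫⁻ u, ‖K ξ u‖ₑ * ‖f u‖ₑ ∂ν := fun ξ => by
    refine (enorm_integral_le_lintegral_enorm _).trans_eq ?_
    simp only [enorm_mul]
  have hN : ∫⁻ ξ, ‖F ξ‖ₑ ^ 2 ∂κ ≠ ⊤ := by
    refine ne_top_of_le_ne_top (ENNReal.mul_ne_top (ENNReal.mul_ne_top ha' hb') hf2)
      (le_trans (lintegral_mono fun ξ => ?_) hT)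
    gcongr
    exact hFle ξ
  have hT' : ∫⁻ u, (∫⁻ ξ, ‖K ξ u‖ₑ * ‖F ξ‖ₑ ∂κ) ^ 2 ∂ν ≤ b * a * ∫⁻ ξ, ‖F ξ‖ₑ ^ 2 ∂κ :=
    lintegral_sq_lintegral_mul_le ν κ (k := fun u ξ => ‖K ξ u‖ₑ) hKe' hb ha hFm.enorm
  have hT'fin : ∫⁻ u, (∫⁻ ξ, ‖K ξ u‖ₑ * ‖F ξ‖ₑ ∂κ) ^ 2 ∂ν ≠ ⊤ :=
    ne_top_of_le_ne_top (ENNReal.mul_ne_top (ENNReal.mul_ne_top hb' ha') hN) hT'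
  have hF_le : ∫⁻ ξ, ‖F ξ‖ₑ ^ 2 ∂κ ≤ ∫⁻ u, ‖f u‖ₑ * ‖G u‖ₑ ∂ν := by
    have hint : Integrable (fun p : X × Y => conj (F p.1) * (K p.1 p.2 * f p.2)) (κ.prod ν) := by
      refine ⟨(((hconj.comp (hFm.comp measurable_fst)).mul
        (hK.mul (hf.comp measurable_snd)))).aestronglyMeasurable, ?_⟩
      rw [hasFiniteIntegral_iff_enorm, lintegral_prod]
      · refine lt_of_le_of_lt ?_ (b := ∫⁻ ξ, ‖F ξ‖ₑ * ∫⁻ u, ‖K ξ u‖ₑ * ‖f u‖ₑ ∂ν ∂κ) ?_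
        · apply lintegral_mono
          intro ξ
          simp only [enorm_mul, enc]
          rw [lintegral_const_mul]
          exact (hK1 ξ).enorm.mul hf.enorm
        · have := ENNReal.sq_lintegral_mul_le κ (f := fun ξ => ‖F ξ‖ₑ)
            (g := fun ξ => ∫⁻ u, ‖K ξ u‖ₑ * ‖f u‖ₑ ∂ν) hFm.enorm.aemeasurable
            (hKe.mul (hf.enorm.comp measurable_snd)).lintegral_prod_right.aemeasurable
          rw [lt_top_iff_ne_top]
          intro h
          rw [h] at this
          have h3 : (∫⁻ ξ, ‖F ξ‖ₑ ^ 2 ∂κ) * ∫⁻ ξ, (∫⁻ u, ‖K ξ u‖ₑ * ‖f u‖ₑ ∂ν) ^ 2 ∂κ ≠ ⊤ :=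
            ENNReal.mul_ne_top hN (ne_top_of_le_ne_top
              (ENNReal.mul_ne_top (ENNReal.mul_ne_top ha' hb') hf2) hT)
          simp at this
          exact h3 this
      · exact (((hconj.comp (hFm.comp measurable_fst)).mul
          (hK.mul (hf.comp measurable_snd)))).enorm.aemeasurable
    have e1 : ((∫⁻ ξ, ‖F ξ‖ₑ ^ 2 ∂κ).toReal : ℂ) = ∫ u, f u * conj (G u) ∂ν := by
      have : (∫⁻ ξ, ‖F ξ‖ₑ ^ 2 ∂κ).toReal = ∫ ξ, ‖F ξ‖ ^ 2 ∂κ := by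
        rw [integral_eq_lintegral_of_nonneg_ae (Filter.Eventually.of_forall fun _ => by positivity)
          (hFm.norm.pow_const 2).aestronglyMeasurable]
        congr 2; ext ξ
        rw [ENNReal.ofReal_pow (norm_nonneg _), ofReal_norm]
      rw [this, ← integral_complex_ofReal]
      calc ∫ ξ, ((‖F ξ‖ ^ 2 : ℝ) : ℂ) ∂κ = ∫ ξ, ∫ u, conj (F ξ) * (K ξ u * f u) ∂ν ∂κ := by
            congr 1; ext ξ
            rw [integral_const_mul]
            change _ = conj (F ξ) * F ξ
            rw [← Complex.normSq_eq_conj_mul_self, Complex.normSq_eq_norm_sq]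
        _ = ∫ u, ∫ ξ, conj (F ξ) * (K ξ u * f u) ∂κ ∂ν := integral_integral_swap hint
        _ = _ := by
            congr 1; ext u
            rw [hG]
            simp only
            rw [← integral_conj, ← integral_const_mul]
            congr 1; ext ξ
            simp; ring
    calc ∫⁻ ξ, ‖F ξ‖ₑ ^ 2 ∂κ = ‖((∫⁻ ξ, ‖F ξ‖ₑ ^ 2 ∂κ).toReal : ℂ)‖ₑ := by
          rw [← ofReal_norm, Complex.norm_real, Real.norm_eq_abs, abs_of_nonneg
            ENNReal.toReal_nonneg, ENNReal.ofReal_toReal hN]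
      _ ≤ ∫⁻ u, ‖f u * conj (G u)‖ₑ ∂ν := by
          rw [e1]; exact enorm_integral_le_lintegral_enorm _
      _ = _ := by simp only [enorm_mul, enc]
  have hG_le : ∫⁻ u, ‖G u‖ₑ ^ 2 ∂ν ≤ B * ∫⁻ ξ, ‖F ξ‖ₑ ^ 2 ∂κ := by
    have hGle : ∀ u, ‖G u‖ₑ ≤ ∫⁻ ξ, ‖K ξ u‖ₑ * ‖F ξ‖ₑ ∂κ := fun u => by
      refine (enorm_integral_le_lintegral_enorm _).trans_eq ?_
      simp only [enorm_mul, enc]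
    have hGN : ∫⁻ u, ‖G u‖ₑ ^ 2 ∂ν ≠ ⊤ := by
      refine ne_top_of_le_ne_top hT'fin (lintegral_mono fun u => ?_)
      gcongr
      exact hGle u
    let H : Y → X × X → ℂ := fun u p =>
      (conj (K p.1 u) * F p.1) * (K p.2 u * conj (F p.2))
    have hHm : Measurable (Function.uncurry H) := by
      have a1 : Measurable (fun q : Y × (X × X) => K q.2.1 q.1) :=
        hK.comp ((measurable_fst.comp measurable_snd).prodMk measurable_fst)
      have a2 : Measurable (fun q : Y × (X × X) => K q.2.2 q.1) :=
        hK.comp ((measurable_snd.comp measurable_snd).prodMk measurable_fst)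
      exact ((hconj.comp a1).mul (hFm.comp (measurable_fst.comp measurable_snd))).mul
        (a2.mul (hconj.comp (hFm.comp (measurable_snd.comp measurable_snd))))
    have hint : Integrable (Function.uncurry H) (ν.prod (κ.prod κ)) := by
      refine ⟨hHm.aestronglyMeasurable, ?_⟩
      rw [hasFiniteIntegral_iff_enorm, lintegral_prod _ hHm.enorm.aemeasurable]
      refine lt_of_le_of_lt (le_of_eq ?_) hT'fin.lt_top
      congr 1; ext u
      simp only [Function.uncurry, H, enorm_mul, enc]
      rw [lintegral_prod_mul (f := fun ξ => ‖K ξ u‖ₑ * ‖F ξ‖ₑ) (g := fun ξ => ‖K ξ u‖ₑ * ‖F ξ‖ₑ)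
        ((hK2 u).enorm.mul hFm.enorm).aemeasurable ((hK2 u).enorm.mul hFm.enorm).aemeasurable, sq]
    have e1 : ((∫⁻ u, ‖G u‖ₑ ^ 2 ∂ν).toReal : ℂ) =
        ∫ p : X × X, (F p.1 * conj (F p.2)) * gramKernel ν K p.2 p.1 ∂(κ.prod κ) := by
      have : (∫⁻ u, ‖G u‖ₑ ^ 2 ∂ν).toReal = ∫ u, ‖G u‖ ^ 2 ∂ν := by
        rw [integral_eq_lintegral_of_nonneg_ae (Filter.Eventually.of_forall fun _ => by positivity)
          (hGm.norm.pow_const 2).aestronglyMeasurable]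
        congr 2; ext ξ
        rw [ENNReal.ofReal_pow (norm_nonneg _), ofReal_norm]
      rw [this, ← integral_complex_ofReal]
      calc ∫ u, ((‖G u‖ ^ 2 : ℝ) : ℂ) ∂ν = ∫ u, ∫ p, H u p ∂(κ.prod κ) ∂ν := by
            congr 1; ext u
            simp only [H]
            rw [integral_prod_mul (fun ξ => conj (K ξ u) * F ξ) (fun ξ => K ξ u * conj (F ξ))]
            have : ∫ ξ, K ξ u * conj (F ξ) ∂κ = conj (G u) := by
              rw [hG]; simp only; rw [← integral_conj]; congr 1; ext ξ; simp
            rw [this]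
            change _ = G u * conj (G u)
            rw [mul_comm, ← Complex.normSq_eq_conj_mul_self, Complex.normSq_eq_norm_sq]
        _ = ∫ p, ∫ u, H u p ∂ν ∂(κ.prod κ) := integral_integral_swap hint
        _ = _ := by
            congr 1; ext p
            rw [gramKernel, ← integral_const_mul]
            congr 1; ext u
            simp only [H]; ring
    have hgm : Measurable (Function.uncurry (gramKernel ν K)) := by
      have a1 : Measurable (fun q : (X × X) × Y => K q.1.1 q.2) :=
        hK.comp ((measurable_fst.comp measurable_fst).prodMk measurable_snd)
      have a2 : Measurable (fun q : (X × X) × Y => K q.1.2 q.2) :=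
        hK.comp ((measurable_snd.comp measurable_fst).prodMk measurable_snd)
      exact ((a1.mul (hconj.comp a2)).stronglyMeasurable.integral_prod_right).measurable
    calc ∫⁻ u, ‖G u‖ₑ ^ 2 ∂ν = ‖((∫⁻ u, ‖G u‖ₑ ^ 2 ∂ν).toReal : ℂ)‖ₑ := by
          rw [← ofReal_norm, Complex.norm_real, Real.norm_eq_abs, abs_of_nonneg
            ENNReal.toReal_nonneg, ENNReal.ofReal_toReal hGN]
      _ ≤ ∫⁻ p : X × X, ‖gramKernel ν K p.1 p.2‖ₑ * (‖F p.1‖ₑ * ‖F p.2‖ₑ) ∂(κ.prod κ) := by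
          rw [e1]; refine (enorm_integral_le_lintegral_enorm _).trans_eq ?_
          congr 1; ext p
          rw [enorm_mul, enorm_mul, enc, mul_comm, enorm_gramKernel_symm]
      _ = ∫⁻ ξ, ∫⁻ η, ‖gramKernel ν K ξ η‖ₑ * (‖F ξ‖ₑ * ‖F η‖ₑ) ∂κ ∂κ := by
          rw [lintegral_prod]
          exact (hgm.enorm.mul ((hFm.comp measurable_fst).enorm.mul
            (hFm.comp measurable_snd).enorm)).aemeasurable
      _ ≤ _ := lintegral_lintegral_mul_mul_le κ
          (m := fun ξ η => ‖gramKernel ν K ξ η‖ₑ) hgm.enorm hB (enorm_gramKernel_symm ν K) hFm.enorm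
  -- This reads `‖F‖⁴ ≤ B ‖f‖² ‖F‖²`; one factor `‖F‖²` cancels since it is finite, the value zero
  -- being trivial.
  have h3 : (∫⁻ ξ, ‖F ξ‖ₑ ^ 2 ∂κ) ^ 2 ≤
      (∫⁻ u, ‖f u‖ₑ ^ 2 ∂ν) * (B * ∫⁻ ξ, ‖F ξ‖ₑ ^ 2 ∂κ) := by
    calc _ ≤ (∫⁻ u, ‖f u‖ₑ * ‖G u‖ₑ ∂ν) ^ 2 := by gcongr
      _ ≤ _ := ENNReal.sq_lintegral_mul_le ν hf.enorm.aemeasurable hGm.enorm.aemeasurable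
      _ ≤ _ := by gcongr
  rcases eq_or_ne (∫⁻ ξ, ‖F ξ‖ₑ ^ 2 ∂κ) 0 with h0 | h0
  · rw [h0]; exact zero_le
  · rw [sq, ← mul_assoc] at h3
    have := (ENNReal.mul_le_mul_iff_left h0 hN).1 h3
    rwa [mul_comm B]

end AbstractSchur

/-! ### Weights with tails of order n + 1 and their moments -/

section Weights

/-- The `L¹`-normalised weight `t⁻ⁿ (1 + |z|/t)^(-n-1)`. -/
noncomputable def bump {n : ℕ} (t : ℝ) (z : Eucl n) : ℝ :=
  (t ^ n)⁻¹ * ((1 + ‖z‖ / t) ^ (n + 1))⁻¹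

theorem bump_nonneg {n : ℕ} {t : ℝ} (ht : 0 < t) (z : Eucl n) : 0 ≤ bump t z := by
  unfold bump; positivity

theorem bump_pos {n : ℕ} {t : ℝ} (ht : 0 < t) (z : Eucl n) : 0 < bump t z := by
  unfold bump; positivity

theorem bump_le {n : ℕ} {t : ℝ} (ht : 0 < t) (z : Eucl n) : bump t z ≤ (t ^ n)⁻¹ := by
  unfold bump
  apply mul_le_of_le_one_right (by positivity)
  apply inv_le_one_of_one_le₀
  apply one_le_pow₀
  have : 0 ≤ ‖z‖ / t := by positivity
  linarith

theorem measurable_bump {n : ℕ} : Measurable (fun p : ℝ × Eucl n => bump p.1 p.2) := by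
  unfold bump; fun_prop

theorem bump_eq_scaled {n : ℕ} {t : ℝ} (ht : 0 < t) (z : Eucl n) :
    bump t z = (t ^ n)⁻¹ * bump 1 (t⁻¹ • z) := by
  simp only [bump, norm_smul, norm_inv, Real.norm_eq_abs, abs_of_pos ht]
  simp [div_eq_inv_mul]

/-- Bernoulli's inequality for `(a/b)^(n+1)`, with `a ≤ b` the two values of `1 + ‖·‖/t`: the
relative decrease of the weight is at most `(n+1)(b - a)`. -/
theorem bump_sub_bump_le {n : ℕ} {t : ℝ} (ht : 0 < t) (z z' : Eucl n) :
    |bump t z - bump t z'| ≤ (n + 1) * (‖z - z'‖ / t) * (bump t z + bump t z') := by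
  wlog h : ‖z‖ ≤ ‖z'‖ generalizing z z'
  · rw [abs_sub_comm, norm_sub_rev, add_comm (bump t z)]
    exact this z' z (not_le.1 h).le
  have ha : 0 < 1 + ‖z‖ / t := by positivity
  have hb : 0 < 1 + ‖z'‖ / t := by positivity
  have hab : 1 + ‖z‖ / t ≤ 1 + ‖z'‖ / t := by gcongr
  have key : ∀ a b : ℝ, 0 < a → a ≤ b → 1 ≤ a →
      (a ^ (n + 1))⁻¹ - (b ^ (n + 1))⁻¹ ≤ (n + 1) * (b - a) * (a ^ (n + 1))⁻¹ := by
    intro a b ha hab h1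
    have hb : 0 < b := ha.trans_le hab
    have h := one_add_mul_le_pow (a := a / b - 1) (by have : 0 < a / b := by positivity
                                                      linarith) (n + 1)
    have e : 1 + (a / b - 1) = a / b := by ring
    rw [e, div_pow] at h
    have h2 : (b - a) / b ≤ b - a := div_le_self (by linarith) (h1.trans hab)
    have h3 : 1 - (n + 1) * (b - a) ≤ a ^ (n + 1) / b ^ (n + 1) := by
      have : a / b - 1 = - ((b - a) / b) := by field_simp; ring
      rw [this] at h
      push_cast at h
      nlinarith [h2, (by positivity : (0 : ℝ) ≤ n + 1)]
    have h4 : (b ^ (n + 1))⁻¹ = (a ^ (n + 1) / b ^ (n + 1)) * (a ^ (n + 1))⁻¹ := by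
      field_simp
    rw [h4]
    have h5 : 0 < (a ^ (n + 1))⁻¹ := by positivity
    nlinarith
  have h1 := key _ _ ha hab (by have : 0 ≤ ‖z‖ / t := by positivity
                                linarith)
  have h6 : bump t z' ≤ bump t z := by
    unfold bump; gcongr
  rw [abs_of_nonneg (by linarith)]
  have h7 : bump t z - bump t z' ≤ (n + 1) * (‖z - z'‖ / t) * bump t z := by
    have : bump t z - bump t z' = (t ^ n)⁻¹ *
        (((1 + ‖z‖ / t) ^ (n + 1))⁻¹ - ((1 + ‖z'‖ / t) ^ (n + 1))⁻¹) := by unfold bump; ring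
    rw [this]
    calc _ ≤ (t ^ n)⁻¹ * ((n + 1) * (1 + ‖z'‖ / t - (1 + ‖z‖ / t)) *
          ((1 + ‖z‖ / t) ^ (n + 1))⁻¹) := by gcongr
      _ ≤ (t ^ n)⁻¹ * ((n + 1) * (‖z - z'‖ / t) * ((1 + ‖z‖ / t) ^ (n + 1))⁻¹) := by
          gcongr
          have : ‖z'‖ - ‖z‖ ≤ ‖z - z'‖ := by
            rw [norm_sub_rev]; exact norm_sub_norm_le z' z
          calc 1 + ‖z'‖ / t - (1 + ‖z‖ / t) = (‖z'‖ - ‖z‖) / t := by ring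
            _ ≤ _ := by gcongr
      _ = _ := by unfold bump; ring
  have h8 := bump_nonneg ht z'
  have h9 : 0 ≤ (n + 1) * (‖z - z'‖ / t) * bump t z' := by positivity
  nlinarith

theorem lintegral_comp_inv_smul {n : ℕ} {t : ℝ} (ht : 0 < t) {φ : Eucl n → ℝ≥0∞}
    (hφ : Measurable φ) :
    ∫⁻ z, φ (t⁻¹ • z) = ENNReal.ofReal (t ^ n) * ∫⁻ z, φ z := by
  rw [← lintegral_map hφ (measurable_const_smul t⁻¹),
    Measure.map_addHaar_smul volume (inv_ne_zero ht.ne'), lintegral_smul_measure, smul_eq_mul]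
  congr 2
  simp [abs_of_pos ht]

/-- The total mass of the weight `bump`. -/
noncomputable def bumpMass (n : ℕ) : ℝ≥0∞ := ∫⁻ z : Eucl n, ENNReal.ofReal (bump 1 z)

/-- The moment of order `1/2` of the weight `bump`. -/
noncomputable def bumpMoment (n : ℕ) : ℝ≥0∞ :=
  ∫⁻ z : Eucl n, ENNReal.ofReal (bump 1 z * √‖z‖)

theorem measurable_bump_right {n : ℕ} (t : ℝ) : Measurable (fun z : Eucl n => bump t z) :=
  measurable_bump.comp measurable_prodMk_left

theorem lintegral_scaled {n : ℕ} {t : ℝ} (ht : 0 < t) {φ : Eucl n → ℝ}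
    (hφ : Measurable φ) :
    ∫⁻ z, ENNReal.ofReal ((t ^ n)⁻¹ * φ (t⁻¹ • z)) = ∫⁻ z, ENNReal.ofReal (φ z) := by
  have h0 : (0 : ℝ) ≤ (t ^ n)⁻¹ := by positivity
  simp only [ENNReal.ofReal_mul h0]
  have hm : Measurable (fun z : Eucl n => ENNReal.ofReal (φ (t⁻¹ • z))) :=
    (hφ.comp (measurable_const_smul t⁻¹)).ennreal_ofReal
  rw [lintegral_const_mul _ hm,
    lintegral_comp_inv_smul ht hφ.ennreal_ofReal, ← mul_assoc, ← ENNReal.ofReal_mul h0,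
    inv_mul_cancel₀ (by positivity)]
  simp

theorem lintegral_bump {n : ℕ} {t : ℝ} (ht : 0 < t) :
    ∫⁻ z : Eucl n, ENNReal.ofReal (bump t z) = bumpMass n := by
  rw [bumpMass, ← lintegral_scaled ht (measurable_bump_right 1)]
  simp only [← bump_eq_scaled ht]

theorem lintegral_bump_mul_sqrt {n : ℕ} {s t : ℝ} (hs : 0 < s) (ht : 0 < t) :
    ∫⁻ z : Eucl n, ENNReal.ofReal (bump s z * √(‖z‖ / t)) =
      ENNReal.ofReal √(s / t) * bumpMoment n := by
  have hm : Measurable (fun z : Eucl n => bump 1 z * √‖z‖) :=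
    (measurable_bump_right 1).mul measurable_norm.sqrt
  rw [bumpMoment, ← lintegral_scaled hs hm, ← lintegral_const_mul]
  · congr 1; ext z
    rw [← ENNReal.ofReal_mul (Real.sqrt_nonneg _)]
    congr 1
    rw [bump_eq_scaled hs, norm_smul, norm_inv, Real.norm_eq_abs, abs_of_pos hs]
    have : ‖z‖ / t = (s / t) * (s⁻¹ * ‖z‖) := by field_simp
    rw [this, Real.sqrt_mul (by positivity)]
    ring
  · have : Measurable (fun z : Eucl n => s⁻¹ • z) := measurable_const_smul s⁻¹
    exact ((hm.comp this).const_mul _).ennreal_ofReal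

theorem bumpMass_ne_top (n : ℕ) : bumpMass n ≠ ⊤ := by
  have h := (integrable_one_add_norm (E := Eucl n) (μ := volume) (r := n + 1) (by simp)).lintegral_lt_top
  refine ne_of_lt (lt_of_le_of_lt (le_of_eq ?_) h)
  unfold bumpMass bump
  congr 1; ext z
  congr 1
  rw [Real.rpow_neg (by positivity)]
  norm_cast
  simp

theorem bumpMass_ne_zero (n : ℕ) : bumpMass n ≠ 0 := by
  unfold bumpMass
  rw [Ne, lintegral_eq_zero_iff (measurable_bump_right 1).ennreal_ofReal]
  intro h
  have : ∀ᵐ z : Eucl n, False := by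
    filter_upwards [h] with z hz
    simp only [Pi.zero_apply, ENNReal.ofReal_eq_zero] at hz
    exact absurd (bump_pos one_pos z) (not_lt.2 hz)
  simp only [Filter.eventually_false_iff_eq_bot, ae_eq_bot] at this
  exact NeZero.ne _ this

/-- The integrand decays like `‖z‖^(-n-1/2)`. The first moment diverges logarithmically when `n ≥
1`, which is why Hölder exponent `1/2` is used for the kernels instead of Lipschitz regularity. -/
theorem bumpMoment_ne_top (n : ℕ) : bumpMoment n ≠ ⊤ := by
  have h := (integrable_one_add_norm (E := Eucl n) (μ := volume) (r := n + 1 / 2)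
    (by simp)).lintegral_lt_top
  refine ne_of_lt (lt_of_le_of_lt (lintegral_mono fun z => ENNReal.ofReal_le_ofReal ?_) h)
  unfold bump
  have h1 : (0 : ℝ) < 1 + ‖z‖ := by positivity
  have e : (1 + ‖z‖) ^ (-((n : ℝ) + 1 / 2)) = ((1 + ‖z‖) ^ (n + 1))⁻¹ * √(1 + ‖z‖) := by
    rw [Real.sqrt_eq_rpow, ← Real.rpow_natCast, ← Real.rpow_neg h1.le, ← Real.rpow_add h1]
    congr 1; push_cast; ring
  rw [e]
  simp only [one_pow, inv_one, one_mul, div_one]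
  gcongr
  linarith

theorem integrable_bump {n : ℕ} {t : ℝ} (ht : 0 < t) : Integrable (fun z : Eucl n => bump t z) := by
  refine ⟨(measurable_bump_right t).aestronglyMeasurable, ?_⟩
  rw [hasFiniteIntegral_iff_ofReal (Filter.Eventually.of_forall fun z => bump_nonneg ht z),
    lintegral_bump ht]
  exact (bumpMass_ne_top n).lt_top

theorem lintegral_bump_sub_left {n : ℕ} {t : ℝ} (ht : 0 < t) (x : Eucl n) :
    ∫⁻ u, ENNReal.ofReal (bump t (x - u)) = bumpMass n := by
  rw [lintegral_sub_left_eq_self (fun z => ENNReal.ofReal (bump t z)), lintegral_bump ht]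

theorem lintegral_bump_sub_right {n : ℕ} {t : ℝ} (ht : 0 < t) (u : Eucl n) :
    ∫⁻ x, ENNReal.ofReal (bump t (x - u)) = bumpMass n := by
  rw [lintegral_sub_right_eq_self (fun z => ENNReal.ofReal (bump t z)), lintegral_bump ht]

end Weights

/-! ### The scale measure dt/t -/

section LogMeasure

/-- The measure `dt / t` on `(0,∞)`. -/
noncomputable def logMeasure : Measure ℝ :=
  (volume.restrict (Set.Ioi 0)).withDensity (fun t => ENNReal.ofReal t⁻¹)

theorem lintegral_logMeasure {φ : ℝ → ℝ≥0∞} (hφ : Measurable φ) :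
    ∫⁻ t, φ t ∂logMeasure = ∫⁻ t in Set.Ioi 0, ENNReal.ofReal t⁻¹ * φ t := by
  unfold logMeasure
  rw [lintegral_withDensity_eq_lintegral_mul _ measurable_inv.ennreal_ofReal hφ]
  rfl

theorem ae_pos_logMeasure : ∀ᵐ t ∂logMeasure, 0 < t := by
  have h : logMeasure ≪ volume.restrict (Set.Ioi 0) := withDensity_absolutelyContinuous _ _
  exact h.ae_le (ae_restrict_mem measurableSet_Ioi)

instance : SigmaFinite logMeasure := by
  unfold logMeasure; infer_instance

/-- An exhaustion of `(0,∞)` by compact intervals. -/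
def logInterval (N : ℕ) : Set ℝ := Set.Icc ((N : ℝ) + 1)⁻¹ (N + 1)

/-- On a compact range of scales the operators satisfy Schur's test with finite constants, as the T
T* lemma requires. -/
theorem logMeasure_logInterval_ne_top (N : ℕ) : logMeasure (logInterval N) ≠ ⊤ := by
  unfold logMeasure logInterval
  rw [withDensity_apply _ measurableSet_Icc]
  have : ∫⁻ t in Set.Icc ((N : ℝ) + 1)⁻¹ (N + 1), ENNReal.ofReal t⁻¹ ∂(volume.restrict (Set.Ioi 0))
      ≤ ∫⁻ t in Set.Icc ((N : ℝ) + 1)⁻¹ (N + 1), ENNReal.ofReal (N + 1)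
        ∂(volume.restrict (Set.Ioi 0)) := by
    apply setLIntegral_mono measurable_const
    intro t ht
    apply ENNReal.ofReal_le_ofReal
    rw [inv_le_comm₀ (lt_of_lt_of_le (by positivity) ht.1) (by positivity)]
    exact ht.1
  refine ne_top_of_le_ne_top ?_ this
  rw [lintegral_const]
  refine ENNReal.mul_ne_top ENNReal.ofReal_ne_top ?_
  rw [Measure.restrict_apply_univ]
  exact ne_top_of_le_ne_top (by simp) (Measure.restrict_apply_le _ _)

theorem iUnion_logInterval : ⋃ N, logInterval N = Set.Ioi 0 := by
  ext t
  simp only [Set.mem_iUnion, logInterval, Set.mem_Icc, Set.mem_Ioi]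
  constructor
  · rintro ⟨N, h, -⟩
    exact lt_of_lt_of_le (by positivity) h
  · intro ht
    obtain ⟨N, hN⟩ := exists_nat_gt (max t t⁻¹)
    refine ⟨N, ?_, ?_⟩
    · rw [inv_le_comm₀ (by positivity) ht]
      linarith [le_max_right t t⁻¹]
    · linarith [le_max_left t t⁻¹]

theorem monotone_logInterval : Monotone logInterval := by
  intro M N h
  apply Set.Icc_subset_Icc
  · gcongr
  · gcongr

theorem logMeasure_restrict_Ioi : logMeasure.restrict (Set.Ioi 0) = logMeasure :=
  Measure.restrict_eq_self_of_ae_mem ae_pos_logMeasure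

theorem lintegral_sqrt_logMeasure_Ioc {s : ℝ} (hs : 0 < s) :
    ∫⁻ t in Set.Ioc 0 s, ENNReal.ofReal √(t / s) ∂logMeasure ≤ 2 := by
  have hm : Measurable (fun t : ℝ => (Set.Ioc 0 s).indicator (fun t => ENNReal.ofReal √(t / s)) t) :=
    ((measurable_id.div_const s).sqrt.ennreal_ofReal).indicator measurableSet_Ioc
  rw [← lintegral_indicator measurableSet_Ioc, lintegral_logMeasure hm]
  have hii : IntervalIntegrable (fun t : ℝ => t ^ (-(1 / 2) : ℝ)) volume 0 s :=
    intervalIntegral.intervalIntegrable_rpow' (by norm_num)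
  have hint : IntegrableOn (fun t : ℝ => s ^ (-(1 / 2) : ℝ) * t ^ (-(1 / 2) : ℝ)) (Set.Ioc 0 s) :=
    ((intervalIntegrable_iff_integrableOn_Ioc_of_le hs.le).1 hii).const_mul _
  calc ∫⁻ t in Set.Ioi 0, ENNReal.ofReal t⁻¹ *
        (Set.Ioc 0 s).indicator (fun t => ENNReal.ofReal √(t / s)) t
      ≤ ∫⁻ t in Set.Ioc 0 s, ENNReal.ofReal (s ^ (-(1 / 2) : ℝ) * t ^ (-(1 / 2) : ℝ)) := by
        rw [← lintegral_indicator measurableSet_Ioi, ← lintegral_indicator measurableSet_Ioc]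
        apply lintegral_mono
        intro t
        by_cases h : t ∈ Set.Ioc 0 s
        · have h0 : 0 < t := h.1
          rw [Set.indicator_of_mem h, Set.indicator_of_mem (show t ∈ Set.Ioi 0 from h0),
            Set.indicator_of_mem h, ← ENNReal.ofReal_mul (by positivity)]
          apply ENNReal.ofReal_le_ofReal
          apply le_of_eq
          rw [Real.sqrt_eq_rpow, Real.div_rpow h0.le hs.le, Real.rpow_neg hs.le, ← div_eq_inv_mul,
            ← div_eq_inv_mul, div_div, mul_comm, ← div_div]
          congr 1
          rw [← Real.rpow_sub_one h0.ne']
          norm_num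
        · by_cases h' : t ∈ Set.Ioi 0 <;> simp [h, h']
    _ = ENNReal.ofReal (∫ t in Set.Ioc 0 s, s ^ (-(1 / 2) : ℝ) * t ^ (-(1 / 2) : ℝ)) := by
        rw [ofReal_integral_eq_lintegral_ofReal hint]
        filter_upwards [ae_restrict_mem measurableSet_Ioc] with t ht
        have := ht.1
        positivity
    _ ≤ 2 := by
        rw [integral_const_mul, ← intervalIntegral.integral_of_le hs.le,
          integral_rpow (Or.inl (by norm_num)), Real.zero_rpow (by norm_num)]
        have : s ^ (-(1 / 2) : ℝ) * ((s ^ (-(1 / 2) + 1 : ℝ) - 0) / (-(1 / 2) + 1)) = 2 := by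
          rw [sub_zero, mul_div_assoc', ← Real.rpow_add hs]
          norm_num
        rw [this]; simp

theorem lintegral_sqrt_logMeasure_Ioi {s : ℝ} (hs : 0 < s) :
    ∫⁻ t in Set.Ioi s, ENNReal.ofReal √(s / t) ∂logMeasure ≤ 2 := by
  have hm : Measurable (fun t : ℝ => (Set.Ioi s).indicator (fun t => ENNReal.ofReal √(s / t)) t) :=
    ((measurable_const.div measurable_id).sqrt.ennreal_ofReal).indicator measurableSet_Ioi
  rw [← lintegral_indicator measurableSet_Ioi, lintegral_logMeasure hm]
  have hint : IntegrableOn (fun t : ℝ => s ^ (1 / 2 : ℝ) * t ^ (-(3 / 2) : ℝ)) (Set.Ioi s) :=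
    (integrableOn_Ioi_rpow_of_lt (by norm_num) hs).const_mul _
  calc ∫⁻ t in Set.Ioi 0, ENNReal.ofReal t⁻¹ *
        (Set.Ioi s).indicator (fun t => ENNReal.ofReal √(s / t)) t
      ≤ ∫⁻ t in Set.Ioi s, ENNReal.ofReal (s ^ (1 / 2 : ℝ) * t ^ (-(3 / 2) : ℝ)) := by
        rw [← lintegral_indicator measurableSet_Ioi, ← lintegral_indicator measurableSet_Ioi]
        apply lintegral_mono
        intro t
        by_cases h : t ∈ Set.Ioi s
        · have h0 : 0 < t := hs.trans h
          rw [Set.indicator_of_mem h, Set.indicator_of_mem (show t ∈ Set.Ioi 0 from h0),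
            Set.indicator_of_mem h, ← ENNReal.ofReal_mul (by positivity)]
          apply ENNReal.ofReal_le_ofReal
          apply le_of_eq
          rw [Real.sqrt_eq_rpow, Real.div_rpow hs.le h0.le, ← div_eq_inv_mul, div_div, div_eq_mul_inv,
            ← Real.rpow_add_one h0.ne', ← Real.rpow_neg h0.le]
          norm_num
        · by_cases h' : t ∈ Set.Ioi 0 <;> simp [h]
    _ = ENNReal.ofReal (∫ t in Set.Ioi s, s ^ (1 / 2 : ℝ) * t ^ (-(3 / 2) : ℝ)) := by
        rw [ofReal_integral_eq_lintegral_ofReal hint]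
        filter_upwards [ae_restrict_mem measurableSet_Ioi] with t ht
        have := hs.trans ht
        positivity
    _ ≤ 2 := by
        rw [integral_const_mul, integral_Ioi_rpow_of_lt (by norm_num) hs]
        have : s ^ (1 / 2 : ℝ) * (-s ^ (-(3 / 2) + 1 : ℝ) / (-(3 / 2) + 1)) = 2 := by
          rw [mul_div_assoc', mul_neg, ← Real.rpow_add hs]
          norm_num
        rw [this]; simp

end LogMeasure

/-! ### Square function estimate for kernels with cancellation -/

section SquareFunction

variable {n : ℕ}

/-- Kernels at all scales `t > 0` with decay, Hölder regularity in the second variable and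
cancellation. -/
structure IsSquareKernel (D : ℝ) (R : ℝ → Eucl n → Eucl n → ℂ) : Prop where
  measurable : Measurable (fun p : (ℝ × Eucl n) × Eucl n => R p.1.1 p.1.2 p.2)
  size : ∀ t, 0 < t → ∀ x u, ‖R t x u‖ ≤ D * bump t (x - u)
  holder : ∀ t, 0 < t → ∀ x u u', ‖R t x u - R t x u'‖ ≤
    D * (√(‖u - u'‖ / t) * (bump t (x - u) + bump t (x - u')))
  integral_eq_zero : ∀ t, 0 < t → ∀ x, ∫ u, R t x u = 0

namespace IsSquareKernel

variable {D : ℝ} {R : ℝ → Eucl n → Eucl n → ℂ}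

theorem measurable_slice (hR : IsSquareKernel D R) (t : ℝ) (x : Eucl n) : Measurable (R t x) :=
  hR.measurable.comp (measurable_prodMk_left (x := (t, x)))

theorem integrable (hR : IsSquareKernel D R) {t : ℝ} (ht : 0 < t) (x : Eucl n) :
    Integrable (R t x) := by
  have h : Integrable (fun u => D * bump t (x - u)) :=
    ((integrable_bump ht).comp_sub_left x).const_mul D
  exact h.mono' (hR.measurable_slice t x).aestronglyMeasurable
    (Filter.Eventually.of_forall fun u => hR.size t ht x u)

/-- Since `R s x` has integral zero, the constant value of `R t y` at `x` may be subtracted; Hölder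
regularity at scale `t` then gains `√(‖x - u‖ / t)`, which is small on average when `s ≪ t`. -/
theorem enorm_gramKernel_le (hR : IsSquareKernel D R) (hD : 0 ≤ D) {s t : ℝ} (hs : 0 < s)
    (ht : 0 < t) (x y : Eucl n) :
    ‖gramKernel volume (fun (p : ℝ × Eucl n) u => R p.1 p.2 u) (s, x) (t, y)‖ₑ ≤
      ENNReal.ofReal (D ^ 2) * ∫⁻ u, ENNReal.ofReal (bump s (x - u) * √(‖x - u‖ / t)) *
        (ENNReal.ofReal (bump t (y - u)) + ENNReal.ofReal (bump t (y - x))) := by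
  have h1 : Integrable (fun u => R s x u * conj (R t y u)) := by
    refine (hR.integrable hs x).mul_bdd (c := D * (t ^ n)⁻¹) ?_ ?_
    · exact (Complex.continuous_conj.measurable.comp
        (hR.measurable_slice t y)).aestronglyMeasurable
    · refine Filter.Eventually.of_forall fun u => ?_
      rw [RCLike.norm_conj]
      exact (hR.size t ht y u).trans (by gcongr; exact bump_le ht _)
  have h2 : Integrable (fun u => R s x u * conj (R t y x)) := (hR.integrable hs x).mul_const _
  have e : gramKernel volume (fun (p : ℝ × Eucl n) u => R p.1 p.2 u) (s, x) (t, y) =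
      ∫ u, R s x u * conj (R t y u - R t y x) := by
    simp only [gramKernel, map_sub, mul_sub]
    rw [integral_sub h1 h2, integral_mul_const, hR.integral_eq_zero s hs x, zero_mul, sub_zero]
  rw [e]
  refine (enorm_integral_le_lintegral_enorm _).trans ?_
  rw [← lintegral_const_mul' _ _ ENNReal.ofReal_ne_top]
  apply lintegral_mono
  intro u
  simp only
  rw [← ENNReal.ofReal_add (bump_nonneg ht _) (bump_nonneg ht _), ← ENNReal.ofReal_mul
    (mul_nonneg (bump_nonneg hs _) (Real.sqrt_nonneg _)), ← ENNReal.ofReal_mul (sq_nonneg D),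
    ← ofReal_norm]
  apply ENNReal.ofReal_le_ofReal
  rw [norm_mul, RCLike.norm_conj]
  have a1 := hR.size s hs x u
  have a2 := hR.holder t ht y u x
  rw [norm_sub_rev u x] at a2
  calc _ ≤ (D * bump s (x - u)) * (D * (√(‖x - u‖ / t) * (bump t (y - u) + bump t (y - x)))) :=
        mul_le_mul a1 a2 (norm_nonneg _) (mul_nonneg hD (bump_nonneg hs _))
    _ = _ := by ring

/-- The variable attached to the scale supplying the regularity is integrated first and costs only
masses; the half moment at scale `s` then gives `√(s/t)`. -/
theorem lintegral_gram_bound_right {s t : ℝ} (hs : 0 < s) (ht : 0 < t) (x : Eucl n) :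
    ∫⁻ y : Eucl n, ∫⁻ u, ENNReal.ofReal (bump s (x - u) * √(‖x - u‖ / t)) *
        (ENNReal.ofReal (bump t (y - u)) + ENNReal.ofReal (bump t (y - x))) =
      ENNReal.ofReal √(s / t) * (2 * bumpMass n * bumpMoment n) := by
  have hb : Measurable (fun z : Eucl n => bump t z) := measurable_bump_right t
  have hk : Measurable (fun u : Eucl n => ENNReal.ofReal (bump s (x - u) * √(‖x - u‖ / t))) := by
    have : Measurable (fun u : Eucl n => bump s (x - u)) :=
      (measurable_bump_right s).comp (measurable_const.sub measurable_id)
    exact (this.mul (by fun_prop)).ennreal_ofReal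
  rw [lintegral_lintegral_swap]
  · have e : ∀ u : Eucl n, ∫⁻ y : Eucl n, ENNReal.ofReal (bump s (x - u) * √(‖x - u‖ / t)) *
        (ENNReal.ofReal (bump t (y - u)) + ENNReal.ofReal (bump t (y - x))) =
        ENNReal.ofReal (bump s (x - u) * √(‖x - u‖ / t)) * (2 * bumpMass n) := by
      intro u
      have m1 : Measurable (fun y : Eucl n => ENNReal.ofReal (bump t (y - u))) :=
        (hb.comp (measurable_id.sub_const u)).ennreal_ofReal
      have m2 : Measurable (fun y : Eucl n => ENNReal.ofReal (bump t (y - x))) :=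
        (hb.comp (measurable_id.sub_const x)).ennreal_ofReal
      have m3 : Measurable (fun y : Eucl n => ENNReal.ofReal (bump t (y - u)) +
        ENNReal.ofReal (bump t (y - x))) := m1.add m2
      rw [lintegral_const_mul _ m3, lintegral_add_left m1, lintegral_bump_sub_right ht,
        lintegral_bump_sub_right ht, two_mul]
    simp only [e]
    rw [lintegral_mul_const _ hk,
      lintegral_sub_left_eq_self (fun z : Eucl n => ENNReal.ofReal (bump s z * √(‖z‖ / t))) x,
      lintegral_bump_mul_sqrt hs ht]
    ring
  · refine Measurable.aemeasurable ?_
    exact (hk.comp measurable_snd).mul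
      ((hb.comp (measurable_fst.sub measurable_snd)).ennreal_ofReal.add
        (hb.comp (measurable_fst.sub measurable_const)).ennreal_ofReal)

/-- Here the variable integrated is the centre of the kernel with cancellation. This version is
needed when the roles of the two scales are exchanged. -/
theorem lintegral_gram_bound_left {s t : ℝ} (hs : 0 < s) (ht : 0 < t) (y : Eucl n) :
    ∫⁻ x : Eucl n, ∫⁻ u, ENNReal.ofReal (bump s (x - u) * √(‖x - u‖ / t)) *
        (ENNReal.ofReal (bump t (y - u)) + ENNReal.ofReal (bump t (y - x))) =
      ENNReal.ofReal √(s / t) * (2 * bumpMass n * bumpMoment n) := by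
  have hb : Measurable (fun z : Eucl n => ENNReal.ofReal (bump t z)) :=
    (measurable_bump_right t).ennreal_ofReal
  have hk : Measurable (fun z : Eucl n => ENNReal.ofReal (bump s z * √(‖z‖ / t))) :=
    ((measurable_bump_right s).mul (by fun_prop)).ennreal_ofReal
  have hk1 : ∀ x : Eucl n,
      Measurable (fun u : Eucl n => ENNReal.ofReal (bump s (x - u) * √(‖x - u‖ / t))) :=
    fun x => hk.comp (measurable_const.sub measurable_id)
  have hk2 : ∀ u : Eucl n,
      Measurable (fun x : Eucl n => ENNReal.ofReal (bump s (x - u) * √(‖x - u‖ / t))) :=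
    fun u => hk.comp (measurable_id.sub measurable_const)
  have hb1 : Measurable (fun u : Eucl n => ENNReal.ofReal (bump t (y - u))) :=
    hb.comp (measurable_const.sub measurable_id)
  have m1 : Measurable (fun p : Eucl n × Eucl n =>
      ENNReal.ofReal (bump s (p.1 - p.2) * √(‖p.1 - p.2‖ / t)) * ENNReal.ofReal (bump t (y - p.2))) :=
    (hk.comp (measurable_fst.sub measurable_snd)).mul (hb.comp (measurable_const.sub measurable_snd))
  have hI : ∫⁻ z : Eucl n, ENNReal.ofReal (bump s z * √(‖z‖ / t)) =
      ENNReal.ofReal √(s / t) * bumpMoment n := lintegral_bump_mul_sqrt hs ht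
  have hI1 : ∀ x : Eucl n, ∫⁻ u : Eucl n, ENNReal.ofReal (bump s (x - u) * √(‖x - u‖ / t)) =
      ENNReal.ofReal √(s / t) * bumpMoment n := fun x => by
    rw [lintegral_sub_left_eq_self (fun z : Eucl n => ENNReal.ofReal (bump s z * √(‖z‖ / t))) x, hI]
  have hI2 : ∀ u : Eucl n, ∫⁻ x : Eucl n, ENNReal.ofReal (bump s (x - u) * √(‖x - u‖ / t)) =
      ENNReal.ofReal √(s / t) * bumpMoment n := fun u => by
    rw [lintegral_sub_right_eq_self (fun z : Eucl n => ENNReal.ofReal (bump s z * √(‖z‖ / t))) u, hI]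
  have e : ∀ x : Eucl n, ∫⁻ u, ENNReal.ofReal (bump s (x - u) * √(‖x - u‖ / t)) *
        (ENNReal.ofReal (bump t (y - u)) + ENNReal.ofReal (bump t (y - x))) =
      (∫⁻ u, ENNReal.ofReal (bump s (x - u) * √(‖x - u‖ / t)) * ENNReal.ofReal (bump t (y - u))) +
      ENNReal.ofReal √(s / t) * bumpMoment n * ENNReal.ofReal (bump t (y - x)) := by
    intro x
    simp only [mul_add]
    have m2 : Measurable (fun u : Eucl n => ENNReal.ofReal (bump s (x - u) * √(‖x - u‖ / t)) *
        ENNReal.ofReal (bump t (y - u))) := (hk1 x).mul hb1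
    rw [lintegral_add_left m2, lintegral_mul_const _ (hk1 x), hI1]
  simp only [e]
  have m3 : Measurable (fun x : Eucl n => ∫⁻ u,
      ENNReal.ofReal (bump s (x - u) * √(‖x - u‖ / t)) * ENNReal.ofReal (bump t (y - u))) :=
    m1.lintegral_prod_right
  have e2 : ∫⁻ x : Eucl n, ∫⁻ u, ENNReal.ofReal (bump s (x - u) * √(‖x - u‖ / t)) *
      ENNReal.ofReal (bump t (y - u)) =
      ∫⁻ u : Eucl n, ∫⁻ x, ENNReal.ofReal (bump s (x - u) * √(‖x - u‖ / t)) *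
      ENNReal.ofReal (bump t (y - u)) := lintegral_lintegral_swap m1.aemeasurable
  rw [lintegral_add_left m3, e2, lintegral_const_mul _ hb1, lintegral_bump_sub_left ht]
  have e3 : ∀ u : Eucl n, ∫⁻ x : Eucl n, ENNReal.ofReal (bump s (x - u) * √(‖x - u‖ / t)) *
      ENNReal.ofReal (bump t (y - u)) =
      ENNReal.ofReal √(s / t) * bumpMoment n * ENNReal.ofReal (bump t (y - u)) := fun u => by
    rw [lintegral_mul_const _ (hk2 u), hI2]
  simp only [e3]
  rw [lintegral_const_mul _ hb1, lintegral_bump_sub_left ht]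
  ring

theorem lintegral_gramKernel_le (hR : IsSquareKernel D R) (hD : 0 ≤ D) {s t : ℝ} (hs : 0 < s)
    (ht : 0 < t) (x : Eucl n) :
    ∫⁻ y, ‖gramKernel volume (fun (p : ℝ × Eucl n) u => R p.1 p.2 u) (s, x) (t, y)‖ₑ ≤
      ENNReal.ofReal (D ^ 2) * (2 * bumpMass n * bumpMoment n) *
        ENNReal.ofReal (min √(s / t) √(t / s)) := by
  -- The cancellation is taken from whichever kernel lives at the finer scale; in the second case
  -- Hermitian symmetry of the Gram kernel swaps the two.
  rcases min_choice √(s / t) √(t / s) with h | h <;> rw [h]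
  · calc _ ≤ ∫⁻ y : Eucl n, ENNReal.ofReal (D ^ 2) *
          ∫⁻ u, ENNReal.ofReal (bump s (x - u) * √(‖x - u‖ / t)) *
            (ENNReal.ofReal (bump t (y - u)) + ENNReal.ofReal (bump t (y - x))) :=
          lintegral_mono fun y => hR.enorm_gramKernel_le hD hs ht x y
      _ = _ := by
          rw [lintegral_const_mul' _ _ ENNReal.ofReal_ne_top, lintegral_gram_bound_right hs ht]
          ring
  · calc _ ≤ ∫⁻ y : Eucl n, ENNReal.ofReal (D ^ 2) *
          ∫⁻ u, ENNReal.ofReal (bump t (y - u) * √(‖y - u‖ / s)) *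
            (ENNReal.ofReal (bump s (x - u)) + ENNReal.ofReal (bump s (x - y))) := by
          refine lintegral_mono fun y => ?_
          rw [enorm_gramKernel_symm]
          exact hR.enorm_gramKernel_le hD ht hs y x
      _ = _ := by
          rw [lintegral_const_mul' _ _ ENNReal.ofReal_ne_top, lintegral_gram_bound_left ht hs]
          ring

/-- The constant in the square function estimate. -/
noncomputable def sqConst (n : ℕ) : ℝ≥0∞ := 8 * bumpMass n * bumpMoment n

theorem sqConst_ne_top (n : ℕ) : sqConst n ≠ ⊤ :=
  ENNReal.mul_ne_top (ENNReal.mul_ne_top (by simp) (bumpMass_ne_top n)) (bumpMoment_ne_top n)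

/-- Each of the ranges `t ≤ s` and `t > s` contributes 2. This 4 times the 2 of the Gram bounds is
the 8 in `sqConst`. -/
theorem lintegral_min_sqrt_le {s : ℝ} (hs : 0 < s) :
    ∫⁻ t, ENNReal.ofReal (min √(s / t) √(t / s)) ∂logMeasure ≤ 4 := by
  rw [← logMeasure_restrict_Ioi, ← Set.Ioc_union_Ioi_eq_Ioi hs.le]
  refine (lintegral_union_le _ _ _).trans ?_
  calc _ ≤ (∫⁻ t in Set.Ioc 0 s, ENNReal.ofReal √(t / s) ∂logMeasure) +
        ∫⁻ t in Set.Ioi s, ENNReal.ofReal √(s / t) ∂logMeasure := by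
        gcongr
        · exact min_le_right _ _
        · exact min_le_left _ _
    _ ≤ 2 + 2 := add_le_add (lintegral_sqrt_logMeasure_Ioc hs) (lintegral_sqrt_logMeasure_Ioi hs)
    _ = 4 := by norm_num

/-- The square function estimate for kernels with cancellation. -/
theorem lintegral_le (hR : IsSquareKernel D R) (hD : 0 ≤ D) {f : Eucl n → ℂ} (hf : Measurable f)
    (hf2 : ∫⁻ u, ‖f u‖ₑ ^ 2 ≠ ⊤) :
    ∫⁻ t, (∫⁻ x, ‖∫ u, R t x u * f u‖ₑ ^ 2) ∂logMeasure ≤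
      ENNReal.ofReal (D ^ 2) * sqConst n * ∫⁻ u, ‖f u‖ₑ ^ 2 := by
  -- By monotone convergence it is enough to bound the integral over each `logInterval N`, with a
  -- constant independent of `N`.
  rw [← logMeasure_restrict_Ioi, ← iUnion_logInterval,
    setLIntegral_iUnion_of_directed _ monotone_logInterval.directed_le]
  refine iSup_le fun N => ?_
  have hpos : ∀ t ∈ logInterval N, 0 < t := fun t ht =>
    lt_of_lt_of_le (by positivity) ht.1
  set lam := logMeasure.restrict (logInterval N) with hlam
  have hae : ∀ᵐ t ∂lam, 0 < t := by
    filter_upwards [ae_restrict_mem measurableSet_Icc] with t ht using hpos t ht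
  have hae' : ∀ᵐ p ∂(lam.prod (volume : Measure (Eucl n))), 0 < p.1 :=
    Measure.quasiMeasurePreserving_fst.ae hae
  have hfin : IsFiniteMeasure lam := ⟨by
    rw [hlam, Measure.restrict_apply_univ]
    exact (logMeasure_logInterval_ne_top N).lt_top⟩
  have hsmeas : Measurable (fun q : (ℝ × Eucl n) × Eucl n => ‖R q.1.1 q.1.2 q.2‖ₑ) :=
    hR.measurable.enorm
  -- Only the column constant `b` depends on the truncation, and the conclusion does not contain it.
  have key := lintegral_sq_integral_le_of_gramKernel (lam.prod (volume : Measure (Eucl n)))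
    (volume : Measure (Eucl n)) (K := fun p u => R p.1 p.2 u) hR.measurable
    (a := ENNReal.ofReal D * bumpMass n) (b := ENNReal.ofReal D * bumpMass n * lam Set.univ)
    (B := ENNReal.ofReal (D ^ 2) * sqConst n) (f := f)
    ?_ ?_ ?_ ?_ ?_ hf hf2
  · rwa [lintegral_prod] at key
    refine Measurable.aemeasurable ?_
    exact ((hR.measurable.mul (hf.comp measurable_snd)).stronglyMeasurable.integral_prod_right
      ).measurable.enorm.pow_const 2
  · filter_upwards [hae'] with p hp
    calc ∫⁻ u, ‖R p.1 p.2 u‖ₑ ≤ ∫⁻ u, ENNReal.ofReal D * ENNReal.ofReal (bump p.1 (p.2 - u)) := by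
          gcongr with u
          rw [← ENNReal.ofReal_mul hD, ← ofReal_norm]
          exact ENNReal.ofReal_le_ofReal (hR.size _ hp _ _)
      _ = _ := by
          rw [lintegral_const_mul' _ _ ENNReal.ofReal_ne_top, lintegral_bump_sub_left hp]
  · refine Filter.Eventually.of_forall fun u => ?_
    have hu : Measurable (fun p : ℝ × Eucl n => ‖R p.1 p.2 u‖ₑ) :=
      hsmeas.comp measurable_prodMk_right
    rw [lintegral_prod _ hu.aemeasurable]
    calc ∫⁻ t, (∫⁻ x, ‖R t x u‖ₑ) ∂lam ≤ ∫⁻ t, ENNReal.ofReal D * bumpMass n ∂lam := by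
          apply lintegral_mono_ae
          filter_upwards [hae] with t ht
          calc ∫⁻ x, ‖R t x u‖ₑ ≤ ∫⁻ x, ENNReal.ofReal D * ENNReal.ofReal (bump t (x - u)) := by
                gcongr with x
                rw [← ENNReal.ofReal_mul hD, ← ofReal_norm]
                exact ENNReal.ofReal_le_ofReal (hR.size _ ht _ _)
            _ = _ := by
                rw [lintegral_const_mul' _ _ ENNReal.ofReal_ne_top, lintegral_bump_sub_right ht]
      _ = _ := by rw [lintegral_const]
  · exact ENNReal.mul_ne_top ENNReal.ofReal_ne_top (bumpMass_ne_top n)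
  · exact ENNReal.mul_ne_top (ENNReal.mul_ne_top ENNReal.ofReal_ne_top (bumpMass_ne_top n))
      (measure_ne_top _ _)
  · filter_upwards [hae'] with p hp
    have hgm : Measurable (fun q : ℝ × Eucl n =>
        ‖gramKernel volume (fun (p : ℝ × Eucl n) u => R p.1 p.2 u) p q‖ₑ) := by
      have a2 : Measurable (fun q : (ℝ × Eucl n) × Eucl n => R p.1 p.2 q.2) :=
        (hR.measurable_slice p.1 p.2).comp measurable_snd
      exact ((a2.mul (Complex.continuous_conj.measurable.comp
        hR.measurable)).stronglyMeasurable.integral_prod_right).measurable.enorm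
    rw [lintegral_prod _ hgm.aemeasurable]
    calc _ ≤ ∫⁻ t, ENNReal.ofReal (D ^ 2) * (2 * bumpMass n * bumpMoment n) *
          ENNReal.ofReal (min √(p.1 / t) √(t / p.1)) ∂lam := by
          apply lintegral_mono_ae
          filter_upwards [hae] with t ht
          exact hR.lintegral_gramKernel_le hD hp ht p.2
      _ ≤ ∫⁻ t, ENNReal.ofReal (D ^ 2) * (2 * bumpMass n * bumpMoment n) *
          ENNReal.ofReal (min √(p.1 / t) √(t / p.1)) ∂logMeasure :=
          lintegral_mono' Measure.restrict_le_self le_rfl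
      _ ≤ ENNReal.ofReal (D ^ 2) * (2 * bumpMass n * bumpMoment n) * 4 := by
          rw [lintegral_const_mul _ (by fun_prop)]
          gcongr
          exact lintegral_min_sqrt_le hp
      _ = _ := by unfold sqConst; ring

end IsSquareKernel

end SquareFunction

/-! ### The Carleson embedding theorem -/

section CarlesonEmbedding

variable {n : ℕ}

/-- The average of `φ` at scale `t` against the weight `bump`. -/
noncomputable def bumpAvg (φ : Eucl n → ℝ≥0∞) (t : ℝ) (x : Eucl n) : ℝ≥0∞ :=
  ∫⁻ u, ENNReal.ofReal (bump t (x - u)) * φ u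

theorem measurable_bumpAvg {φ : Eucl n → ℝ≥0∞} (hφ : Measurable φ) :
    Measurable (fun p : ℝ × Eucl n => bumpAvg φ p.1 p.2) := by
  unfold bumpAvg
  have h1 : Measurable (fun q : (ℝ × Eucl n) × Eucl n => bump q.1.1 (q.1.2 - q.2)) :=
    measurable_bump.comp ((measurable_fst.comp measurable_fst).prodMk
      ((measurable_snd.comp measurable_fst).sub measurable_snd))
  exact (h1.ennreal_ofReal.mul (hφ.comp measurable_snd)).lintegral_prod_right

/-- Only one summand is needed: the first dyadic ball containing `z`, for which `2 ^ k ≤ 2 (1 + ‖z‖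
/ t)` by minimality. -/
theorem bump_le_tsum {t : ℝ} (ht : 0 < t) (z : Eucl n) :
    ENNReal.ofReal (bump t z) ≤ ∑' k : ℕ, (Metric.closedBall (0 : Eucl n) (2 ^ k * t)).indicator
      (fun _ => ENNReal.ofReal (2 ^ (n + 1) * (t ^ n)⁻¹ * ((2 ^ k) ^ (n + 1))⁻¹)) z := by
  have hex : ∃ k : ℕ, ‖z‖ ≤ 2 ^ k * t := by
    obtain ⟨k, hk⟩ := pow_unbounded_of_one_lt (‖z‖ / t) (one_lt_two)
    exact ⟨k, ((div_lt_iff₀ ht).1 hk).le⟩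
  classical
  have hk := Nat.find_spec hex
  have hmin := fun j => Nat.find_min hex (m := j)
  set k := Nat.find hex with hkdef
  refine le_trans ?_ (ENNReal.le_tsum k)
  rw [Set.indicator_of_mem (by simpa using hk)]
  apply ENNReal.ofReal_le_ofReal
  have h2 : (2 : ℝ) ^ k ≤ 2 * (1 + ‖z‖ / t) := by
    rcases Nat.eq_zero_or_pos k with h0 | h0
    · rw [h0]
      have : 0 ≤ ‖z‖ / t := by positivity
      linarith
    · have := hmin (k - 1) (by omega)
      rw [not_le, ← lt_div_iff₀ ht] at this
      have e : (2 : ℝ) ^ k = 2 * 2 ^ (k - 1) := by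
        rw [← pow_succ']; congr 1; omega
      rw [e]; linarith
  have h3 : ((2 : ℝ) ^ k) ^ (n + 1) ≤ 2 ^ (n + 1) * (1 + ‖z‖ / t) ^ (n + 1) := by
    rw [← mul_pow]; gcongr
  unfold bump
  rw [mul_comm ((2 : ℝ) ^ (n + 1)), mul_assoc]
  gcongr
  rw [← div_eq_mul_inv, inv_le_comm₀ (by positivity) (by positivity), inv_div,
    div_le_iff₀ (by positivity), mul_comm]
  exact h3

/-- The dyadic pieces contribute `2 ^ (n+1) a 2^(-k)`, a geometric series. In contrapositive form: a
large weighted average forces a large average over one of the balls of radius `2 ^ k * t`. -/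
theorem bumpAvg_le_of_forall_ball {φ : Eucl n → ℝ≥0∞} (hφ : Measurable φ) {t : ℝ} (ht : 0 < t)
    (x : Eucl n) {a : ℝ≥0∞}
    (h : ∀ k : ℕ, ∫⁻ u in Metric.closedBall x (2 ^ k * t), φ u ≤
      a * ENNReal.ofReal ((2 ^ k * t) ^ n)) :
    bumpAvg φ t x ≤ 2 ^ (n + 2) * a := by
  let c : ℕ → ℝ≥0∞ := fun k => ENNReal.ofReal (2 ^ (n + 1) * (t ^ n)⁻¹ * ((2 ^ k) ^ (n + 1))⁻¹)
  calc bumpAvg φ t x ≤ ∫⁻ u, ∑' k : ℕ, c k * (Metric.closedBall x (2 ^ k * t)).indicator φ u := by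
        apply lintegral_mono
        intro u
        simp only
        calc _ ≤ (∑' k : ℕ, (Metric.closedBall (0 : Eucl n) (2 ^ k * t)).indicator
              (fun _ => c k) (x - u)) * φ u := by
              gcongr; exact bump_le_tsum ht _
          _ = _ := by
              rw [← ENNReal.tsum_mul_right]
              congr 1; ext k
              by_cases hu : ‖x - u‖ ≤ 2 ^ k * t
              · rw [Set.indicator_of_mem (by simpa using hu), Set.indicator_of_mem]
                rwa [Metric.mem_closedBall, dist_comm, dist_eq_norm]
              · rw [Set.indicator_of_notMem (by simpa using hu), Set.indicator_of_notMem]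
                · simp
                · rwa [Metric.mem_closedBall, dist_comm, dist_eq_norm]
    _ = ∑' k : ℕ, c k * ∫⁻ u in Metric.closedBall x (2 ^ k * t), φ u := by
        rw [lintegral_tsum]
        · congr 1; ext k
          rw [lintegral_const_mul _ (hφ.indicator Metric.isClosed_closedBall.measurableSet),
            lintegral_indicator Metric.isClosed_closedBall.measurableSet]
        · exact fun k => ((hφ.indicator
            Metric.isClosed_closedBall.measurableSet).const_mul _).aemeasurable
    _ ≤ ∑' k : ℕ, 2 ^ (n + 1) * a * (2⁻¹ : ℝ≥0∞) ^ k := by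
        refine ENNReal.tsum_le_tsum fun k => ?_
        calc c k * ∫⁻ u in Metric.closedBall x (2 ^ k * t), φ u
            ≤ c k * (a * ENNReal.ofReal ((2 ^ k * t) ^ n)) := by gcongr; exact h k
          _ = a * ENNReal.ofReal (2 ^ (n + 1) * (t ^ n)⁻¹ * ((2 ^ k) ^ (n + 1))⁻¹ *
              (2 ^ k * t) ^ n) := by
              rw [ENNReal.ofReal_mul (by positivity)]; ring
          _ = a * ENNReal.ofReal (2 ^ (n + 1) * (2 ^ k)⁻¹) := by
              congr 2
              have : (2 : ℝ) ^ k ≠ 0 := by positivity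
              field_simp
              ring
          _ = _ := by
              rw [ENNReal.ofReal_mul (by positivity), ENNReal.ofReal_pow (by positivity),
                ENNReal.ofReal_inv_of_pos (by positivity), ENNReal.ofReal_pow (by positivity),
                ENNReal.inv_pow]
              simp only [ENNReal.ofReal_ofNat]
              ring
    _ = _ := by
        rw [ENNReal.tsum_mul_left, ENNReal.tsum_geometric, ENNReal.one_sub_inv_two, inv_inv]
        ring

/-- Measures on the half space `(0,∞) × ℝⁿ` for which boxes over balls of radius `r` have measure
at most `Λ rⁿ`. -/
structure IsCarlesonMeasure (Λ : ℝ≥0∞) (q : Measure (ℝ × Eucl n)) : Prop where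
  ae_pos : ∀ᵐ p ∂q, 0 < p.1
  box_le : ∀ (x : Eucl n) (r : ℝ), 0 < r →
    q (Set.Ioc 0 r ×ˢ Metric.closedBall x r) ≤ Λ * ENNReal.ofReal (r ^ n)

namespace IsCarlesonMeasure

variable {Λ : ℝ≥0∞} {q : Measure (ℝ × Eucl n)}

/-- A Vitali covering argument. Balls on which `φ` has mass above `a ρⁿ` are thinned to a disjoint
family; the boxes over their threefold enlargements cover the superlevel set, the Carleson condition
bounds the measure of each box, and disjointness sums the masses of `φ`. -/
theorem weak_type (hq : IsCarlesonMeasure Λ q) (hn : 1 ≤ n) {φ : Eucl n → ℝ≥0∞}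
    (hφ : Measurable φ) (hφ1 : ∫⁻ u, φ u ≠ ⊤) {a : ℝ≥0∞} (ha0 : a ≠ 0) (ha : a ≠ ⊤) :
    q {p | 0 < p.1 ∧ 2 ^ (n + 2) * a < bumpAvg φ p.1 p.2} ≤ Λ * 3 ^ n * a⁻¹ * ∫⁻ u, φ u := by
  let S : Set (Eucl n × ℝ) := {b | 0 < b.2 ∧
    a * ENNReal.ofReal (b.2 ^ n) < ∫⁻ u in Metric.closedBall b.1 b.2, φ u}
  -- Vitali's lemma needs bounded radii. If `ρ > 1` then `ρ ≤ ρ ^ n` because `n ≥ 1`, and `ρ ^ n` is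
  -- at most the total mass divided by `a`.
  have hbd : ∀ b ∈ S, b.2 ≤ max 1 ((∫⁻ u, φ u) / a).toReal := by
    rintro ⟨x, ρ⟩ ⟨hρ, h⟩
    simp only at hρ h ⊢
    by_contra! hlt
    have h1 : 1 < ρ := (le_max_left _ _).trans_lt hlt
    have h2 : ρ ≤ ρ ^ n := le_self_pow₀ h1.le (by omega)
    have h3 : a * ENNReal.ofReal (ρ ^ n) < ∫⁻ u, φ u :=
      h.trans_le (setLIntegral_le_lintegral _ _)
    have h4 : ENNReal.ofReal (ρ ^ n) < (∫⁻ u, φ u) / a := by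
      rw [ENNReal.lt_div_iff_mul_lt (Or.inl ha0) (Or.inl ha), mul_comm]; exact h3
    have h5 : ρ ^ n < ((∫⁻ u, φ u) / a).toReal :=
      (ENNReal.ofReal_lt_iff_lt_toReal (by positivity) (ENNReal.div_ne_top hφ1 ha0)).1 h4
    linarith [le_max_right 1 ((∫⁻ u, φ u) / a).toReal]
  obtain ⟨U, hUS, hdisj, hcov⟩ := Vitali.exists_disjoint_subfamily_covering_enlargement
    (fun b : Eucl n × ℝ => Metric.closedBall b.1 b.2) S (fun b => b.2) 2 one_lt_two
    (fun b hb => hb.1.le) _ hbd (fun b hb => Metric.nonempty_closedBall.2 hb.1.le)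
  have hUc : U.Countable := by
    refine hdisj.countable_of_nonempty_interior fun b hb => ?_
    refine Set.Nonempty.mono Metric.ball_subset_interior_closedBall ?_
    exact Metric.nonempty_ball.2 (hUS hb).1
  have hsub : {p : ℝ × Eucl n | 0 < p.1 ∧ 2 ^ (n + 2) * a < bumpAvg φ p.1 p.2} ⊆
      ⋃ b ∈ U, Set.Ioc 0 (3 * b.2) ×ˢ Metric.closedBall b.1 (3 * b.2) := by
    rintro ⟨t, x⟩ ⟨ht, hp⟩
    simp only at ht hp
    have : ∃ k : ℕ, a * ENNReal.ofReal ((2 ^ k * t) ^ n) <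
        ∫⁻ u in Metric.closedBall x (2 ^ k * t), φ u := by
      by_contra! hcon
      exact absurd hp (not_lt.2 (bumpAvg_le_of_forall_ball hφ ht x hcon))
    obtain ⟨k, hk⟩ := this
    have hmem : ((x, 2 ^ k * t) : Eucl n × ℝ) ∈ S := ⟨by positivity, hk⟩
    obtain ⟨b, hb, ⟨y, hy1, hy2⟩, hle⟩ := hcov _ hmem
    simp only [Metric.mem_closedBall] at hy1 hy2 hle
    simp only [Set.mem_iUnion, Set.mem_prod, Set.mem_Ioc, Metric.mem_closedBall]
    have hb0 : 0 < b.2 := (hUS hb).1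
    -- The chosen ball meets the original one and has at least half its radius. So `x` lies within
    -- `3 * b.2` of its centre, and `t ≤ 2 * b.2`.
    have ht2 : t ≤ 2 ^ k * t := le_mul_of_one_le_left ht.le (one_le_pow₀ one_le_two)
    refine ⟨b, hb, ⟨ht, by linarith⟩, ?_⟩
    have := dist_triangle_left x b.1 y
    linarith
  calc q {p | 0 < p.1 ∧ 2 ^ (n + 2) * a < bumpAvg φ p.1 p.2}
      ≤ q (⋃ b ∈ U, Set.Ioc 0 (3 * b.2) ×ˢ Metric.closedBall b.1 (3 * b.2)) := measure_mono hsub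
    _ ≤ ∑' b : U, q (Set.Ioc 0 (3 * b.1.2) ×ˢ Metric.closedBall b.1.1 (3 * b.1.2)) :=
        measure_biUnion_le q hUc _
    _ ≤ ∑' b : U, Λ * 3 ^ n * a⁻¹ * ∫⁻ u in Metric.closedBall b.1.1 b.1.2, φ u := by
        gcongr with b
        have hb := hUS b.2
        calc _ ≤ Λ * ENNReal.ofReal ((3 * b.1.2) ^ n) := hq.box_le _ _ (by linarith [hb.1])
          _ = Λ * 3 ^ n * a⁻¹ * (a * ENNReal.ofReal (b.1.2 ^ n)) := by
              rw [mul_pow, ENNReal.ofReal_mul (by positivity), ENNReal.ofReal_pow (by positivity)]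
              simp only [ENNReal.ofReal_ofNat]
              rw [mul_assoc (Λ * 3 ^ n), ← mul_assoc a⁻¹, ENNReal.inv_mul_cancel ha0 ha, one_mul,
                mul_assoc]
          _ ≤ _ := by gcongr; exact hb.2.le
    _ = Λ * 3 ^ n * a⁻¹ * ∫⁻ u in ⋃ b ∈ U, Metric.closedBall b.1 b.2, φ u := by
        rw [ENNReal.tsum_mul_left, lintegral_biUnion hUc
          (fun b _ => Metric.isClosed_closedBall.measurableSet) hdisj]
    _ ≤ _ := mul_le_mul_right (setLIntegral_le_lintegral _ _) _

/-- The constant in the Carleson embedding theorem. -/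
noncomputable def carlesonConst (n : ℕ) : ℝ≥0∞ := 2 * 3 ^ n * 2 ^ (n + 3) * (2 * bumpMass n)

theorem carlesonConst_ne_top (n : ℕ) : carlesonConst n ≠ ⊤ := by
  unfold carlesonConst
  have := bumpMass_ne_top n
  finiteness

/-- Truncation as in Marcinkiewicz interpolation: where `φ ≤ l / (2 bumpMass n)` its average is at
most `l / 2`, so the large part of `φ` must have average above `l / 2`. The weak-type bound is
applied with `a = l / 2 ^ (n+3)`, for which `2 ^ (n+2) * a = l / 2`. -/
theorem weak_type_truncated (hq : IsCarlesonMeasure Λ q) (hn : 1 ≤ n) {φ : Eucl n → ℝ≥0∞}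
    (hφ : Measurable φ) (hφ2 : ∫⁻ u, φ u ^ 2 ≠ ⊤) {l : ℝ} (hl : 0 < l) :
    q {p | 0 < p.1 ∧ ENNReal.ofReal l < bumpAvg φ p.1 p.2} * ENNReal.ofReal l ≤
      Λ * 3 ^ n * 2 ^ (n + 3) *
        ∫⁻ u, {u | ENNReal.ofReal l < 2 * bumpMass n * φ u}.indicator φ u := by
  have hW := bumpMass_ne_top n
  have hW0 := bumpMass_ne_zero n
  set A := {u | ENNReal.ofReal l < 2 * bumpMass n * φ u} with hA
  have hl0 : ENNReal.ofReal l ≠ 0 := by simpa using hl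
  have hAm : MeasurableSet A := measurableSet_lt measurable_const (hφ.const_mul _)
  have h2W : 2 * bumpMass n ≠ ⊤ := ENNReal.mul_ne_top (by simp) hW
  have h2W0 : 2 * bumpMass n ≠ 0 := mul_ne_zero (by simp) hW0
  -- On `A` one has `l φ ≤ 2 bumpMass n φ²`, so the truncated function is integrable as soon as `φ`
  -- is in `L²`.
  have hfin : ∫⁻ u, A.indicator φ u ≠ ⊤ := by
    have h1 : ∀ u, ENNReal.ofReal l * A.indicator φ u ≤ 2 * bumpMass n * φ u ^ 2 := by
      intro u
      by_cases hu : u ∈ A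
      · rw [Set.indicator_of_mem hu, sq, ← mul_assoc]
        gcongr
        exact hu.le
      · simp [hu]
    have h2 : ENNReal.ofReal l * ∫⁻ u, A.indicator φ u ≤ 2 * bumpMass n * ∫⁻ u, φ u ^ 2 := by
      rw [← lintegral_const_mul _ (hφ.indicator hAm), ← lintegral_const_mul _ (hφ.pow_const 2)]
      exact lintegral_mono h1
    intro h
    rw [h, ENNReal.mul_top hl0, top_le_iff] at h2
    exact ENNReal.mul_ne_top h2W hφ2 h2
  have hsub : {p : ℝ × Eucl n | 0 < p.1 ∧ ENNReal.ofReal l < bumpAvg φ p.1 p.2} ⊆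
      {p | 0 < p.1 ∧ 2 ^ (n + 2) * (ENNReal.ofReal l / 2 ^ (n + 3)) <
        bumpAvg (A.indicator φ) p.1 p.2} := by
    rintro ⟨t, x⟩ ⟨ht, hp⟩
    refine ⟨ht, ?_⟩
    simp only at ht hp ⊢
    have e : 2 ^ (n + 2) * (ENNReal.ofReal l / 2 ^ (n + 3)) = ENNReal.ofReal l / 2 := by
      rw [pow_succ 2 (n + 2), ← mul_div_assoc, ENNReal.mul_div_mul_left _ _ (by simp) (by simp)]
    rw [e]
    by_contra! hcon
    have hle : bumpAvg φ t x ≤ bumpAvg (A.indicator φ) t x +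
        bumpMass n * (ENNReal.ofReal l / (2 * bumpMass n)) := by
      have hm : Measurable (fun u => ENNReal.ofReal (bump t (x - u))) :=
        ((measurable_bump_right t).comp (measurable_const.sub measurable_id)).ennreal_ofReal
      have hm2 : Measurable (fun u => ENNReal.ofReal (bump t (x - u)) * A.indicator φ u) :=
        hm.mul (hφ.indicator hAm)
      have e3 : bumpMass n * (ENNReal.ofReal l / (2 * bumpMass n)) =
          ∫⁻ u, ENNReal.ofReal (bump t (x - u)) * (ENNReal.ofReal l / (2 * bumpMass n)) := by
        rw [lintegral_mul_const _ hm, lintegral_bump_sub_left ht]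
      rw [e3, bumpAvg, bumpAvg, ← lintegral_add_left hm2]
      apply lintegral_mono
      intro u
      simp only
      rw [← mul_add]
      gcongr
      by_cases hu : u ∈ A
      · rw [Set.indicator_of_mem hu]; exact le_self_add
      · rw [Set.indicator_of_notMem hu, zero_add,
          ENNReal.le_div_iff_mul_le (Or.inl h2W0) (Or.inl h2W), mul_comm]
        exact not_lt.1 hu
    have e2 : bumpMass n * (ENNReal.ofReal l / (2 * bumpMass n)) = ENNReal.ofReal l / 2 := by
      rw [← mul_div_assoc, mul_comm, ENNReal.mul_div_mul_right _ _ hW0 hW]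
    rw [e2] at hle
    have : bumpAvg φ t x ≤ ENNReal.ofReal l := by
      calc _ ≤ ENNReal.ofReal l / 2 + ENNReal.ofReal l / 2 := hle.trans (by gcongr)
        _ = _ := ENNReal.add_halves _
    exact absurd hp (not_lt.2 this)
  have ha0 : ENNReal.ofReal l / 2 ^ (n + 3) ≠ 0 := ENNReal.div_ne_zero.2 ⟨hl0, by simp⟩
  have ha : ENNReal.ofReal l / 2 ^ (n + 3) ≠ ⊤ := ENNReal.div_ne_top ENNReal.ofReal_ne_top (by simp)
  calc _ ≤ (Λ * 3 ^ n * (ENNReal.ofReal l / 2 ^ (n + 3))⁻¹ * ∫⁻ u, A.indicator φ u) *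
        ENNReal.ofReal l := by
        gcongr
        exact (measure_mono hsub).trans (hq.weak_type hn (hφ.indicator hAm) hfin ha0 ha)
    _ = Λ * 3 ^ n * (2 ^ (n + 3) / ENNReal.ofReal l * ENNReal.ofReal l) *
        ∫⁻ u, A.indicator φ u := by
        rw [ENNReal.inv_div (by simp) (by simp)]; ring
    _ = _ := by rw [ENNReal.div_mul_cancel hl0 ENNReal.ofReal_ne_top]

theorem bumpAvg_ne_top {φ : Eucl n → ℝ≥0∞} (hφ : Measurable φ) (hφ2 : ∫⁻ u, φ u ^ 2 ≠ ⊤)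
    {t : ℝ} (ht : 0 < t) (x : Eucl n) : bumpAvg φ t x ≠ ⊤ := by
  have hm : Measurable (fun u => ENNReal.ofReal (bump t (x - u))) :=
    ((measurable_bump_right t).comp (measurable_const.sub measurable_id)).ennreal_ofReal
  have h := ENNReal.sq_lintegral_mul_le_weight volume hm.aemeasurable hφ.aemeasurable
  rw [lintegral_bump_sub_left ht] at h
  have h2 : ∫⁻ u, ENNReal.ofReal (bump t (x - u)) * φ u ^ 2 ≤
      ENNReal.ofReal (t ^ n)⁻¹ * ∫⁻ u, φ u ^ 2 := by
    rw [← lintegral_const_mul _ (hφ.pow_const 2)]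
    gcongr
    exact bump_le ht _
  have h3 : bumpAvg φ t x ^ 2 ≠ ⊤ := by
    refine ne_top_of_le_ne_top ?_ (h.trans (mul_le_mul_right h2 _))
    exact ENNReal.mul_ne_top (bumpMass_ne_top n) (ENNReal.mul_ne_top ENNReal.ofReal_ne_top hφ2)
  intro h4
  simp [h4] at h3

/-- The Carleson embedding theorem. -/
theorem lintegral_bumpAvg_sq_le [SFinite q] (hq : IsCarlesonMeasure Λ q) (hn : 1 ≤ n)
    {φ : Eucl n → ℝ≥0∞} (hφ : Measurable φ) (hφ2 : ∫⁻ u, φ u ^ 2 ≠ ⊤) :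
    ∫⁻ p, bumpAvg φ p.1 p.2 ^ 2 ∂q ≤ Λ * carlesonConst n * ∫⁻ u, φ u ^ 2 := by
  have hW := bumpMass_ne_top n
  have hW0 := bumpMass_ne_zero n
  have h2W : 2 * bumpMass n ≠ ⊤ := ENNReal.mul_ne_top (by simp) hW
  have h2W0 : 2 * bumpMass n ≠ 0 := mul_ne_zero (by simp) hW0
  have hm := measurable_bumpAvg hφ
  have hset : ∀ l : ℝ, 0 < l → q {p | l < (bumpAvg φ p.1 p.2).toReal} =
      q {p | 0 < p.1 ∧ ENNReal.ofReal l < bumpAvg φ p.1 p.2} := by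
    intro l hl
    apply measure_congr
    filter_upwards [hq.ae_pos] with p hp
    apply propext
    change l < (bumpAvg φ p.1 p.2).toReal ↔ 0 < p.1 ∧ ENNReal.ofReal l < bumpAvg φ p.1 p.2
    rw [ENNReal.ofReal_lt_iff_lt_toReal hl.le (bumpAvg_ne_top hφ hφ2 hp p.2)]
    exact ⟨fun h => ⟨hp, h⟩, fun h => h.2⟩
  have hjoint : Measurable (fun z : ℝ × Eucl n =>
      {u | ENNReal.ofReal z.1 < 2 * bumpMass n * φ u}.indicator φ z.2) := by
    have hs : MeasurableSet {z : ℝ × Eucl n | ENNReal.ofReal z.1 < 2 * bumpMass n * φ z.2} :=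
      measurableSet_lt measurable_fst.ennreal_ofReal ((hφ.comp measurable_snd).const_mul _)
    have := (hφ.comp (measurable_snd (α := ℝ))).indicator hs
    convert this using 1
    ext z
    simp [Set.indicator]
  -- Layer-cake formula for the square, the truncated weak-type bound at each level, then Tonelli:
  -- the levels `l < 2 bumpMass n φ(u)` contribute `φ(u)` times their length, that is `2 bumpMass n
  -- φ(u)²`.
  calc ∫⁻ p, bumpAvg φ p.1 p.2 ^ 2 ∂q
      = ∫⁻ p, ENNReal.ofReal ((bumpAvg φ p.1 p.2).toReal ^ (2 : ℝ)) ∂q := by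
        apply lintegral_congr_ae
        filter_upwards [hq.ae_pos] with p hp
        rw [Real.rpow_ofNat, ENNReal.ofReal_pow ENNReal.toReal_nonneg,
          ENNReal.ofReal_toReal (bumpAvg_ne_top hφ hφ2 hp p.2)]
    _ = ENNReal.ofReal 2 * ∫⁻ l in Set.Ioi 0, q {p | l < (bumpAvg φ p.1 p.2).toReal} *
          ENNReal.ofReal (l ^ ((2 : ℝ) - 1)) :=
        lintegral_rpow_eq_lintegral_meas_lt_mul q
          (Filter.Eventually.of_forall fun _ => ENNReal.toReal_nonneg)
          hm.ennreal_toReal.aemeasurable two_pos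
    _ ≤ ENNReal.ofReal 2 * ∫⁻ l in Set.Ioi 0, Λ * 3 ^ n * 2 ^ (n + 3) *
        ∫⁻ u, {u | ENNReal.ofReal l < 2 * bumpMass n * φ u}.indicator φ u := by
        gcongr 1
        apply setLIntegral_mono' measurableSet_Ioi
        intro l hl
        rw [hset l hl]
        have : (2 : ℝ) - 1 = 1 := by norm_num
        rw [this, Real.rpow_one]
        exact hq.weak_type_truncated hn hφ hφ2 hl
    _ = ENNReal.ofReal 2 * (Λ * 3 ^ n * 2 ^ (n + 3) * ∫⁻ u, ∫⁻ l in Set.Ioi 0,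
        {u | ENNReal.ofReal l < 2 * bumpMass n * φ u}.indicator φ u) := by
        rw [lintegral_const_mul _ hjoint.lintegral_prod_right,
          lintegral_lintegral_swap hjoint.aemeasurable]
    _ ≤ ENNReal.ofReal 2 * (Λ * 3 ^ n * 2 ^ (n + 3) * ∫⁻ u, 2 * bumpMass n * φ u ^ 2) := by
        gcongr with u
        set c := 2 * bumpMass n * φ u with hc
        have e : ∀ l : ℝ, {u | ENNReal.ofReal l < 2 * bumpMass n * φ u}.indicator φ u =
            {l : ℝ | ENNReal.ofReal l < c}.indicator (fun _ => φ u) l := by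
          intro l
          by_cases h : ENNReal.ofReal l < c
          · rw [Set.indicator_of_mem (by exact h), Set.indicator_of_mem (by exact h)]
          · rw [Set.indicator_of_notMem (by exact h), Set.indicator_of_notMem (by exact h)]
        simp only [e]
        have hms : MeasurableSet {l : ℝ | ENNReal.ofReal l < c} :=
          measurableSet_lt ENNReal.measurable_ofReal measurable_const
        rw [lintegral_indicator hms, lintegral_const, Measure.restrict_apply_univ,
          Measure.restrict_apply hms]
        have hv : volume ({l : ℝ | ENNReal.ofReal l < c} ∩ Set.Ioi 0) ≤ c := by
          rcases eq_or_ne c ⊤ with h | h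
          · rw [h]; exact le_top
          · calc _ ≤ volume (Set.Ioo 0 c.toReal) := by
                  apply measure_mono
                  rintro l ⟨h1, h2⟩
                  exact ⟨h2, (ENNReal.ofReal_lt_iff_lt_toReal (le_of_lt h2) h).1 h1⟩
              _ = c := by rw [Real.volume_Ioo, sub_zero, ENNReal.ofReal_toReal h]
        calc _ ≤ φ u * c := by gcongr
          _ = _ := by rw [hc]; ring
    _ = _ := by
        rw [lintegral_const_mul _ (hφ.pow_const 2)]
        simp only [ENNReal.ofReal_ofNat, carlesonConst]
        ring

end IsCarlesonMeasure

end CarlesonEmbedding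

/-! ### The change of variables x ↦ x - τ x -/

section Deformation

variable {n : ℕ}

/-- By the Leibniz formula the determinant is a polynomial in the coordinates of `T`. -/
theorem contDiff_det_one_sub :
    ContDiff ℝ 1 (fun T : Eucl n →L[ℝ] Eucl n => (1 - T).det) := by
  have e : (fun T : Eucl n →L[ℝ] Eucl n => (1 - T).det) = fun T =>
      ∑ σ : Equiv.Perm (Fin n), Equiv.Perm.sign σ •
        ∏ j, ((1 - T) (EuclideanSpace.single j 1)) (σ j) := by
    ext T
    rw [ContinuousLinearMap.det, ← LinearMap.det_toMatrix (EuclideanSpace.basisFun (Fin n) ℝ).toBasis,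
      Matrix.det_apply]
    congr 1
  rw [e]
  apply ContDiff.sum
  intro σ _
  apply ContDiff.const_smul
  apply contDiff_prod
  intro i _
  fun_prop

/-- On the compact ball `‖T‖ ≤ 1/2` the operator `1 - T` is invertible (Neumann series), the
determinant is Lipschitz because it is `C¹`, and its inverse is continuous, hence bounded. -/
theorem exists_det_bound (n : ℕ) : ∃ C : ℝ, 1 ≤ C ∧ ∀ T : Eucl n →L[ℝ] Eucl n, ‖T‖ ≤ 1 / 2 →
    |(|(1 - T).det| - 1)| ≤ C * ‖T‖ ∧ 0 < |(1 - T).det| ∧ |(1 - T).det|⁻¹ ≤ C := by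
  have hc := contDiff_det_one_sub (n := n)
  have hK : IsCompact (Metric.closedBall (0 : Eucl n →L[ℝ] Eucl n) (1 / 2)) :=
    isCompact_closedBall _ _
  have hne : ∀ T : Eucl n →L[ℝ] Eucl n, ‖T‖ ≤ 1 / 2 → (1 - T).det ≠ 0 := by
    intro T hT
    have hu : IsUnit (1 - T) := isUnit_one_sub_of_norm_lt_one (by linarith)
    have hu2 : IsUnit ((1 - T : Eucl n →L[ℝ] Eucl n) : Eucl n →ₗ[ℝ] Eucl n) :=
      hu.map (ContinuousLinearMap.toLinearMapRingHom :
        (Eucl n →L[ℝ] Eucl n) →+* (Eucl n →ₗ[ℝ] Eucl n))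
    exact ((LinearMap.isUnit_iff_isUnit_det _).1 hu2).ne_zero
  obtain ⟨C1, h1⟩ := hK.exists_bound_of_continuousOn
    (hc.continuous_fderiv (by norm_num)).continuousOn
  obtain ⟨C2, h2⟩ := hK.exists_bound_of_continuousOn
    (f := fun T : Eucl n →L[ℝ] Eucl n => |(1 - T).det|⁻¹) (by
      apply ContinuousOn.inv₀
      · exact hc.continuous.abs.continuousOn
      · intro T hT
        exact abs_ne_zero.2 (hne T (by simpa using hT)))
  refine ⟨max 1 (max C1 C2), le_max_left _ _, fun T hT => ⟨?_, abs_pos.2 (hne T hT), ?_⟩⟩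
  · have hmem : T ∈ Metric.closedBall (0 : Eucl n →L[ℝ] Eucl n) (1 / 2) := by simpa using hT
    have h := (convex_closedBall (0 : Eucl n →L[ℝ] Eucl n) (1 / 2)).norm_image_sub_le_of_norm_fderiv_le
      (𝕜 := ℝ) (fun x _ => (hc.differentiable (by norm_num)) x) h1
      (Metric.mem_closedBall_self (by norm_num)) hmem
    simp only [sub_zero] at h
    have h0 : (1 : Eucl n →L[ℝ] Eucl n).det = 1 := by simp [ContinuousLinearMap.det]
    rw [h0, Real.norm_eq_abs] at h
    calc |(|(1 - T).det| - 1)| = |(|(1 - T).det| - |1|)| := by rw [abs_one]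
      _ ≤ |(1 - T).det - 1| := abs_abs_sub_abs_le _ _
      _ ≤ C1 * ‖T‖ := h
      _ ≤ _ := by gcongr; exact (le_max_left _ _).trans (le_max_right _ _)
  · have := h2 T (by simpa using hT)
    simp only [Real.norm_eq_abs, abs_inv, abs_abs] at this
    exact this.trans ((le_max_right _ _).trans (le_max_right _ _))

/-- A bound for the Jacobian determinants of small perturbations of the identity. -/
noncomputable def detConst (n : ℕ) : ℝ := (exists_det_bound n).choose

theorem one_le_detConst (n : ℕ) : 1 ≤ detConst n := (exists_det_bound n).choose_spec.1

/-- Displacement fields with derivative of operator norm at most `δ ≤ 1/2`. -/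
structure IsSmallDisplacement (δ : ℝ) (τ : Eucl n → Eucl n) : Prop where
  differentiable : Differentiable ℝ τ
  norm_fderiv_le : ∀ x, ‖fderiv ℝ τ x‖ ≤ δ
  le_half : δ ≤ 1 / 2

namespace IsSmallDisplacement

variable {δ : ℝ} {τ : Eucl n → Eucl n}

theorem nonneg (h : IsSmallDisplacement δ τ) : 0 ≤ δ := (norm_nonneg _).trans (h.norm_fderiv_le 0)

theorem norm_sub_le (h : IsSmallDisplacement δ τ) (x y : Eucl n) :
    ‖τ x - τ y‖ ≤ δ * ‖x - y‖ :=
  convex_univ.norm_image_sub_le_of_norm_fderiv_le (𝕜 := ℝ) (fun z _ => h.differentiable z)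
    (fun z _ => h.norm_fderiv_le z) (Set.mem_univ y) (Set.mem_univ x)

theorem hasFDerivAt (h : IsSmallDisplacement δ τ) (x : Eucl n) :
    HasFDerivAt (fun y => y - τ y) (1 - fderiv ℝ τ x) x :=
  (hasFDerivAt_id x).sub (h.differentiable x).hasFDerivAt

theorem approximatesLinearOn (h : IsSmallDisplacement δ τ) :
    ApproximatesLinearOn (fun y => y - τ y)
      ((ContinuousLinearEquiv.refl ℝ (Eucl n) : Eucl n ≃L[ℝ] Eucl n) : Eucl n →L[ℝ] Eucl n)
      Set.univ (1 / 2) := by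
  intro x _ y _
  have e : x - τ x - (y - τ y) - ((ContinuousLinearEquiv.refl ℝ (Eucl n) :
      Eucl n ≃L[ℝ] Eucl n) : Eucl n →L[ℝ] Eucl n) (x - y) = -(τ x - τ y) := by
    simp; abel
  rw [e, norm_neg]
  refine (h.norm_sub_le x y).trans ?_
  gcongr
  simpa using h.le_half

theorem injective (h : IsSmallDisplacement δ τ) : Function.Injective (fun y => y - τ y) := by
  intro x y hxy
  have e : τ x - τ y = x - y := by
    have : x - τ x = y - τ y := hxy
    rw [sub_eq_sub_iff_add_eq_add] at this
    rw [sub_eq_sub_iff_add_eq_add, add_comm, ← this]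
  have := h.norm_sub_le x y
  rw [e] at this
  have h2 := h.le_half
  have h3 : ‖x - y‖ ≤ 0 := by nlinarith [norm_nonneg (x - y)]
  exact sub_eq_zero.1 (norm_le_zero_iff.1 h3)

/-- The homeomorphism `x ↦ x - τ x`. -/
noncomputable def homeo (hn : 1 ≤ n) (h : IsSmallDisplacement δ τ) : Eucl n ≃ₜ Eucl n :=
  h.approximatesLinearOn.toHomeomorph _ (by
    right
    -- Since `n ≥ 1` the identity has norm exactly 1, and the Lipschitz constant `1/2` of the
    -- perturbation lies below its inverse.
    have : Nonempty (Fin n) := ⟨⟨0, hn⟩⟩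
    have e : ‖((ContinuousLinearEquiv.refl ℝ (Eucl n)).symm : Eucl n →L[ℝ] Eucl n)‖₊ = 1 := by
      have : ((ContinuousLinearEquiv.refl ℝ (Eucl n)).symm : Eucl n →L[ℝ] Eucl n) =
        ContinuousLinearMap.id ℝ (Eucl n) := rfl
      rw [this]
      simp
    rw [e, inv_one]
    exact NNReal.half_lt_self one_ne_zero)

theorem homeo_apply (hn : 1 ≤ n) (h : IsSmallDisplacement δ τ) (x : Eucl n) :
    h.homeo hn x = x - τ x := rfl

theorem surjective (hn : 1 ≤ n) (h : IsSmallDisplacement δ τ) :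
    Function.Surjective (fun y => y - τ y) := (h.homeo hn).surjective

/-- The Jacobian of `x ↦ x - τ x`. -/
noncomputable def _root_.displacementJac (τ : Eucl n → Eucl n) (x : Eucl n) : ℝ :=
  |(1 - fderiv ℝ τ x).det|

theorem abs_jac_sub_one_le (h : IsSmallDisplacement δ τ) (x : Eucl n) :
    |displacementJac τ x - 1| ≤ detConst n * δ := by
  have h1 := ((exists_det_bound n).choose_spec.2 (fderiv ℝ τ x)
    ((h.norm_fderiv_le x).trans h.le_half)).1
  refine h1.trans ?_
  have := one_le_detConst n
  change detConst n * _ ≤ _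
  gcongr
  exact h.norm_fderiv_le x

theorem jac_pos (h : IsSmallDisplacement δ τ) (x : Eucl n) : 0 < displacementJac τ x :=
  ((exists_det_bound n).choose_spec.2 (fderiv ℝ τ x)
    ((h.norm_fderiv_le x).trans h.le_half)).2.1

theorem jac_inv_le (h : IsSmallDisplacement δ τ) (x : Eucl n) :
    (displacementJac τ x)⁻¹ ≤ detConst n :=
  ((exists_det_bound n).choose_spec.2 (fderiv ℝ τ x)
    ((h.norm_fderiv_le x).trans h.le_half)).2.2

theorem measurable_jac (τ : Eucl n → Eucl n) : Measurable (displacementJac τ) := by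
  unfold displacementJac
  exact (contDiff_det_one_sub.continuous.measurable.comp (measurable_fderiv ℝ τ)).abs

theorem lintegral_eq (hn : 1 ≤ n) (h : IsSmallDisplacement δ τ) (F : Eucl n → ℝ≥0∞) :
    ∫⁻ y, F y = ∫⁻ x, ENNReal.ofReal (displacementJac τ x) * F (x - τ x) := by
  have := lintegral_image_eq_lintegral_abs_det_fderiv_mul volume MeasurableSet.univ
    (f := fun y => y - τ y) (f' := fun x => 1 - fderiv ℝ τ x)
    (fun x _ => (h.hasFDerivAt x).hasFDerivWithinAt) h.injective.injOn F
  rw [Set.image_univ, (h.surjective hn).range_eq] at this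
  simpa [displacementJac] using this

theorem integral_eq (hn : 1 ≤ n) (h : IsSmallDisplacement δ τ) {V : Type*}
    [NormedAddCommGroup V] [NormedSpace ℝ V] (F : Eucl n → V) :
    ∫ y, F y = ∫ x, displacementJac τ x • F (x - τ x) := by
  have := integral_image_eq_integral_abs_det_fderiv_smul volume MeasurableSet.univ
    (f := fun y => y - τ y) (f' := fun x => 1 - fderiv ℝ τ x)
    (fun x _ => (h.hasFDerivAt x).hasFDerivWithinAt) h.injective.injOn F
  rw [Set.image_univ, (h.surjective hn).range_eq] at this
  simpa [displacementJac] using this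

/-- The Jacobian is bounded below by `(detConst n)⁻¹`. -/
theorem lintegral_comp_le (hn : 1 ≤ n) (h : IsSmallDisplacement δ τ) (F : Eucl n → ℝ≥0∞) :
    ∫⁻ x, F (x - τ x) ≤ ENNReal.ofReal (detConst n) * ∫⁻ y, F y := by
  rw [h.lintegral_eq hn F, ← lintegral_const_mul' _ _ ENNReal.ofReal_ne_top]
  apply lintegral_mono
  intro x
  simp only
  have h1 := h.jac_inv_le x
  have h2 := h.jac_pos x
  rw [← mul_assoc, ← ENNReal.ofReal_mul (by linarith [one_le_detConst n])]
  apply le_mul_of_one_le_left zero_le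
  rw [ENNReal.one_le_ofReal]
  rwa [inv_le_iff_one_le_mul₀ h2] at h1

/-- The deviation from `1` of the Jacobian of the inverse of `x ↦ x - τ x`. -/
noncomputable def jacDefect (hn : 1 ≤ n) (h : IsSmallDisplacement δ τ) (y : Eucl n) : ℝ :=
  (displacementJac τ ((h.homeo hn).symm y))⁻¹ - 1

theorem measurable_jacDefect (hn : 1 ≤ n) (h : IsSmallDisplacement δ τ) :
    Measurable (h.jacDefect hn) :=
  (((measurable_jac τ).comp (h.homeo hn).symm.continuous.measurable).inv).sub_const 1

theorem abs_jacDefect_le (hn : 1 ≤ n) (h : IsSmallDisplacement δ τ) (y : Eucl n) :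
    |h.jacDefect hn y| ≤ detConst n ^ 2 * δ := by
  unfold jacDefect
  set x := (h.homeo hn).symm y
  have h1 := h.jac_inv_le x
  have h2 := h.jac_pos x
  have h3 := h.abs_jac_sub_one_le x
  have e : (displacementJac τ x)⁻¹ - 1 = -((displacementJac τ x)⁻¹ * (displacementJac τ x - 1)) := by
    field_simp; ring
  rw [e, abs_neg, abs_mul, abs_of_pos (inv_pos.2 h2)]
  have h4 := one_le_detConst n
  calc _ ≤ detConst n * (detConst n * δ) := by gcongr
    _ = _ := by ring

theorem jacDefect_comp (hn : 1 ≤ n) (h : IsSmallDisplacement δ τ) (x : Eucl n) :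
    h.jacDefect hn (x - τ x) = (displacementJac τ x)⁻¹ - 1 := by
  unfold jacDefect
  rw [← h.homeo_apply hn, Homeomorph.symm_apply_apply]

theorem measurable_map (h : IsSmallDisplacement δ τ) : Measurable (fun x => x - τ x) :=
  (measurable_id.sub h.differentiable.continuous.measurable)

end IsSmallDisplacement

end Deformation

/-! ### Unit-scale kernels built from a wavelet -/

section WaveletKernels

variable {n : ℕ}

theorem bump_one (z : Eucl n) : bump 1 z = ((1 + ‖z‖) ^ (n + 1))⁻¹ := by simp [bump]

theorem inv_pow_le_of_le_two_mul {a b : ℝ} (ha : 0 < a) (h : a ≤ 2 * b) (m : ℕ) :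
    (b ^ m)⁻¹ ≤ 2 ^ m * (a ^ m)⁻¹ := by
  have hb : 0 < b := by linarith
  rw [← div_eq_mul_inv, inv_le_comm₀ (by positivity) (by positivity), inv_div,
    div_le_iff₀ (by positivity), mul_comm, ← mul_pow]
  gcongr

/-- Kernels at scale one with decay and Lipschitz regularity in the second variable. -/
structure IsUnitKernel (D : ℝ) (k : Eucl n → Eucl n → ℂ) : Prop where
  size : ∀ x u, ‖k x u‖ ≤ D * bump 1 (x - u)
  lipschitz : ∀ x u u', ‖k x u - k x u'‖ ≤ D * (‖u - u'‖ * (bump 1 (x - u) + bump 1 (x - u')))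

/-- At distance at least 1 the size bound suffices; at distance below 1 the mean value inequality
applies, and a unit shift changes the weight by at most the factor `2 ^ (n+1)`. -/
theorem IsUnitKernel.of_fderiv {D : ℝ} (hD : 0 ≤ D) {k : Eucl n → Eucl n → ℂ}
    {k' : Eucl n → Eucl n → (Eucl n →L[ℝ] ℂ)} (hk : ∀ x u, HasFDerivAt (k x) (k' x u) u)
    (hsize : ∀ x u, ‖k x u‖ ≤ D * bump 1 (x - u))
    (hgrad : ∀ x u, ‖k' x u‖ ≤ D * bump 1 (x - u)) :
    IsUnitKernel (2 ^ (n + 1) * D) k := by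
  have h2 : (1 : ℝ) ≤ 2 ^ (n + 1) := one_le_pow₀ one_le_two
  have hD2 : D ≤ 2 ^ (n + 1) * D := le_mul_of_one_le_left hD h2
  refine ⟨fun x u => (hsize x u).trans ?_, fun x u u' => ?_⟩
  · have := bump_nonneg one_pos (x - u)
    gcongr
  · have b1 := bump_nonneg one_pos (x - u)
    have b2 := bump_nonneg one_pos (x - u')
    rcases le_total 1 ‖u - u'‖ with h | h
    · calc ‖k x u - k x u'‖ ≤ ‖k x u‖ + ‖k x u'‖ := norm_sub_le _ _
        _ ≤ D * bump 1 (x - u) + D * bump 1 (x - u') := add_le_add (hsize _ _) (hsize _ _)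
        _ = D * (1 * (bump 1 (x - u) + bump 1 (x - u'))) := by ring
        _ ≤ _ := by gcongr
    · have hb : ∀ v ∈ Metric.closedBall u' 1, ‖k' x v‖ ≤ 2 ^ (n + 1) * D * bump 1 (x - u') := by
        intro v hv
        rw [Metric.mem_closedBall, dist_eq_norm] at hv
        refine (hgrad x v).trans ?_
        rw [mul_comm _ D, mul_assoc]
        gcongr
        rw [bump_one, bump_one]
        apply inv_pow_le_of_le_two_mul (by positivity)
        have : ‖x - u'‖ ≤ ‖x - v‖ + ‖v - u'‖ := norm_sub_le_norm_sub_add_norm_sub _ _ _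
        have := norm_nonneg (x - v)
        linarith
      have := (convex_closedBall u' 1).norm_image_sub_le_of_norm_hasFDerivWithin_le (𝕜 := ℝ)
        (fun v _ => (hk x v).hasFDerivWithinAt) hb
        (Metric.mem_closedBall_self (by norm_num)) (show u ∈ Metric.closedBall u' 1 by
          rw [Metric.mem_closedBall, dist_eq_norm]; exact h)
      calc _ ≤ _ := this
        _ = 2 ^ (n + 1) * D * (‖u - u'‖ * bump 1 (x - u')) := by ring
        _ ≤ _ := by gcongr; linarith

theorem le_sqrt_of_le_one {a : ℝ} (h0 : 0 ≤ a) (h1 : a ≤ 1) : a ≤ √a := by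
  apply Real.le_sqrt_of_sq_le
  nlinarith

theorem IsUnitKernel.scaled_size {D : ℝ} {k : Eucl n → Eucl n → ℂ} (hk : IsUnitKernel D k)
    {t : ℝ} (ht : 0 < t) (x u : Eucl n) :
    ‖(((t ^ n)⁻¹ : ℝ) : ℂ) * k (t⁻¹ • x) (t⁻¹ • u)‖ ≤ D * bump t (x - u) := by
  rw [norm_mul, Complex.norm_real, Real.norm_eq_abs, abs_of_pos (by positivity),
    bump_eq_scaled ht, smul_sub]
  calc _ ≤ (t ^ n)⁻¹ * (D * bump 1 (t⁻¹ • x - t⁻¹ • u)) := by gcongr; exact hk.size _ _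
    _ = _ := by ring

/-- For `‖u - u'‖ ≤ t` the Lipschitz bound is weakened by `a ≤ √a`; for larger distances the size
bound is enough since the root is at least 1. -/
theorem IsUnitKernel.scaled_holder {D : ℝ} (hD : 0 ≤ D) {k : Eucl n → Eucl n → ℂ}
    (hk : IsUnitKernel D k) {t : ℝ} (ht : 0 < t) (x u u' : Eucl n) :
    ‖(((t ^ n)⁻¹ : ℝ) : ℂ) * k (t⁻¹ • x) (t⁻¹ • u) -
      (((t ^ n)⁻¹ : ℝ) : ℂ) * k (t⁻¹ • x) (t⁻¹ • u')‖ ≤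
      D * (√(‖u - u'‖ / t) * (bump t (x - u) + bump t (x - u'))) := by
  have b1 := bump_nonneg ht (x - u)
  have b2 := bump_nonneg ht (x - u')
  have ha : 0 ≤ ‖u - u'‖ / t := by positivity
  rcases le_total (‖u - u'‖ / t) 1 with h | h
  · calc _ = (t ^ n)⁻¹ * ‖k (t⁻¹ • x) (t⁻¹ • u) - k (t⁻¹ • x) (t⁻¹ • u')‖ := by
          rw [← mul_sub, norm_mul, Complex.norm_real, Real.norm_eq_abs, abs_of_pos (by positivity)]
      _ ≤ (t ^ n)⁻¹ * (D * (‖t⁻¹ • u - t⁻¹ • u'‖ *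
          (bump 1 (t⁻¹ • x - t⁻¹ • u) + bump 1 (t⁻¹ • x - t⁻¹ • u')))) := by
          gcongr; exact hk.lipschitz _ _ _
      _ = D * (‖u - u'‖ / t * (bump t (x - u) + bump t (x - u'))) := by
          rw [← smul_sub, ← smul_sub, ← smul_sub, norm_smul, norm_inv, Real.norm_eq_abs,
            abs_of_pos ht, bump_eq_scaled ht (x - u), bump_eq_scaled ht (x - u')]
          ring
      _ ≤ _ := by gcongr; exact le_sqrt_of_le_one ha h
  · calc _ ≤ _ := norm_sub_le _ _
      _ ≤ D * bump t (x - u) + D * bump t (x - u') :=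
          add_le_add (hk.scaled_size ht _ _) (hk.scaled_size ht _ _)
      _ = D * (1 * (bump t (x - u) + bump t (x - u'))) := by ring
      _ ≤ _ := by gcongr; exact Real.one_le_sqrt.2 h

/-- Wavelets with two derivatives bounded, in operator norm, by `B (1 + |x|)^(-n-2)`. -/
structure IsSmoothWavelet (B : ℝ) (ψ : Eucl n → ℂ) : Prop where
  contDiff : ContDiff ℝ 2 ψ
  integral_eq_zero : ∫ x, ψ x = 0
  norm_le : ∀ x, ‖ψ x‖ ≤ B * ((1 + ‖x‖) ^ (n + 2))⁻¹
  norm_fderiv_le : ∀ x, ‖fderiv ℝ ψ x‖ ≤ B * ((1 + ‖x‖) ^ (n + 2))⁻¹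
  norm_fderiv_fderiv_le : ∀ x, ‖fderiv ℝ (fderiv ℝ ψ) x‖ ≤ B * ((1 + ‖x‖) ^ (n + 2))⁻¹

theorem inv_pow_add_two_le_bump (z : Eucl n) : ((1 + ‖z‖) ^ (n + 2))⁻¹ ≤ bump 1 z := by
  rw [bump_one]
  gcongr
  · linarith [norm_nonneg z]
  · omega

namespace IsSmoothWavelet

variable {B : ℝ} {ψ : Eucl n → ℂ}

theorem nonneg (h : IsSmoothWavelet B ψ) : 0 ≤ B := by
  have := (norm_nonneg _).trans (h.norm_le 0)
  simpa using this

theorem differentiable (h : IsSmoothWavelet B ψ) : Differentiable ℝ ψ :=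
  h.contDiff.differentiable (by norm_num)

theorem differentiable_fderiv (h : IsSmoothWavelet B ψ) : Differentiable ℝ (fderiv ℝ ψ) :=
  (h.contDiff.fderiv_right (m := 1) (by norm_num)).differentiable (by norm_num)

theorem isUnitKernel (h : IsSmoothWavelet B ψ) :
    IsUnitKernel (2 ^ (n + 1) * B) (fun x u => ψ (x - u)) := by
  refine IsUnitKernel.of_fderiv h.nonneg (k' := fun x u => -(fderiv ℝ ψ (x - u))) ?_ ?_ ?_
  · intro x u
    have h1 : HasFDerivAt (fun u : Eucl n => x - u) (-(ContinuousLinearMap.id ℝ (Eucl n))) u :=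
      (hasFDerivAt_id u).const_sub x
    have h2 : HasFDerivAt (fun u => ψ (x - u))
        ((fderiv ℝ ψ (x - u)).comp (-(ContinuousLinearMap.id ℝ (Eucl n)))) u :=
      (h.differentiable (x - u)).hasFDerivAt.comp u h1
    rwa [ContinuousLinearMap.comp_neg, ContinuousLinearMap.comp_id] at h2
  · intro x u
    exact (h.norm_le _).trans (mul_le_mul_of_nonneg_left (inv_pow_add_two_le_bump _) h.nonneg)
  · intro x u
    rw [norm_neg]
    exact (h.norm_fderiv_le _).trans
      (mul_le_mul_of_nonneg_left (inv_pow_add_two_le_bump _) h.nonneg)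

/-- Mean value inequality on the ball of radius `‖z‖ / 2` about `z`, where the weight is comparable
to its value at `z`. The extra power in the exponent `n + 2` absorbs the factor `‖z‖` from `‖w‖ ≤ δ
‖z‖`, leaving the exponent `n + 1` of `bump`. -/
theorem norm_sub_le_of_bound {V : Type*} [NormedAddCommGroup V] [NormedSpace ℝ V]
    (hB : 0 ≤ B) {F : Eucl n → V} (hF : Differentiable ℝ F)
    (hbd : ∀ x, ‖fderiv ℝ F x‖ ≤ B * ((1 + ‖x‖) ^ (n + 2))⁻¹) {δ : ℝ}
    (hδ0 : 0 ≤ δ) (hδ : δ ≤ 1 / 2) {z w : Eucl n} (hw : ‖w‖ ≤ δ * ‖z‖) :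
    ‖F (z - w) - F z‖ ≤ 2 ^ (n + 2) * B * δ * bump 1 z := by
  have hz := norm_nonneg z
  have hw2 : ‖w‖ ≤ ‖z‖ / 2 := hw.trans (by nlinarith)
  have hb : ∀ v ∈ Metric.closedBall z (‖z‖ / 2),
      ‖fderiv ℝ F v‖ ≤ 2 ^ (n + 2) * B * ((1 + ‖z‖) ^ (n + 2))⁻¹ := by
    intro v hv
    rw [Metric.mem_closedBall, dist_eq_norm] at hv
    refine (hbd v).trans ?_
    rw [mul_comm _ B, mul_assoc]
    gcongr
    apply inv_pow_le_of_le_two_mul (by positivity)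
    have : ‖z‖ - ‖v‖ ≤ ‖v - z‖ := by rw [norm_sub_rev]; exact norm_sub_norm_le _ _
    linarith
  have := (convex_closedBall z (‖z‖ / 2)).norm_image_sub_le_of_norm_fderiv_le (𝕜 := ℝ)
    (fun v _ => hF v) hb (Metric.mem_closedBall_self (by positivity))
    (show z - w ∈ Metric.closedBall z (‖z‖ / 2) by
      rw [Metric.mem_closedBall, dist_eq_norm]; simpa using hw2)
  calc _ ≤ _ := this
    _ = 2 ^ (n + 2) * B * ((1 + ‖z‖) ^ (n + 2))⁻¹ * ‖w‖ := by simp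
    _ ≤ 2 ^ (n + 2) * B * ((1 + ‖z‖) ^ (n + 2))⁻¹ * (δ * ‖z‖) := by gcongr
    _ = 2 ^ (n + 2) * B * δ * (‖z‖ * ((1 + ‖z‖) ^ (n + 2))⁻¹) := by ring
    _ ≤ _ := by
        gcongr
        rw [bump_one, ← div_eq_mul_inv, ← one_div, div_le_div_iff₀ (by positivity) (by positivity)]
        rw [one_mul, pow_succ _ (n + 1), mul_comm]
        gcongr
        linarith

/-- The arguments `x - u` and `(x - τ x) - (u - τ u)` differ by at most `δ ‖x - u‖`, so the kernel
is `O(δ)`. Differentiating once in `u` involves second derivatives of `ψ` but only `Dτ`, so no bound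
on `D²τ` is required. -/
theorem isUnitKernel_sub (h : IsSmoothWavelet B ψ) {δ : ℝ} {τ : Eucl n → Eucl n}
    (hτ : IsSmallDisplacement δ τ) :
    IsUnitKernel (2 ^ (n + 1) * (2 ^ (n + 3) * B * δ))
      (fun x u => ψ (x - u) - ψ ((x - τ x) - (u - τ u))) := by
  have hB := h.nonneg
  have hδ := hτ.nonneg
  have e : ∀ x u : Eucl n, (x - τ x) - (u - τ u) = (x - u) - (τ x - τ u) := fun x u => by abel
  refine IsUnitKernel.of_fderiv (by positivity) (k' := fun x u => -(fderiv ℝ ψ (x - u)) -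
    (fderiv ℝ ψ ((x - τ x) - (u - τ u))).comp (-(1 - fderiv ℝ τ u))) ?_ ?_ ?_
  · intro x u
    have h1 : HasFDerivAt (fun u : Eucl n => x - u) (-(ContinuousLinearMap.id ℝ (Eucl n))) u :=
      (hasFDerivAt_id u).const_sub x
    have h2 : HasFDerivAt (fun u => ψ (x - u))
        ((fderiv ℝ ψ (x - u)).comp (-(ContinuousLinearMap.id ℝ (Eucl n)))) u :=
      (h.differentiable (x - u)).hasFDerivAt.comp u h1
    rw [ContinuousLinearMap.comp_neg, ContinuousLinearMap.comp_id] at h2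
    have h3 : HasFDerivAt (fun u : Eucl n => (x - τ x) - (u - τ u)) (-(1 - fderiv ℝ τ u)) u :=
      (hτ.hasFDerivAt u).const_sub _
    exact h2.sub ((h.differentiable ((x - τ x) - (u - τ u))).hasFDerivAt.comp u h3)
  · intro x u
    have hb := bump_nonneg one_pos (x - u)
    simp only [e]
    rw [norm_sub_rev]
    refine (norm_sub_le_of_bound hB h.differentiable h.norm_fderiv_le hδ hτ.le_half
      (hτ.norm_sub_le x u)).trans ?_
    gcongr
    · exact one_le_two
    · omega
  · intro x u
    have hb := bump_nonneg one_pos (x - u)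
    simp only [e]
    set z := x - u with hz
    set w := τ x - τ u with hw
    have hw1 : ‖w‖ ≤ δ * ‖z‖ := hτ.norm_sub_le x u
    -- The gradient splits into an increment of `Dψ`, controlled by `D²ψ`, and `Dψ` composed with
    -- `Dτ`; each is `O(δ)`.
    have e2 : -(fderiv ℝ ψ z) - (fderiv ℝ ψ (z - w)).comp (-(1 - fderiv ℝ τ u)) =
        (fderiv ℝ ψ (z - w) - fderiv ℝ ψ z) - (fderiv ℝ ψ (z - w)).comp (fderiv ℝ τ u) := by
      ext v
      simp
      ring
    rw [e2]
    have a1 := norm_sub_le_of_bound hB h.differentiable_fderiv h.norm_fderiv_fderiv_le hδ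
      hτ.le_half hw1
    have a2 : ‖fderiv ℝ ψ (z - w)‖ ≤ B * (2 ^ (n + 2) * bump 1 z) := by
      refine (h.norm_fderiv_le _).trans ?_
      gcongr
      refine (inv_pow_le_of_le_two_mul (a := 1 + ‖z‖) (by positivity) ?_ (n + 2)).trans ?_
      · have h5 : ‖z‖ - ‖w‖ ≤ ‖z - w‖ := norm_sub_norm_le _ _
        have h6 := hτ.le_half
        nlinarith [norm_nonneg z]
      · gcongr; exact inv_pow_add_two_le_bump z
    have a3 := hτ.norm_fderiv_le u
    calc _ ≤ _ := norm_sub_le _ _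
      _ ≤ 2 ^ (n + 2) * B * δ * bump 1 z + B * (2 ^ (n + 2) * bump 1 z) * δ := by
          gcongr
          refine (ContinuousLinearMap.opNorm_comp_le _ _).trans ?_
          gcongr
      _ = _ := by ring

end IsSmoothWavelet

end WaveletKernels

/-! ### Passing to all scales -/

section Dilations

variable {n : ℕ}

/-- The `L¹`-normalised dilation `t⁻ⁿ ψ(z/t)`. -/
noncomputable def dilate (ψ : Eucl n → ℂ) (t : ℝ) (z : Eucl n) : ℂ :=
  (((t ^ n)⁻¹ : ℝ) : ℂ) * ψ (t⁻¹ • z)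

theorem measurable_dilate {ψ : Eucl n → ℂ} (hψ : Measurable ψ) :
    Measurable (fun p : ℝ × Eucl n => dilate ψ p.1 p.2) := by
  unfold dilate
  apply Measurable.mul
  · exact Complex.measurable_ofReal.comp (by fun_prop)
  · exact hψ.comp (measurable_fst.inv.smul measurable_snd)

theorem integral_dilate {ψ : Eucl n → ℂ} (hψ : ∫ x, ψ x = 0) (t : ℝ) :
    ∫ z, dilate ψ t z = 0 := by
  unfold dilate
  rw [integral_const_mul, Measure.integral_comp_smul, hψ]
  simp

/-- The derivative is invariant under conjugating `τ` by a dilation; this makes the unit-scale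
estimates uniform in `t`. -/
theorem IsSmallDisplacement.rescale {δ : ℝ} {τ : Eucl n → Eucl n} (h : IsSmallDisplacement δ τ)
    {t : ℝ} (ht : 0 < t) : IsSmallDisplacement δ (fun x => t⁻¹ • τ (t • x)) := by
  have hd : ∀ x : Eucl n, HasFDerivAt (fun x => t⁻¹ • τ (t • x)) (fderiv ℝ τ (t • x)) x := by
    intro x
    have h1 : HasFDerivAt (fun x : Eucl n => t • x) (t • ContinuousLinearMap.id ℝ (Eucl n)) x :=
      (hasFDerivAt_id x).const_smul t
    have h2 := ((h.differentiable (t • x)).hasFDerivAt.comp x h1).const_smul t⁻¹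
    rwa [ContinuousLinearMap.comp_smul, ContinuousLinearMap.comp_id, smul_smul,
      inv_mul_cancel₀ ht.ne', one_smul] at h2
  refine ⟨fun x => (hd x).differentiableAt, fun x => ?_, h.le_half⟩
  rw [(hd x).fderiv]
  exact h.norm_fderiv_le _

/-- The kernel of the commutator of a convolution and a change of variables. -/
noncomputable def commKernel (ψ : Eucl n → ℂ) (τ : Eucl n → Eucl n) (t : ℝ) (x u : Eucl n) : ℂ :=
  dilate ψ t (x - u) - dilate ψ t ((x - τ x) - (u - τ u))

theorem measurable_commKernel {ψ : Eucl n → ℂ} (hψ : Measurable ψ) {τ : Eucl n → Eucl n}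
    (hτ : Measurable τ) :
    Measurable (fun p : (ℝ × Eucl n) × Eucl n => commKernel ψ τ p.1.1 p.1.2 p.2) := by
  unfold commKernel
  have h1 : Measurable (fun p : (ℝ × Eucl n) × Eucl n => p.1.1) :=
    measurable_fst.comp measurable_fst
  have h2 : Measurable (fun p : (ℝ × Eucl n) × Eucl n => p.1.2) :=
    measurable_snd.comp measurable_fst
  have h3 : Measurable (fun p : (ℝ × Eucl n) × Eucl n => p.2) := measurable_snd
  exact ((measurable_dilate hψ).comp (h1.prodMk (h2.sub h3))).sub
    ((measurable_dilate hψ).comp (h1.prodMk ((h2.sub (hτ.comp h2)).sub (h3.sub (hτ.comp h3)))))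

theorem commKernel_eq_scaled (ψ : Eucl n → ℂ) (τ : Eucl n → Eucl n) {t : ℝ} (ht : 0 < t)
    (x u : Eucl n) : commKernel ψ τ t x u = (((t ^ n)⁻¹ : ℝ) : ℂ) *
      (fun x u => ψ (x - u) - ψ ((x - t⁻¹ • τ (t • x)) - (u - t⁻¹ • τ (t • u))))
        (t⁻¹ • x) (t⁻¹ • u) := by
  simp only [commKernel, dilate, smul_smul, mul_inv_cancel₀ ht.ne', one_smul, smul_sub, mul_sub]

namespace IsSmoothWavelet

variable {B : ℝ} {ψ : Eucl n → ℂ}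

theorem isSquareKernel (h : IsSmoothWavelet B ψ) :
    IsSquareKernel (2 ^ (n + 1) * B) (fun t x u => dilate ψ t (x - u)) := by
  have hB := h.nonneg
  have hk := h.isUnitKernel
  have e : ∀ t : ℝ, ∀ x u : Eucl n, dilate ψ t (x - u) = (((t ^ n)⁻¹ : ℝ) : ℂ) *
      (fun x u => ψ (x - u)) (t⁻¹ • x) (t⁻¹ • u) := fun t x u => by
    simp only [dilate, smul_sub]
  refine ⟨?_, fun t ht x u => ?_, fun t ht x u u' => ?_, fun t ht x => ?_⟩
  · exact (measurable_dilate h.contDiff.continuous.measurable).comp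
      ((measurable_fst.comp measurable_fst).prodMk
        ((measurable_snd.comp measurable_fst).sub measurable_snd))
  · rw [e]; exact hk.scaled_size ht x u
  · rw [e, e]; exact hk.scaled_holder (by positivity) ht x u u'
  · rw [integral_sub_left_eq_self (fun z => dilate ψ t z) volume x]
    exact integral_dilate h.integral_eq_zero t

theorem commKernel_size (h : IsSmoothWavelet B ψ) {δ : ℝ} {τ : Eucl n → Eucl n}
    (hτ : IsSmallDisplacement δ τ) {t : ℝ} (ht : 0 < t) (x u : Eucl n) :
    ‖commKernel ψ τ t x u‖ ≤ 2 ^ (n + 1) * (2 ^ (n + 3) * B * δ) * bump t (x - u) := by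
  rw [commKernel_eq_scaled ψ τ ht]
  exact (h.isUnitKernel_sub (hτ.rescale ht)).scaled_size ht x u

theorem commKernel_holder (h : IsSmoothWavelet B ψ) {δ : ℝ} {τ : Eucl n → Eucl n}
    (hτ : IsSmallDisplacement δ τ) {t : ℝ} (ht : 0 < t) (x u u' : Eucl n) :
    ‖commKernel ψ τ t x u - commKernel ψ τ t x u'‖ ≤ 2 ^ (n + 1) * (2 ^ (n + 3) * B * δ) *
      (√(‖u - u'‖ / t) * (bump t (x - u) + bump t (x - u'))) := by
  have hB := h.nonneg
  have hδ := hτ.nonneg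
  rw [commKernel_eq_scaled ψ τ ht, commKernel_eq_scaled ψ τ ht]
  exact (h.isUnitKernel_sub (hτ.rescale ht)).scaled_holder (by positivity) ht x u u'

end IsSmoothWavelet

end Dilations

/-! ### Integrability of kernels and the Carleson condition for the Jacobian defect -/

section Commutator

variable {n : ℕ}

/-- Hölder-1/2 regularity of the weight, needed because the weight itself is subtracted to create
cancellation. -/
theorem abs_bump_sub_le_sqrt {t : ℝ} (ht : 0 < t) (z z' : Eucl n) :
    |bump t z - bump t z'| ≤ (n + 1) * (√(‖z - z'‖ / t) * (bump t z + bump t z')) := by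
  have b1 := bump_nonneg ht z
  have b2 := bump_nonneg ht z'
  have ha : 0 ≤ ‖z - z'‖ / t := by positivity
  rcases le_total (‖z - z'‖ / t) 1 with h | h
  · refine (bump_sub_bump_le ht z z').trans ?_
    rw [mul_assoc]
    gcongr
    exact le_sqrt_of_le_one ha h
  · have h1 : |bump t z - bump t z'| ≤ bump t z + bump t z' := by
      rw [abs_le]; constructor <;> linarith
    have h2 : (1 : ℝ) ≤ √(‖z - z'‖ / t) := Real.one_le_sqrt.2 h
    calc _ ≤ 1 * (1 * (bump t z + bump t z')) := by linarith
      _ ≤ _ := by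
        gcongr
        linarith [(Nat.cast_nonneg n : (0 : ℝ) ≤ n)]

theorem integrable_bump_mul_norm {f : Eucl n → ℂ} (hf : Measurable f)
    (hf2 : ∫⁻ u, ‖f u‖ₑ ^ 2 ≠ ⊤) {t : ℝ} (ht : 0 < t) (x : Eucl n) :
    Integrable (fun u => bump t (x - u) * ‖f u‖) := by
  have hb : Measurable (fun u : Eucl n => bump t (x - u)) :=
    (measurable_bump_right t).comp (measurable_const.sub measurable_id)
  refine ⟨(hb.mul hf.norm).aestronglyMeasurable, ?_⟩
  rw [hasFiniteIntegral_iff_ofReal (Filter.Eventually.of_forall fun u =>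
    mul_nonneg (bump_nonneg ht _) (norm_nonneg _))]
  have := (IsCarlesonMeasure.bumpAvg_ne_top hf.enorm hf2 ht x).lt_top
  refine lt_of_le_of_lt (le_of_eq ?_) this
  unfold bumpAvg
  congr 1; ext u
  rw [ENNReal.ofReal_mul (bump_nonneg ht _), ofReal_norm]

theorem integrable_kernel_mul {f : Eucl n → ℂ} (hf : Measurable f)
    (hf2 : ∫⁻ u, ‖f u‖ₑ ^ 2 ≠ ⊤) {t : ℝ} (ht : 0 < t) (x : Eucl n) {D : ℝ} {k : Eucl n → ℂ}
    (hk : Measurable k) (hkb : ∀ u, ‖k u‖ ≤ D * bump t (x - u)) :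
    Integrable (fun u => k u * f u) := by
  refine ((integrable_bump_mul_norm hf hf2 ht x).const_mul D).mono'
    (hk.mul hf).aestronglyMeasurable (Filter.Eventually.of_forall fun u => ?_)
  rw [norm_mul, ← mul_assoc]
  exact mul_le_mul_of_nonneg_right (hkb u) (norm_nonneg _)

theorem integrable_kernel_mul_bdd {b : ℝ} {β : Eucl n → ℂ} (hβ : Measurable β)
    (hβb : ∀ y, ‖β y‖ ≤ b) {t : ℝ} (ht : 0 < t) (x : Eucl n) {D : ℝ} {k : Eucl n → ℂ}
    (hk : Measurable k) (hkb : ∀ u, ‖k u‖ ≤ D * bump t (x - u)) :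
    Integrable (fun u => k u * β u) := by
  have h1 : Integrable k := (((integrable_bump ht).comp_sub_left x).const_mul D).mono'
    hk.aestronglyMeasurable (Filter.Eventually.of_forall hkb)
  exact h1.mul_bdd (c := b) hβ.aestronglyMeasurable (Filter.Eventually.of_forall hβb)

/-- The convolution with a dilated wavelet, with the kernel written first. -/
noncomputable def dilConv (ψ : Eucl n → ℂ) (t : ℝ) (b : Eucl n → ℂ) (y : Eucl n) : ℂ :=
  ∫ z, dilate ψ t (y - z) * b z

theorem measurable_dilConv {ψ : Eucl n → ℂ} (hψ : Measurable ψ) {b : Eucl n → ℂ}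
    (hb : Measurable b) : Measurable (fun p : ℝ × Eucl n => dilConv ψ p.1 b p.2) := by
  unfold dilConv
  have h1 : Measurable (fun q : (ℝ × Eucl n) × Eucl n => dilate ψ q.1.1 (q.1.2 - q.2)) :=
    (measurable_dilate hψ).comp ((measurable_fst.comp measurable_fst).prodMk
      ((measurable_snd.comp measurable_fst).sub measurable_snd))
  exact ((h1.mul (hb.comp measurable_snd)).stronglyMeasurable.integral_prod_right).measurable

namespace IsSmoothWavelet

variable {B : ℝ} {ψ : Eucl n → ℂ}

theorem measurable (h : IsSmoothWavelet B ψ) : Measurable ψ := h.contDiff.continuous.measurable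

theorem measurable_dilate_sub (h : IsSmoothWavelet B ψ) (t : ℝ) (x : Eucl n) :
    Measurable (fun u => dilate ψ t (x - u)) :=
  (measurable_dilate h.measurable).comp
    (measurable_const.prodMk (measurable_const.sub measurable_id))

theorem lintegral_dilConv_sq_le (h : IsSmoothWavelet B ψ) {f : Eucl n → ℂ} (hf : Measurable f)
    (hf2 : ∫⁻ u, ‖f u‖ₑ ^ 2 ≠ ⊤) :
    ∫⁻ t, (∫⁻ x, ‖dilConv ψ t f x‖ₑ ^ 2) ∂logMeasure ≤
      ENNReal.ofReal ((2 ^ (n + 1) * B) ^ 2) * IsSquareKernel.sqConst n * ∫⁻ u, ‖f u‖ₑ ^ 2 :=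
  h.isSquareKernel.lintegral_le (mul_nonneg (by positivity) h.nonneg) hf hf2

theorem dilConv_add (h : IsSmoothWavelet B ψ) {b : ℝ} {β γ : Eucl n → ℂ}
    (hβ : Measurable β) (hβb : ∀ y, ‖β y‖ ≤ b) (hγ : Measurable γ) (hγb : ∀ y, ‖γ y‖ ≤ b)
    {t : ℝ} (ht : 0 < t) (y : Eucl n) :
    dilConv ψ t (fun z => β z + γ z) y = dilConv ψ t β y + dilConv ψ t γ y := by
  unfold dilConv
  simp only [mul_add]
  exact integral_add (integrable_kernel_mul_bdd hβ hβb ht y (h.measurable_dilate_sub t y)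
    (h.isSquareKernel.size t ht y)) (integrable_kernel_mul_bdd hγ hγb ht y
    (h.measurable_dilate_sub t y) (h.isSquareKernel.size t ht y))

/-- Where `β` does not vanish, `√(‖y - z‖ / r) ≥ 1` may be inserted; the half moment of the weight
then gives the decay `√(t / r)`. -/
theorem enorm_dilConv_le_of_far (h : IsSmoothWavelet B ψ) {b : ℝ} (hb : 0 ≤ b) {β : Eucl n → ℂ}
    (hβb : ∀ y, ‖β y‖ ≤ b) {t r : ℝ} (ht : 0 < t) (hr : 0 < r) (y : Eucl n)
    (hfar : ∀ z, ‖y - z‖ < r → β z = 0) :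
    ‖dilConv ψ t β y‖ₑ ≤
      ENNReal.ofReal (2 ^ (n + 1) * B * b) * (ENNReal.ofReal √(t / r) * bumpMoment n) := by
  have hB := h.nonneg
  unfold dilConv
  calc _ ≤ ∫⁻ z, ‖dilate ψ t (y - z) * β z‖ₑ := enorm_integral_le_lintegral_enorm _
    _ ≤ ∫⁻ z, ENNReal.ofReal (2 ^ (n + 1) * B * b) *
        ENNReal.ofReal (bump t (y - z) * √(‖y - z‖ / r)) := by
        apply lintegral_mono
        intro z
        have hbn := bump_nonneg ht (y - z)
        simp only
        rw [← ENNReal.ofReal_mul (by positivity), ← ofReal_norm]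
        apply ENNReal.ofReal_le_ofReal
        rcases lt_or_ge ‖y - z‖ r with hz | hz
        · rw [hfar z hz, mul_zero, norm_zero]
          positivity
        · rw [norm_mul]
          have h1 : 1 ≤ √(‖y - z‖ / r) := Real.one_le_sqrt.2 ((one_le_div hr).2 hz)
          have h2 := h.isSquareKernel.size t ht y z
          calc _ ≤ (2 ^ (n + 1) * B * bump t (y - z)) * b := by
                gcongr; exact hβb z
            _ = 2 ^ (n + 1) * B * b * (bump t (y - z) * 1) := by ring
            _ ≤ _ := by gcongr
    _ = _ := by
        rw [lintegral_const_mul' _ _ ENNReal.ofReal_ne_top,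
          lintegral_sub_left_eq_self (fun z : Eucl n => ENNReal.ofReal (bump t z * √(‖z‖ / r))) y,
          lintegral_bump_mul_sqrt ht hr]

/-- The dimensional constant in the Carleson condition for `ψ_t * β`. -/
noncomputable def boxConst (n : ℕ) : ℝ≥0∞ :=
  (2 * ENNReal.ofReal (detConst n) * IsSquareKernel.sqConst n * 3 ^ n + 4 * bumpMoment n ^ 2) *
    volume (Metric.ball (0 : Eucl n) 1)

theorem boxConst_ne_top (n : ℕ) : boxConst n ≠ ⊤ := by
  unfold boxConst
  have h1 := IsSquareKernel.sqConst_ne_top n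
  have h2 := bumpMoment_ne_top n
  have h3 : volume (Metric.ball (0 : Eucl n) 1) ≠ ⊤ := measure_ball_lt_top.ne
  finiteness

theorem _root_.enorm_add_sq_le (a b : ℂ) :
    ‖a + b‖ₑ ^ 2 ≤ 2 * ‖a‖ₑ ^ 2 + 2 * ‖b‖ₑ ^ 2 := by
  calc ‖a + b‖ₑ ^ 2 ≤ (‖a‖ₑ + ‖b‖ₑ) ^ 2 := by gcongr; exact enorm_add_le a b
    _ = ‖a‖ₑ ^ 2 + ‖b‖ₑ ^ 2 + 2 * (‖a‖ₑ * ‖b‖ₑ) := by ring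
    _ ≤ ‖a‖ₑ ^ 2 + ‖b‖ₑ ^ 2 + (‖a‖ₑ ^ 2 + ‖b‖ₑ ^ 2) := by
        gcongr; exact ENNReal.two_mul_mul_le_sq_add_sq _ _
    _ = _ := by ring

theorem volume_closedBall_eq (x : Eucl n) {r : ℝ} (hr : 0 ≤ r) :
    volume (Metric.closedBall x r) =
      ENNReal.ofReal (r ^ n) * volume (Metric.ball (0 : Eucl n) 1) := by
  rw [Measure.addHaar_closedBall _ _ hr]
  simp

/-- The standard proof that a bounded function generates a Carleson measure, moved by `x ↦ x - τ x`.
Over a box of radius `r`, the part of `β` near the image of the ball is treated by the square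
function estimate, its `L²` norm squared being `O(b² rⁿ)`; the far part is bounded pointwise with
decay `√(t / r)`. -/
theorem isCarlesonMeasure (h : IsSmoothWavelet B ψ) (hn : 1 ≤ n) {δ : ℝ} {τ : Eucl n → Eucl n}
    (hτ : IsSmallDisplacement δ τ) {b : ℝ} (hb : 0 ≤ b) {β : Eucl n → ℂ} (hβ : Measurable β)
    (hβb : ∀ y, ‖β y‖ ≤ b) :
    IsCarlesonMeasure (ENNReal.ofReal ((2 ^ (n + 1) * B * b) ^ 2) * boxConst n)
      ((logMeasure.prod volume).withDensity
        (fun p : ℝ × Eucl n => ‖dilConv ψ p.1 β (p.2 - τ p.2)‖ₑ ^ 2)) := by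
  have hB := h.nonneg
  have hτm := hτ.differentiable.continuous.measurable
  refine ⟨?_, fun x₀ r hr => ?_⟩
  · have h1 : ∀ᵐ p ∂(logMeasure.prod (volume : Measure (Eucl n))), 0 < p.1 :=
      Measure.quasiMeasurePreserving_fst.ae ae_pos_logMeasure
    exact (withDensity_absolutelyContinuous _ _).ae_le h1
  · set y₀ := x₀ - τ x₀ with hy₀
    -- The map sends the ball of radius `r` into the ball of radius `3r/2` about `y₀`, as `δ ≤ 1/2`.
    -- A further `r` gives `5r/2 ≤ 3r`, so points outside `A` are at distance at least `r` from the
    -- image.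
    set A := Metric.closedBall y₀ (3 * r) with hA
    have hAm : MeasurableSet A := Metric.isClosed_closedBall.measurableSet
    set β₁ : Eucl n → ℂ := A.indicator β with hβ₁
    set β₂ : Eucl n → ℂ := Aᶜ.indicator β with hβ₂
    have hm1 : Measurable β₁ := hβ.indicator hAm
    have hm2 : Measurable β₂ := hβ.indicator hAm.compl
    have hb1 : ∀ y, ‖β₁ y‖ ≤ b := fun y => (norm_indicator_le_norm_self _ _).trans (hβb y)
    have hb2 : ∀ y, ‖β₂ y‖ ≤ b := fun y => (norm_indicator_le_norm_self _ _).trans (hβb y)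
    have hsum : β = fun z => β₁ z + β₂ z := by
      ext z; exact (congrFun (Set.indicator_self_add_compl A β) z).symm
    have hint1 : ∫⁻ u, ‖β₁ u‖ₑ ^ 2 ≤ ENNReal.ofReal (b ^ 2) *
        (3 ^ n * (ENNReal.ofReal (r ^ n) * volume (Metric.ball (0 : Eucl n) 1))) := by
      calc ∫⁻ u, ‖β₁ u‖ₑ ^ 2 ≤ ∫⁻ u, A.indicator (fun _ => ENNReal.ofReal (b ^ 2)) u := by
            apply lintegral_mono
            intro u
            by_cases hu : u ∈ A
            · simp only [hβ₁, Set.indicator_of_mem hu]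
              rw [ENNReal.ofReal_pow hb, ← ofReal_norm]
              gcongr
              exact hβb u
            · simp [hβ₁, hu]
        _ = _ := by
            have e3 : ENNReal.ofReal ((3 : ℝ) ^ n) = 3 ^ n := by
              rw [ENNReal.ofReal_pow (by norm_num)]; simp
            rw [lintegral_indicator hAm, lintegral_const, Measure.restrict_apply_univ, hA,
              volume_closedBall_eq _ (by positivity), mul_pow, ENNReal.ofReal_mul (by positivity), e3,
              mul_assoc (3 ^ n)]
    have hvfin : volume (Metric.ball (0 : Eucl n) 1) ≠ ⊤ := measure_ball_lt_top.ne
    have hfin1 : ∫⁻ u, ‖β₁ u‖ₑ ^ 2 ≠ ⊤ := ne_top_of_le_ne_top (by finiteness) hint1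
    have hS : MeasurableSet (Set.Ioc 0 r ×ˢ Metric.closedBall x₀ r) :=
      measurableSet_Ioc.prod Metric.isClosed_closedBall.measurableSet
    have hmeas : ∀ γ : Eucl n → ℂ, Measurable γ →
        Measurable (fun p : ℝ × Eucl n => ‖dilConv ψ p.1 γ (p.2 - τ p.2)‖ₑ ^ 2) := fun γ hγ =>
      ((measurable_dilConv h.measurable hγ).comp (measurable_fst.prodMk
        (measurable_snd.sub (hτm.comp measurable_snd)))).enorm.pow_const 2
    have hpt : ∀ t ∈ Set.Ioc 0 r, ∀ x ∈ Metric.closedBall x₀ r,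
        ‖dilConv ψ t β₂ (x - τ x)‖ₑ ^ 2 ≤
        ENNReal.ofReal ((2 ^ (n + 1) * B * b) ^ 2) * bumpMoment n ^ 2 *
          ENNReal.ofReal √(t / r) := by
      intro t ht x hx
      rw [Metric.mem_closedBall, dist_eq_norm] at hx
      have hfar : ∀ z, ‖x - τ x - z‖ < r → β₂ z = 0 := by
        intro z hz
        apply Set.indicator_of_notMem
        rw [Set.notMem_compl_iff, hA, Metric.mem_closedBall, dist_eq_norm]
        have e : z - y₀ = (x - x₀) - (τ x - τ x₀) - (x - τ x - z) := by rw [hy₀]; abel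
        rw [e]
        have h3 := hτ.norm_sub_le x x₀
        have h4 := hτ.le_half
        have h5 := norm_sub_le ((x - x₀) - (τ x - τ x₀)) (x - τ x - z)
        have h6 := norm_sub_le (x - x₀) (τ x - τ x₀)
        nlinarith [norm_nonneg (x - x₀)]
      have h1 := h.enorm_dilConv_le_of_far hb hb2 ht.1 hr (x - τ x) hfar
      have h0 : 0 < t := ht.1
      have h7 : t / r ≤ 1 := (div_le_one hr).2 ht.2
      -- Squaring gives `t / r`, which is weakened to its root so that the integral in `dt/t` is the
      -- one already computed.
      have h8 : (√(t / r)) ^ 2 ≤ √(t / r) := by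
        rw [Real.sq_sqrt (by positivity)]
        exact le_sqrt_of_le_one (by positivity) h7
      calc _ ≤ (ENNReal.ofReal (2 ^ (n + 1) * B * b) *
            (ENNReal.ofReal √(t / r) * bumpMoment n)) ^ 2 := by gcongr
        _ = ENNReal.ofReal ((2 ^ (n + 1) * B * b) ^ 2) * bumpMoment n ^ 2 *
            ENNReal.ofReal ((√(t / r)) ^ 2) := by
            rw [ENNReal.ofReal_pow (by positivity), ENNReal.ofReal_pow (by positivity)]; ring
        _ ≤ _ := by gcongr
    have hterm1 : ∫⁻ p in Set.Ioc 0 r ×ˢ Metric.closedBall x₀ r,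
        ‖dilConv ψ p.1 β₁ (p.2 - τ p.2)‖ₑ ^ 2 ∂(logMeasure.prod volume) ≤
        ENNReal.ofReal (detConst n) * (ENNReal.ofReal ((2 ^ (n + 1) * B) ^ 2) *
          IsSquareKernel.sqConst n * ∫⁻ u, ‖β₁ u‖ₑ ^ 2) := by
      calc _ ≤ ∫⁻ p : ℝ × Eucl n, ‖dilConv ψ p.1 β₁ (p.2 - τ p.2)‖ₑ ^ 2
            ∂(logMeasure.prod volume) := setLIntegral_le_lintegral _ _
        _ = ∫⁻ t, (∫⁻ x, ‖dilConv ψ t β₁ (x - τ x)‖ₑ ^ 2) ∂logMeasure :=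
            lintegral_prod _ (hmeas β₁ hm1).aemeasurable
        _ ≤ ∫⁻ t, (ENNReal.ofReal (detConst n) * ∫⁻ y, ‖dilConv ψ t β₁ y‖ₑ ^ 2) ∂logMeasure :=
            lintegral_mono fun t => hτ.lintegral_comp_le hn (fun y => ‖dilConv ψ t β₁ y‖ₑ ^ 2)
        _ ≤ _ := by
            rw [lintegral_const_mul' _ _ ENNReal.ofReal_ne_top]
            gcongr
            exact h.lintegral_dilConv_sq_le hm1 hfin1
    have hterm2 : ∫⁻ p in Set.Ioc 0 r ×ˢ Metric.closedBall x₀ r,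
        ‖dilConv ψ p.1 β₂ (p.2 - τ p.2)‖ₑ ^ 2 ∂(logMeasure.prod volume) ≤
        ENNReal.ofReal ((2 ^ (n + 1) * B * b) ^ 2) * bumpMoment n ^ 2 * 2 *
          (ENNReal.ofReal (r ^ n) * volume (Metric.ball (0 : Eucl n) 1)) := by
      calc _ ≤ ∫⁻ p in Set.Ioc 0 r ×ˢ Metric.closedBall x₀ r,
            ENNReal.ofReal ((2 ^ (n + 1) * B * b) ^ 2) * bumpMoment n ^ 2 *
              ENNReal.ofReal √(p.1 / r) ∂(logMeasure.prod volume) :=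
            setLIntegral_mono' hS fun p hp => hpt p.1 hp.1 p.2 hp.2
        _ = ∫⁻ t in Set.Ioc 0 r, (∫⁻ x in Metric.closedBall x₀ r,
            ENNReal.ofReal ((2 ^ (n + 1) * B * b) ^ 2) * bumpMoment n ^ 2 *
              ENNReal.ofReal √(t / r)) ∂logMeasure := by
            rw [← Measure.prod_restrict, lintegral_prod]
            refine Measurable.aemeasurable ?_
            exact ((measurable_fst.div_const r).sqrt.ennreal_ofReal).const_mul _
        _ = ENNReal.ofReal ((2 ^ (n + 1) * B * b) ^ 2) * bumpMoment n ^ 2 *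
            (∫⁻ t in Set.Ioc 0 r, ENNReal.ofReal √(t / r) ∂logMeasure) *
            volume (Metric.closedBall x₀ r) := by
            simp only [lintegral_const, Measure.restrict_apply_univ]
            rw [lintegral_mul_const, lintegral_const_mul]
            · exact (measurable_id.div_const r).sqrt.ennreal_ofReal
            · exact ((measurable_id.div_const r).sqrt.ennreal_ofReal).const_mul _
        _ ≤ _ := by
            rw [volume_closedBall_eq _ hr.le]
            gcongr
            exact lintegral_sqrt_logMeasure_Ioc hr
    rw [withDensity_apply _ hS]
    calc _ ≤ ∫⁻ p in Set.Ioc 0 r ×ˢ Metric.closedBall x₀ r,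
          (2 * ‖dilConv ψ p.1 β₁ (p.2 - τ p.2)‖ₑ ^ 2 +
            2 * ‖dilConv ψ p.1 β₂ (p.2 - τ p.2)‖ₑ ^ 2) ∂(logMeasure.prod volume) := by
          apply setLIntegral_mono' hS
          intro p hp
          have e := h.dilConv_add hm1 hb1 hm2 hb2 hp.1.1 (p.2 - τ p.2)
          rw [← hsum] at e
          rw [e]
          exact enorm_add_sq_le _ _
      _ = 2 * (∫⁻ p in Set.Ioc 0 r ×ˢ Metric.closedBall x₀ r,
          ‖dilConv ψ p.1 β₁ (p.2 - τ p.2)‖ₑ ^ 2 ∂(logMeasure.prod volume)) +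
          2 * (∫⁻ p in Set.Ioc 0 r ×ˢ Metric.closedBall x₀ r,
          ‖dilConv ψ p.1 β₂ (p.2 - τ p.2)‖ₑ ^ 2 ∂(logMeasure.prod volume)) := by
          rw [lintegral_add_left ((hmeas β₁ hm1).const_mul 2), lintegral_const_mul _ (hmeas β₁ hm1),
            lintegral_const_mul _ (hmeas β₂ hm2)]
      _ ≤ 2 * (ENNReal.ofReal (detConst n) * (ENNReal.ofReal ((2 ^ (n + 1) * B) ^ 2) *
          IsSquareKernel.sqConst n * (ENNReal.ofReal (b ^ 2) *
        (3 ^ n * (ENNReal.ofReal (r ^ n) * volume (Metric.ball (0 : Eucl n) 1)))))) +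
          2 * (ENNReal.ofReal ((2 ^ (n + 1) * B * b) ^ 2) * bumpMoment n ^ 2 * 2 *
          (ENNReal.ofReal (r ^ n) * volume (Metric.ball (0 : Eucl n) 1))) := by
          gcongr
          exact hterm1.trans (by gcongr)
      _ = _ := by
          have e : ENNReal.ofReal ((2 ^ (n + 1) * B * b) ^ 2) =
              ENNReal.ofReal ((2 ^ (n + 1) * B) ^ 2) * ENNReal.ofReal (b ^ 2) := by
            rw [← ENNReal.ofReal_mul (by positivity)]; congr 1; ring
          rw [e, boxConst]
          ring

end IsSmoothWavelet

end Commutator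

/-! ### Decomposition and bound of the commutator -/

section CommutatorEstimate

variable {n : ℕ}

/-- The integral of `commKernel` in the second variable. -/
noncomputable def commMean (ψ : Eucl n → ℂ) (τ : Eucl n → Eucl n) (t : ℝ) (x : Eucl n) : ℂ :=
  ∫ u, commKernel ψ τ t x u

/-- The part of `commKernel` with cancellation. -/
noncomputable def commKernelCanc (ψ : Eucl n → ℂ) (τ : Eucl n → Eucl n) (t : ℝ) (x u : Eucl n) :
    ℂ :=
  commKernel ψ τ t x u - commMean ψ τ t x * ((bump t (x - u) / (bumpMass n).toReal : ℝ) : ℂ)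

theorem bumpMass_toReal_pos (n : ℕ) : 0 < (bumpMass n).toReal :=
  ENNReal.toReal_pos (bumpMass_ne_zero n) (bumpMass_ne_top n)

theorem integral_bump_sub {t : ℝ} (ht : 0 < t) (x : Eucl n) :
    ∫ u, bump t (x - u) = (bumpMass n).toReal := by
  rw [integral_eq_lintegral_of_nonneg_ae (Filter.Eventually.of_forall fun u => bump_nonneg ht _)
    ((integrable_bump ht).comp_sub_left x).aestronglyMeasurable, lintegral_bump_sub_left ht]

namespace IsSmoothWavelet

variable {B δ : ℝ} {ψ : Eucl n → ℂ} {τ : Eucl n → Eucl n}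

theorem measurable_commKernel_slice (h : IsSmoothWavelet B ψ) (hτ : IsSmallDisplacement δ τ)
    (t : ℝ) (x : Eucl n) : Measurable (commKernel ψ τ t x) :=
  (measurable_commKernel h.measurable hτ.differentiable.continuous.measurable).comp
    (measurable_prodMk_left (x := (t, x)))

theorem integrable_commKernel (h : IsSmoothWavelet B ψ) (hτ : IsSmallDisplacement δ τ)
    {t : ℝ} (ht : 0 < t) (x : Eucl n) : Integrable (commKernel ψ τ t x) :=
  (((integrable_bump ht).comp_sub_left x).const_mul _).mono'
    (h.measurable_commKernel_slice hτ t x).aestronglyMeasurable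
    (Filter.Eventually.of_forall (h.commKernel_size hτ ht x))

theorem measurable_commMean (h : IsSmoothWavelet B ψ) (hτ : IsSmallDisplacement δ τ) :
    Measurable (fun p : ℝ × Eucl n => commMean ψ τ p.1 p.2) :=
  ((measurable_commKernel h.measurable
    hτ.differentiable.continuous.measurable).stronglyMeasurable.integral_prod_right).measurable

theorem norm_commMean_le (h : IsSmoothWavelet B ψ) (hτ : IsSmallDisplacement δ τ)
    {t : ℝ} (ht : 0 < t) (x : Eucl n) :
    ‖commMean ψ τ t x‖ ≤ 2 ^ (n + 1) * (2 ^ (n + 3) * B * δ) * (bumpMass n).toReal := by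
  unfold commMean
  rw [← integral_bump_sub ht x, ← integral_const_mul]
  exact norm_integral_le_of_norm_le (((integrable_bump ht).comp_sub_left x).const_mul _)
    (Filter.Eventually.of_forall (h.commKernel_size hτ ht x))

/-- The normalised weight has integral one, so subtracting the mean times the weight cancels the
integral. The mean is `O(δ)` and the weight is as regular as required, which costs only the factor
`n + 2`. -/
theorem isSquareKernel_commKernelCanc (h : IsSmoothWavelet B ψ) (hτ : IsSmallDisplacement δ τ) :
    IsSquareKernel ((n + 2) * (2 ^ (n + 1) * (2 ^ (n + 3) * B * δ))) (commKernelCanc ψ τ) := by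
  have hB := h.nonneg
  have hδ := hτ.nonneg
  set D := 2 ^ (n + 1) * (2 ^ (n + 3) * B * δ) with hD
  have hD0 : 0 ≤ D := by positivity
  have hW := bumpMass_toReal_pos n
  refine ⟨?_, fun t ht x u => ?_, fun t ht x u u' => ?_, fun t ht x => ?_⟩
  · unfold commKernelCanc
    refine (measurable_commKernel h.measurable hτ.differentiable.continuous.measurable).sub
      (((h.measurable_commMean hτ).comp measurable_fst).mul ?_)
    refine Complex.measurable_ofReal.comp (Measurable.div_const ?_ _)
    exact measurable_bump.comp ((measurable_fst.comp measurable_fst).prodMk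
      ((measurable_snd.comp measurable_fst).sub measurable_snd))
  · have b1 := bump_nonneg ht (x - u)
    calc ‖commKernelCanc ψ τ t x u‖
        ≤ ‖commKernel ψ τ t x u‖ + ‖commMean ψ τ t x‖ * (bump t (x - u) / (bumpMass n).toReal) := by
          unfold commKernelCanc
          refine (norm_sub_le _ _).trans ?_
          rw [norm_mul, Complex.norm_real, Real.norm_eq_abs, abs_of_nonneg (by positivity)]
      _ ≤ D * bump t (x - u) + D * (bumpMass n).toReal * (bump t (x - u) / (bumpMass n).toReal) := by
          gcongr
          · exact h.commKernel_size hτ ht x u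
          · exact h.norm_commMean_le hτ ht x
      _ = 2 * D * bump t (x - u) := by field_simp; ring
      _ ≤ _ := by
          gcongr
          linarith [(Nat.cast_nonneg n : (0 : ℝ) ≤ n)]
  · have b1 := bump_nonneg ht (x - u)
    have b2 := bump_nonneg ht (x - u')
    have e : commKernelCanc ψ τ t x u - commKernelCanc ψ τ t x u' =
        (commKernel ψ τ t x u - commKernel ψ τ t x u') - commMean ψ τ t x *
          (((bump t (x - u) - bump t (x - u')) / (bumpMass n).toReal : ℝ) : ℂ) := by
      unfold commKernelCanc; push_cast; ring
    have hs := abs_bump_sub_le_sqrt ht (x - u) (x - u')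
    have e2 : ‖(x - u) - (x - u')‖ = ‖u - u'‖ := by rw [sub_sub_sub_cancel_left, norm_sub_rev]
    rw [e2] at hs
    rw [e]
    calc _ ≤ ‖commKernel ψ τ t x u - commKernel ψ τ t x u'‖ + ‖commMean ψ τ t x‖ *
          (|bump t (x - u) - bump t (x - u')| / (bumpMass n).toReal) := by
          refine (norm_sub_le _ _).trans ?_
          rw [norm_mul, Complex.norm_real, Real.norm_eq_abs, abs_div, abs_of_pos hW]
      _ ≤ D * (√(‖u - u'‖ / t) * (bump t (x - u) + bump t (x - u'))) +
          D * (bumpMass n).toReal * (((n + 1) * (√(‖u - u'‖ / t) *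
            (bump t (x - u) + bump t (x - u')))) / (bumpMass n).toReal) := by
          gcongr
          · exact h.commKernel_holder hτ ht x u u'
          · exact h.norm_commMean_le hτ ht x
      _ = _ := by field_simp; ring
  · unfold commKernelCanc
    have hb : Integrable (fun u => bump t (x - u)) := (integrable_bump ht).comp_sub_left x
    have hb2 : Integrable (fun u => commMean ψ τ t x *
        ((bump t (x - u) / (bumpMass n).toReal : ℝ) : ℂ)) := ((hb.div_const _).ofReal).const_mul _
    rw [integral_sub (h.integrable_commKernel hτ ht x) hb2, integral_const_mul, integral_complex_ofReal,
      integral_div, integral_bump_sub ht, div_self hW.ne']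
    simp [commMean]

/-- The first half of the kernel integrates to zero. In the second half, `y = u - τ u` produces the
density `1 + jacDefect`, whose constant part again integrates to zero against the dilated wavelet.
-/
theorem commMean_eq (h : IsSmoothWavelet B ψ) (hn : 1 ≤ n) (hτ : IsSmallDisplacement δ τ)
    {t : ℝ} (ht : 0 < t) (x : Eucl n) :
    commMean ψ τ t x = -dilConv ψ t (fun y => (hτ.jacDefect hn y : ℂ)) (x - τ x) := by
  have hm : Measurable (fun y => (hτ.jacDefect hn y : ℂ)) :=
    Complex.measurable_ofReal.comp (hτ.measurable_jacDefect hn)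
  have hbd : ∀ y, ‖(hτ.jacDefect hn y : ℂ)‖ ≤ detConst n ^ 2 * δ := fun y => by
    rw [Complex.norm_real]; exact hτ.abs_jacDefect_le hn y
  have i1 : Integrable (fun u => dilate ψ t (x - u)) := h.isSquareKernel.integrable ht x
  have i2 : Integrable (fun u => dilate ψ t ((x - τ x) - (u - τ u))) := by
    have := i1.sub (h.integrable_commKernel hτ ht x)
    refine this.congr (Filter.Eventually.of_forall fun u => ?_)
    simp [commKernel]
  have i3 : Integrable (fun y => dilate ψ t ((x - τ x) - y)) :=
    h.isSquareKernel.integrable ht (x - τ x)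
  have i4 : Integrable (fun y => dilate ψ t ((x - τ x) - y) * (hτ.jacDefect hn y : ℂ)) :=
    integrable_kernel_mul_bdd hm hbd ht (x - τ x) (h.measurable_dilate_sub t _)
      (h.isSquareKernel.size t ht (x - τ x))
  have e1 : ∫ u, dilate ψ t ((x - τ x) - (u - τ u)) =
      ∫ y, (dilate ψ t ((x - τ x) - y) + dilate ψ t ((x - τ x) - y) * (hτ.jacDefect hn y : ℂ)) := by
    refine Eq.trans ?_ (hτ.integral_eq hn (fun y => dilate ψ t ((x - τ x) - y) +
      dilate ψ t ((x - τ x) - y) * (hτ.jacDefect hn y : ℂ))).symm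
    congr 1; ext u
    rw [hτ.jacDefect_comp hn, Complex.real_smul]
    have : (displacementJac τ u : ℂ) ≠ 0 := by exact_mod_cast (hτ.jac_pos u).ne'
    push_cast
    field_simp
    ring
  unfold commMean commKernel
  rw [integral_sub i1 i2, e1, integral_add i3 i4, h.isSquareKernel.integral_eq_zero t ht x,
    h.isSquareKernel.integral_eq_zero t ht (x - τ x)]
  simp [dilConv]

/-- The commutator of `f ↦ f * ψ_t` with composition with `x ↦ x - τ x`. -/
theorem commutator_eq (h : IsSmoothWavelet B ψ) (hn : 1 ≤ n) (hτ : IsSmallDisplacement δ τ)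
    {f : Eucl n → ℂ} (hf : Measurable f) (hf2 : ∫⁻ u, ‖f u‖ₑ ^ 2 ≠ ⊤)
    {t : ℝ} (ht : 0 < t) (x : Eucl n) :
    dilConv ψ t (fun u => f (u - τ u)) x - dilConv ψ t f (x - τ x) =
      (∫ u, commKernelCanc ψ τ t x u * f (u - τ u)) +
      (commMean ψ τ t x * ((∫ u, (bump t (x - u) : ℂ) * f (u - τ u)) / (bumpMass n).toReal) +
      dilConv ψ t (fun y => (hτ.jacDefect hn y : ℂ) * f y) (x - τ x)) := by
  have hm : Measurable (fun y => (hτ.jacDefect hn y : ℂ)) :=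
    Complex.measurable_ofReal.comp (hτ.measurable_jacDefect hn)
  have hbd : ∀ y, ‖(hτ.jacDefect hn y : ℂ)‖ ≤ detConst n ^ 2 * δ := fun y => by
    rw [Complex.norm_real]; exact hτ.abs_jacDefect_le hn y
  have hg : Measurable (fun u => f (u - τ u)) := hf.comp hτ.measurable_map
  have hg2 : ∫⁻ u, ‖f (u - τ u)‖ₑ ^ 2 ≠ ⊤ :=
    ne_top_of_le_ne_top (ENNReal.mul_ne_top ENNReal.ofReal_ne_top hf2)
      (hτ.lintegral_comp_le hn (fun y => ‖f y‖ₑ ^ 2))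
  have i1 : Integrable (fun u => dilate ψ t (x - u) * f (u - τ u)) :=
    integrable_kernel_mul hg hg2 ht x (h.measurable_dilate_sub t _) (h.isSquareKernel.size t ht x)
  have i2 : Integrable (fun u => commKernel ψ τ t x u * f (u - τ u)) :=
    integrable_kernel_mul hg hg2 ht x (h.measurable_commKernel_slice hτ t x)
      (h.commKernel_size hτ ht x)
  have i3 : Integrable (fun y => dilate ψ t ((x - τ x) - y) * f y) :=
    integrable_kernel_mul hf hf2 ht _ (h.measurable_dilate_sub t _)
      (h.isSquareKernel.size t ht (x - τ x))
  have i4 : Integrable (fun y => dilate ψ t ((x - τ x) - y) * ((hτ.jacDefect hn y : ℂ) * f y)) := by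
    have := i3.bdd_mul (c := detConst n ^ 2 * δ) hm.aestronglyMeasurable
      (Filter.Eventually.of_forall hbd)
    refine this.congr (Filter.Eventually.of_forall fun y => ?_)
    simp only; ring
  have i5 : Integrable (fun u => (bump t (x - u) : ℂ) * f (u - τ u)) := by
    refine integrable_kernel_mul hg hg2 ht x (D := 1) ?_ fun u => ?_
    · exact Complex.measurable_ofReal.comp
        ((measurable_bump_right t).comp (measurable_const.sub measurable_id))
    · rw [Complex.norm_real, Real.norm_eq_abs, abs_of_nonneg (bump_nonneg ht _), one_mul]
  -- Change of variables `y = u - τ u`: the part 1 of the inverse Jacobian gives back the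
  -- convolution at `x - τ x`, and the defect gives the third term.
  have e1 : ∫ u, dilate ψ t ((x - τ x) - (u - τ u)) * f (u - τ u) =
      ∫ y, (dilate ψ t ((x - τ x) - y) * f y +
        dilate ψ t ((x - τ x) - y) * ((hτ.jacDefect hn y : ℂ) * f y)) := by
    refine Eq.trans ?_ (hτ.integral_eq hn (fun y => dilate ψ t ((x - τ x) - y) * f y +
      dilate ψ t ((x - τ x) - y) * ((hτ.jacDefect hn y : ℂ) * f y))).symm
    congr 1; ext u
    rw [hτ.jacDefect_comp hn, Complex.real_smul]
    have : (displacementJac τ u : ℂ) ≠ 0 := by exact_mod_cast (hτ.jac_pos u).ne'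
    push_cast
    field_simp
    ring
  have e2 : ∫ u, commKernelCanc ψ τ t x u * f (u - τ u) =
      (∫ u, commKernel ψ τ t x u * f (u - τ u)) -
      commMean ψ τ t x * ((∫ u, (bump t (x - u) : ℂ) * f (u - τ u)) / (bumpMass n).toReal) := by
    rw [← integral_div, ← integral_const_mul, ← integral_sub i2 ((i5.div_const _).const_mul _)]
    congr 1; ext u
    unfold commKernelCanc; push_cast; ring
  have e3 : ∫ u, commKernel ψ τ t x u * f (u - τ u) =
      (∫ u, dilate ψ t (x - u) * f (u - τ u)) -
        ∫ u, dilate ψ t ((x - τ x) - (u - τ u)) * f (u - τ u) := by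
    have i6 : Integrable (fun u => dilate ψ t ((x - τ x) - (u - τ u)) * f (u - τ u)) := by
      refine (i1.sub i2).congr (Filter.Eventually.of_forall fun u => ?_)
      simp only [Pi.sub_apply, commKernel]; ring
    rw [← integral_sub i1 i6]
    congr 1; ext u
    unfold commKernel; ring
  rw [e2, e3, e1, integral_add i3 i4]
  unfold dilConv
  ring

/-- The dimensional constant in the commutator estimate. -/
noncomputable def commConst (n : ℕ) : ℝ≥0∞ :=
  2 * (ENNReal.ofReal (((n + 2) * (2 ^ (n + 1) * 2 ^ (n + 3))) ^ 2) * IsSquareKernel.sqConst n *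
    ENNReal.ofReal (detConst n)) +
  2 * (2 * (ENNReal.ofReal ((2 ^ (n + 1) * detConst n ^ 2) ^ 2) * boxConst n *
    IsCarlesonMeasure.carlesonConst n * ENNReal.ofReal (detConst n) * (bumpMass n ^ 2)⁻¹) +
  2 * (ENNReal.ofReal (detConst n) * (ENNReal.ofReal ((2 ^ (n + 1) * detConst n ^ 2) ^ 2) *
    IsSquareKernel.sqConst n)))

theorem commConst_ne_top (n : ℕ) : commConst n ≠ ⊤ := by
  unfold commConst
  have h1 := IsSquareKernel.sqConst_ne_top n
  have h2 := boxConst_ne_top n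
  have h3 := IsCarlesonMeasure.carlesonConst_ne_top n
  have h4 : (bumpMass n ^ 2)⁻¹ ≠ ⊤ :=
    ENNReal.inv_ne_top.2 (pow_ne_zero 2 (bumpMass_ne_zero n))
  finiteness

theorem _root_.lintegral_logMeasure_add_add_sq_le {F T₁ T₂ T₃ : ℝ → Eucl n → ℂ}
    (m₁ : Measurable (fun p : ℝ × Eucl n => T₁ p.1 p.2))
    (m₂ : Measurable (fun p : ℝ × Eucl n => T₂ p.1 p.2))
    (hF : ∀ t, 0 < t → ∀ x, F t x = T₁ t x + (T₂ t x + T₃ t x)) :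
    ∫⁻ t, (∫⁻ x, ‖F t x‖ₑ ^ 2) ∂logMeasure ≤
      2 * (∫⁻ t, (∫⁻ x, ‖T₁ t x‖ₑ ^ 2) ∂logMeasure) +
      2 * (2 * (∫⁻ t, (∫⁻ x, ‖T₂ t x‖ₑ ^ 2) ∂logMeasure) +
        2 * ∫⁻ t, (∫⁻ x, ‖T₃ t x‖ₑ ^ 2) ∂logMeasure) := by
  have m1 : Measurable (fun p : ℝ × Eucl n => ‖T₁ p.1 p.2‖ₑ ^ 2) := m₁.enorm.pow_const 2
  have m2 : Measurable (fun p : ℝ × Eucl n => ‖T₂ p.1 p.2‖ₑ ^ 2) := m₂.enorm.pow_const 2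
  have M1 : Measurable (fun t => ∫⁻ x, ‖T₁ t x‖ₑ ^ 2) := m1.lintegral_prod_right
  have M2 : Measurable (fun t => ∫⁻ x, ‖T₂ t x‖ₑ ^ 2) := m2.lintegral_prod_right
  calc _ ≤ ∫⁻ t, (2 * (∫⁻ x, ‖T₁ t x‖ₑ ^ 2) + 2 * (2 * (∫⁻ x, ‖T₂ t x‖ₑ ^ 2) +
        2 * ∫⁻ x, ‖T₃ t x‖ₑ ^ 2)) ∂logMeasure := by
        apply lintegral_mono_ae
        filter_upwards [ae_pos_logMeasure] with t ht
        have m1t : Measurable (fun x => ‖T₁ t x‖ₑ ^ 2) := m1.comp (measurable_prodMk_left (x := t))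
        have m2t : Measurable (fun x => ‖T₂ t x‖ₑ ^ 2) := m2.comp (measurable_prodMk_left (x := t))
        calc _ ≤ ∫⁻ x, (2 * ‖T₁ t x‖ₑ ^ 2 + 2 * (2 * ‖T₂ t x‖ₑ ^ 2 + 2 * ‖T₃ t x‖ₑ ^ 2)) := by
              apply lintegral_mono
              intro x
              simp only
              rw [hF t ht x]
              refine (enorm_add_sq_le _ _).trans ?_
              gcongr
              exact enorm_add_sq_le _ _
          _ = _ := by
              rw [lintegral_add_left (m1t.const_mul 2), lintegral_const_mul _ m1t,
                lintegral_const_mul' _ _ (by simp), lintegral_add_left (m2t.const_mul 2),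
                lintegral_const_mul _ m2t, lintegral_const_mul' _ _ (by simp)]
    _ = _ := by
        rw [lintegral_add_left (M1.const_mul 2),
          lintegral_const_mul _ M1, lintegral_const_mul' _ _ (by simp),
          lintegral_add_left (M2.const_mul 2),
          lintegral_const_mul _ M2, lintegral_const_mul' _ _ (by simp)]

/-- The commutator estimate: composition with `x ↦ x - τ x` commutes with the wavelet transform up
to an operator of norm `O(‖Dτ‖∞)`. -/
theorem lintegral_commutator_sq_le (h : IsSmoothWavelet B ψ) (hn : 1 ≤ n)
    (hτ : IsSmallDisplacement δ τ) {f : Eucl n → ℂ} (hf : Measurable f)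
    (hf2 : ∫⁻ u, ‖f u‖ₑ ^ 2 ≠ ⊤) :
    ∫⁻ t, (∫⁻ x, ‖dilConv ψ t (fun u => f (u - τ u)) x - dilConv ψ t f (x - τ x)‖ₑ ^ 2)
      ∂logMeasure ≤ ENNReal.ofReal ((B * δ) ^ 2) * commConst n * ∫⁻ u, ‖f u‖ₑ ^ 2 := by
  have hB := h.nonneg
  have hδ := hτ.nonneg
  have hdet := one_le_detConst n
  have hτm := hτ.differentiable.continuous.measurable
  have hm : Measurable (fun y => (hτ.jacDefect hn y : ℂ)) :=
    Complex.measurable_ofReal.comp (hτ.measurable_jacDefect hn)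
  have hbd : ∀ y, ‖(hτ.jacDefect hn y : ℂ)‖ ≤ detConst n ^ 2 * δ := fun y => by
    rw [Complex.norm_real]; exact hτ.abs_jacDefect_le hn y
  have hb0 : 0 ≤ detConst n ^ 2 * δ := by positivity
  set g : Eucl n → ℂ := fun u => f (u - τ u) with hgdef
  have hg : Measurable g := hf.comp hτ.measurable_map
  have hgle : ∫⁻ u, ‖g u‖ₑ ^ 2 ≤ ENNReal.ofReal (detConst n) * ∫⁻ u, ‖f u‖ₑ ^ 2 :=
    hτ.lintegral_comp_le hn (fun y => ‖f y‖ₑ ^ 2)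
  have hg2 : ∫⁻ u, ‖g u‖ₑ ^ 2 ≠ ⊤ :=
    ne_top_of_le_ne_top (ENNReal.mul_ne_top ENNReal.ofReal_ne_top hf2) hgle
  set β : Eucl n → ℂ := fun y => (hτ.jacDefect hn y : ℂ) with hβ
  have hβf : ∫⁻ u, ‖β u * f u‖ₑ ^ 2 ≤
      ENNReal.ofReal ((detConst n ^ 2 * δ) ^ 2) * ∫⁻ u, ‖f u‖ₑ ^ 2 := by
    rw [← lintegral_const_mul' _ _ ENNReal.ofReal_ne_top]
    apply lintegral_mono
    intro u
    simp only
    rw [enorm_mul, mul_pow, ENNReal.ofReal_pow hb0, ← ofReal_norm (β u)]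
    gcongr
    exact hbd u
  have hβf2 : ∫⁻ u, ‖β u * f u‖ₑ ^ 2 ≠ ⊤ :=
    ne_top_of_le_ne_top (ENNReal.mul_ne_top ENNReal.ofReal_ne_top hf2) hβf
  -- `T1` has cancellation (square function estimate), `T2` is the mean times an average of `g`
  -- (Carleson embedding), and `T3` is an ordinary wavelet transform of `β f`, where `β = O(δ)`.
  -- Each contributes `O(B² δ²)`.
  let T1 : ℝ → Eucl n → ℂ := fun t x => ∫ u, commKernelCanc ψ τ t x u * g u
  let T2 : ℝ → Eucl n → ℂ := fun t x =>
    commMean ψ τ t x * ((∫ u, (bump t (x - u) : ℂ) * g u) / (bumpMass n).toReal)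
  let T3 : ℝ → Eucl n → ℂ := fun t x => dilConv ψ t (fun y => β y * f y) (x - τ x)
  have mT1 : Measurable (fun p : ℝ × Eucl n => T1 p.1 p.2) :=
    (((h.isSquareKernel_commKernelCanc hτ).measurable.mul
      (hg.comp measurable_snd)).stronglyMeasurable.integral_prod_right).measurable
  have mT2 : Measurable (fun p : ℝ × Eucl n => T2 p.1 p.2) := by
    have hb : Measurable (fun q : (ℝ × Eucl n) × Eucl n => (bump q.1.1 (q.1.2 - q.2) : ℂ)) :=
      Complex.measurable_ofReal.comp (measurable_bump.comp
        ((measurable_fst.comp measurable_fst).prodMk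
        ((measurable_snd.comp measurable_fst).sub measurable_snd)))
    exact (h.measurable_commMean hτ).mul (((hb.mul
      (hg.comp measurable_snd)).stronglyMeasurable.integral_prod_right).measurable.div_const _)
  have b1 : ∫⁻ t, (∫⁻ x, ‖T1 t x‖ₑ ^ 2) ∂logMeasure ≤
      ENNReal.ofReal (((n + 2) * (2 ^ (n + 1) * (2 ^ (n + 3) * B * δ))) ^ 2) *
        IsSquareKernel.sqConst n * ∫⁻ u, ‖g u‖ₑ ^ 2 :=
    (h.isSquareKernel_commKernelCanc hτ).lintegral_le (by positivity) hg hg2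
  have b3 : ∫⁻ t, (∫⁻ x, ‖T3 t x‖ₑ ^ 2) ∂logMeasure ≤ ENNReal.ofReal (detConst n) *
      (ENNReal.ofReal ((2 ^ (n + 1) * B) ^ 2) * IsSquareKernel.sqConst n *
        ∫⁻ u, ‖β u * f u‖ₑ ^ 2) := by
    calc _ ≤ ∫⁻ t, (ENNReal.ofReal (detConst n) *
          ∫⁻ y, ‖dilConv ψ t (fun y => β y * f y) y‖ₑ ^ 2) ∂logMeasure :=
          lintegral_mono fun t => hτ.lintegral_comp_le hn
            (fun y => ‖dilConv ψ t (fun y => β y * f y) y‖ₑ ^ 2)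
      _ ≤ _ := by
          rw [lintegral_const_mul' _ _ ENNReal.ofReal_ne_top]
          gcongr
          exact h.lintegral_dilConv_sq_le (hm.mul hf) hβf2
  have b2 : ∫⁻ t, (∫⁻ x, ‖T2 t x‖ₑ ^ 2) ∂logMeasure ≤
      ENNReal.ofReal ((2 ^ (n + 1) * B * (detConst n ^ 2 * δ)) ^ 2) * boxConst n *
        IsCarlesonMeasure.carlesonConst n * (∫⁻ u, ‖g u‖ₑ ^ 2) * (bumpMass n ^ 2)⁻¹ := by
    have hd : Measurable (fun p : ℝ × Eucl n => ‖dilConv ψ p.1 β (p.2 - τ p.2)‖ₑ ^ 2) :=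
      ((measurable_dilConv h.measurable hm).comp (measurable_fst.prodMk
        (measurable_snd.sub (hτm.comp measurable_snd)))).enorm.pow_const 2
    -- By `commMean_eq` the density of this Carleson measure is the squared modulus of the mean, so
    -- the embedding theorem bounds exactly the product occurring in `T2`.
    have hcar := (h.isCarlesonMeasure hn hτ hb0 hm hbd).lintegral_bumpAvg_sq_le hn hg.enorm hg2
    have hav : Measurable (fun p : ℝ × Eucl n => bumpAvg (fun u => ‖g u‖ₑ) p.1 p.2 ^ 2) :=
      (measurable_bumpAvg hg.enorm).pow_const 2
    rw [lintegral_withDensity_eq_lintegral_mul _ hd hav] at hcar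
    have hW : ‖(((bumpMass n).toReal : ℝ) : ℂ)‖ₑ = bumpMass n := by
      rw [← ofReal_norm, Complex.norm_real, Real.norm_eq_abs,
        abs_of_pos (bumpMass_toReal_pos n), ENNReal.ofReal_toReal (bumpMass_ne_top n)]
    calc ∫⁻ t, (∫⁻ x, ‖T2 t x‖ₑ ^ 2) ∂logMeasure
        ≤ ∫⁻ t, (∫⁻ x, (‖dilConv ψ t β (x - τ x)‖ₑ ^ 2 * bumpAvg (fun u => ‖g u‖ₑ) t x ^ 2) *
          (bumpMass n ^ 2)⁻¹) ∂logMeasure := by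
          apply lintegral_mono_ae
          filter_upwards [ae_pos_logMeasure] with t ht
          apply lintegral_mono
          intro x
          simp only [T2]
          rw [h.commMean_eq hn hτ ht x, div_eq_mul_inv, enorm_mul, enorm_mul, enorm_neg, enorm_inv
            (by exact_mod_cast (bumpMass_toReal_pos n).ne'), hW, mul_pow, mul_pow, ENNReal.inv_pow,
            mul_assoc]
          gcongr
          refine (enorm_integral_le_lintegral_enorm _).trans (le_of_eq ?_)
          unfold bumpAvg
          congr 1; ext u
          rw [enorm_mul, ← ofReal_norm (bump t (x - u) : ℂ), Complex.norm_real, Real.norm_eq_abs,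
            abs_of_nonneg (bump_nonneg ht _)]
      _ = (∫⁻ p : ℝ × Eucl n, (‖dilConv ψ p.1 β (p.2 - τ p.2)‖ₑ ^ 2 *
          bumpAvg (fun u => ‖g u‖ₑ) p.1 p.2 ^ 2) ∂(logMeasure.prod volume)) *
          (bumpMass n ^ 2)⁻¹ := by
          have hda : Measurable (fun p : ℝ × Eucl n => ‖dilConv ψ p.1 β (p.2 - τ p.2)‖ₑ ^ 2 *
            bumpAvg (fun u => ‖g u‖ₑ) p.1 p.2 ^ 2) := hd.mul hav
          rw [← lintegral_mul_const _ hda, lintegral_prod _ (hda.mul_const _).aemeasurable]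
      _ ≤ _ := by gcongr; exact hcar
  have hsplit := lintegral_logMeasure_add_add_sq_le
    (F := fun t x => dilConv ψ t g x - dilConv ψ t f (x - τ x)) (T₃ := T3) mT1 mT2
    (fun t ht x => h.commutator_eq hn hτ hf hf2 ht x)
  refine hsplit.trans ?_
  have c1 : ENNReal.ofReal (((n + 2) * (2 ^ (n + 1) * (2 ^ (n + 3) * B * δ))) ^ 2) =
      ENNReal.ofReal ((B * δ) ^ 2) *
        ENNReal.ofReal (((n + 2) * (2 ^ (n + 1) * 2 ^ (n + 3))) ^ 2) := by
    rw [← ENNReal.ofReal_mul (by positivity)]; congr 1; ring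
  have c2 : ENNReal.ofReal ((2 ^ (n + 1) * B * (detConst n ^ 2 * δ)) ^ 2) =
      ENNReal.ofReal ((B * δ) ^ 2) * ENNReal.ofReal ((2 ^ (n + 1) * detConst n ^ 2) ^ 2) := by
    rw [← ENNReal.ofReal_mul (by positivity)]; congr 1; ring
  have c3 : ENNReal.ofReal ((2 ^ (n + 1) * B) ^ 2) * ENNReal.ofReal ((detConst n ^ 2 * δ) ^ 2) =
      ENNReal.ofReal ((B * δ) ^ 2) * ENNReal.ofReal ((2 ^ (n + 1) * detConst n ^ 2) ^ 2) := by
    rw [← ENNReal.ofReal_mul (by positivity), ← ENNReal.ofReal_mul (by positivity)]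
    congr 1; ring
  rw [c1] at b1
  rw [c2] at b2
  calc _ ≤ 2 * (ENNReal.ofReal ((B * δ) ^ 2) *
        ENNReal.ofReal (((n + 2) * (2 ^ (n + 1) * 2 ^ (n + 3))) ^ 2) * IsSquareKernel.sqConst n *
        (ENNReal.ofReal (detConst n) * ∫⁻ u, ‖f u‖ₑ ^ 2)) +
      2 * (2 * (ENNReal.ofReal ((B * δ) ^ 2) * ENNReal.ofReal ((2 ^ (n + 1) * detConst n ^ 2) ^ 2) *
        boxConst n * IsCarlesonMeasure.carlesonConst n *
        (ENNReal.ofReal (detConst n) * ∫⁻ u, ‖f u‖ₑ ^ 2) * (bumpMass n ^ 2)⁻¹) +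
      2 * (ENNReal.ofReal (detConst n) * (ENNReal.ofReal ((2 ^ (n + 1) * B) ^ 2) *
        IsSquareKernel.sqConst n * (ENNReal.ofReal ((detConst n ^ 2 * δ) ^ 2) *
        ∫⁻ u, ‖f u‖ₑ ^ 2)))) := by
        gcongr
        · exact b1.trans (by gcongr)
        · exact b2.trans (by gcongr)
        · exact b3.trans (by gcongr)
    _ = _ := by
        have e : ENNReal.ofReal ((2 ^ (n + 1) * B) ^ 2) * IsSquareKernel.sqConst n *
            (ENNReal.ofReal ((detConst n ^ 2 * δ) ^ 2) * ∫⁻ u, ‖f u‖ₑ ^ 2) =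
            (ENNReal.ofReal ((2 ^ (n + 1) * B) ^ 2) * ENNReal.ofReal ((detConst n ^ 2 * δ) ^ 2)) *
            (IsSquareKernel.sqConst n * ∫⁻ u, ‖f u‖ₑ ^ 2) := by ring
        rw [e, c3, commConst]
        ring

end IsSmoothWavelet

end CommutatorEstimate

/-! ### The rotation group: compactness and action -/

section Rotations

variable {n : ℕ}

instance instSecondCountableTopologyMatrixReal : SecondCountableTopology (Matrix (Fin n) (Fin n) ℝ) :=
  inferInstanceAs (SecondCountableTopology (Fin n → Fin n → ℝ))

/-- Makes the Borel σ-algebra of a product with `SO(n)` the product σ-algebra, so that continuous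
maps of several rotations and points are jointly measurable. -/
instance instSecondCountableTopologyRotGroup : SecondCountableTopology (RotGroup n) :=
  TopologicalSpace.Subtype.secondCountableTopology _

theorem RotGroup.transpose_mul_self (R : RotGroup n) :
    (R : Matrix (Fin n) (Fin n) ℝ).transpose * (R : Matrix (Fin n) (Fin n) ℝ) = 1 := by
  have h := (Matrix.mem_specialOrthogonalGroup_iff.1 R.2).1
  exact (Matrix.mem_orthogonalGroup_iff' (Fin n) ℝ).1 h

/-- A closed subset of a cube, since the entries of an orthogonal matrix have absolute value at most
1. Compactness makes Haar measure finite. -/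
instance instCompactSpaceRotGroup : CompactSpace (RotGroup n) := by
  refine (isCompact_iff_compactSpace (s := ((Matrix.specialOrthogonalGroup (Fin n) ℝ :
    Submonoid _) : Set (Matrix (Fin n) (Fin n) ℝ)))).1 ?_
  have hbox : IsCompact (Set.univ.pi fun _ : Fin n => Set.univ.pi fun _ : Fin n =>
      Set.Icc (-1 : ℝ) 1) :=
    isCompact_univ_pi fun _ => isCompact_univ_pi fun _ => isCompact_Icc
  refine IsCompact.of_isClosed_subset (s := (Set.univ.pi fun _ : Fin n => Set.univ.pi fun _ : Fin n =>
      Set.Icc (-1 : ℝ) 1)) hbox ?_ ?_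
  · have : ((Matrix.specialOrthogonalGroup (Fin n) ℝ : Submonoid _) :
        Set (Matrix (Fin n) (Fin n) ℝ)) = {M | M.transpose * M = 1} ∩ {M | M.det = 1} := by
      ext M
      exact (Matrix.mem_specialOrthogonalGroup_iff).trans
        (and_congr_left' (Matrix.mem_orthogonalGroup_iff' (Fin n) ℝ))
    rw [this]
    refine (isClosed_eq ?_ continuous_const).inter (isClosed_eq ?_ continuous_const)
    · exact (continuous_id.matrix_transpose).matrix_mul continuous_id
    · exact continuous_id.matrix_det
  · intro M hM i _ j _
    have h := (Matrix.mem_specialOrthogonalGroup_iff.1 hM).1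
    have := entry_norm_bound_of_unitary h i j
    rwa [Real.norm_eq_abs, abs_le] at this

theorem RotGroup.isFiniteMeasure (μ : Measure (RotGroup n)) [μ.IsHaarMeasure] :
    IsFiniteMeasure μ := ⟨isCompact_univ.measure_lt_top⟩

theorem continuous_rotAct_inv : Continuous fun p : RotGroup n × Eucl n => rotAct p.1⁻¹ p.2 := by
  have : (fun p : RotGroup n × Eucl n => rotAct p.1⁻¹ p.2) = fun p => WithLp.toLp 2
      ((p.1 : Matrix (Fin n) (Fin n) ℝ).transpose.mulVec (WithLp.ofLp p.2)) := by
    funext p; rfl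
  rw [this]
  refine (PiLp.continuous_toLp 2 _).comp (Continuous.matrix_mulVec ?_ ?_)
  · exact (continuous_subtype_val.comp continuous_fst).matrix_transpose
  · exact (PiLp.continuous_ofLp 2 _).comp continuous_snd

theorem norm_rotAct (R : RotGroup n) (x : Eucl n) : ‖rotAct R x‖ = ‖x‖ := by
  have h : ‖rotAct R x‖ ^ 2 = ‖x‖ ^ 2 := by
    rw [EuclideanSpace.norm_sq_eq, EuclideanSpace.norm_sq_eq]
    have key : ∀ v : Fin n → ℝ, ∑ i, ‖v i‖ ^ 2 = v ⬝ᵥ v := fun v => by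
      simp [dotProduct, sq]
    rw [key (fun i => rotAct R x i), key (fun i => x i)]
    change ((R : Matrix (Fin n) (Fin n) ℝ).mulVec (WithLp.ofLp x)) ⬝ᵥ
      ((R : Matrix (Fin n) (Fin n) ℝ).mulVec (WithLp.ofLp x)) = _
    rw [Matrix.dotProduct_mulVec, Matrix.vecMul_mulVec, RotGroup.transpose_mul_self,
      Matrix.vecMul_one]
  exact (pow_left_inj₀ (norm_nonneg _) (norm_nonneg _) two_ne_zero).1 h

/-- A rotation as a linear isometry of `ℝⁿ`. -/
noncomputable def rotIsometry (R : RotGroup n) : Eucl n ≃ₗᵢ[ℝ] Eucl n :=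
  LinearIsometry.toLinearIsometryEquiv
    (⟨Matrix.toEuclideanLin (R : Matrix (Fin n) (Fin n) ℝ), norm_rotAct R⟩ :
      Eucl n →ₗᵢ[ℝ] Eucl n) rfl

end Rotations

/-! ### From partial derivatives to operator norms -/

section Derivatives

variable {n : ℕ}

theorem opNorm_le_of_basis {V : Type*} [NormedAddCommGroup V] [NormedSpace ℝ V]
    (T : Eucl n →L[ℝ] V) {c : ℝ} (hc : 0 ≤ c)
    (h : ∀ i, ‖T (EuclideanSpace.single i (1 : ℝ))‖ ≤ c) : ‖T‖ ≤ n * c := by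
  refine T.opNorm_le_bound (by positivity) fun x => ?_
  have hx : x = ∑ i, x i • EuclideanSpace.single i (1 : ℝ) := by
    conv_lhs => rw [← (EuclideanSpace.basisFun (Fin n) ℝ).sum_repr x]
    simp
  calc ‖T x‖ = ‖∑ i, x i • T (EuclideanSpace.single i (1 : ℝ))‖ := by
        conv_lhs => rw [hx]
        simp only [map_sum, map_smul]
    _ ≤ ∑ i : Fin n, ‖x‖ * c := by
        refine norm_sum_le_of_le _ fun i _ => ?_
        rw [norm_smul]
        exact mul_le_mul (PiLp.norm_apply_le x i) (h i) (norm_nonneg _) (norm_nonneg _)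
    _ = n * c * ‖x‖ := by simp; ring

/-- Passing from entries to operator norms costs a factor `n` per derivative. Operator norms are
preferred because they are unchanged by rotations. -/
theorem IsDecayingWavelet.isSmoothWavelet {A : ℝ} {ψ : Eucl n → ℂ} (h : IsDecayingWavelet n A ψ) :
    IsSmoothWavelet ((n ^ 2 + 1) * A) ψ := by
  have hA : 0 ≤ A := by
    have := (norm_nonneg _).trans (h.decay 0)
    simpa using this
  have hd : Differentiable ℝ (fderiv ℝ ψ) :=
    (h.contDiff.fderiv_right (m := 1) (by norm_num)).differentiable (by norm_num)
  have hn2 : (0 : ℝ) ≤ n := n.cast_nonneg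
  have hn3 : (n : ℝ) ≤ n ^ 2 + 1 := by nlinarith [sq_nonneg ((n : ℝ) - 1)]
  refine ⟨h.contDiff, h.integral_eq_zero, fun x => ?_, fun x => ?_, fun x => ?_⟩
  all_goals
    have hp : 0 ≤ A * ((1 + ‖x‖) ^ (n + 2))⁻¹ := by positivity
    rw [mul_assoc]
  · refine (h.decay x).trans ?_
    rw [div_eq_mul_inv]
    nlinarith [mul_nonneg (sq_nonneg (n : ℝ)) hp]
  · refine (opNorm_le_of_basis _ hp fun i => ?_).trans (mul_le_mul_of_nonneg_right hn3 hp)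
    exact (h.decay_first i x).trans (by rw [div_eq_mul_inv])
  · have h1 : ‖fderiv ℝ (fderiv ℝ ψ) x‖ ≤ n * (n * (A * ((1 + ‖x‖) ^ (n + 2))⁻¹)) := by
      refine opNorm_le_of_basis _ (by positivity) fun i => opNorm_le_of_basis _ hp fun j => ?_
      have h2 := h.decay_second i j x
      have h3 : partialDeriv i (partialDeriv j ψ) x =
          fderiv ℝ (fderiv ℝ ψ) x (EuclideanSpace.single i 1) (EuclideanSpace.single j 1) := by
        have : partialDeriv j ψ = fun y => fderiv ℝ ψ y (EuclideanSpace.single j (1 : ℝ)) := rfl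
        rw [this]
        unfold partialDeriv
        rw [fderiv_clm_apply (hd x) (differentiableAt_const _)]
        simp
      rw [h3] at h2
      exact h2.trans (by rw [div_eq_mul_inv])
    nlinarith

/-- Rotations are linear isometries of determinant one: they preserve the integral, the weight and
the operator norms, with the same `B`. All later estimates are thus uniform in the rotations. -/
theorem IsSmoothWavelet.comp_rotAct {B : ℝ} {ψ : Eucl n → ℂ} (h : IsSmoothWavelet B ψ)
    (R : RotGroup n) : IsSmoothWavelet B (fun x => ψ (rotAct R x)) := by
  have e : (fun x => ψ (rotAct R x)) = ψ ∘ rotIsometry R := rfl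
  have h1 : ∀ x, fderiv ℝ (ψ ∘ rotIsometry R) x =
      (fderiv ℝ ψ (rotIsometry R x)).comp (rotIsometry R : Eucl n →L[ℝ] Eucl n) := fun x =>
    ((h.differentiable _).hasFDerivAt.comp x
      (rotIsometry R : Eucl n →L[ℝ] Eucl n).hasFDerivAt).fderiv
  have hR : ‖((rotIsometry R : Eucl n ≃L[ℝ] Eucl n) : Eucl n →L[ℝ] Eucl n)‖ ≤ 1 :=
    ContinuousLinearMap.opNorm_le_bound _ zero_le_one fun x => by simp
  rw [e]
  refine ⟨h.contDiff.comp (rotIsometry R).contDiff, ?_, fun x => ?_, fun x => ?_, fun x => ?_⟩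
  · rw [← h.integral_eq_zero]
    exact (rotIsometry R).measurePreserving.integral_comp
      (rotIsometry R).toHomeomorph.measurableEmbedding ψ
  · simpa using h.norm_le (rotIsometry R x)
  · rw [h1]
    refine (ContinuousLinearMap.opNorm_comp_le _ _).trans ?_
    have := h.norm_fderiv_le (rotIsometry R x)
    rw [LinearIsometryEquiv.norm_map] at this
    exact (mul_le_of_le_one_right (norm_nonneg _) hR).trans this
  · have h2 : fderiv ℝ (ψ ∘ rotIsometry R) = fun x =>
      (fderiv ℝ ψ (rotIsometry R x)).comp (rotIsometry R : Eucl n →L[ℝ] Eucl n) := funext h1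
    have h3 := ((h.differentiable_fderiv _).hasFDerivAt.comp x
      (rotIsometry R : Eucl n →L[ℝ] Eucl n).hasFDerivAt).clm_comp
        (hasFDerivAt_const ((rotIsometry R : Eucl n ≃L[ℝ] Eucl n) : Eucl n →L[ℝ] Eucl n) x)
    have h4 := h3.fderiv
    have := h.norm_fderiv_fderiv_le (rotIsometry R x)
    rw [LinearIsometryEquiv.norm_map] at this
    rw [h2]
    refine (le_of_eq (congrArg norm h4)).trans (le_trans ?_ this)
    refine ContinuousLinearMap.opNorm_le_bound _ (ContinuousLinearMap.opNorm_nonneg _) fun v => ?_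
    refine ContinuousLinearMap.opNorm_le_bound _ (by positivity) fun w => ?_
    have h5 := ContinuousLinearMap.le_opNorm₂ (fderiv ℝ (fderiv ℝ ψ) (rotIsometry R x))
      (rotIsometry R v) (rotIsometry R w)
    simpa using h5

/-- The operator norm is at most the Hilbert–Schmidt norm, hence at most `n` times the largest
entry; Cauchy–Schwarz is applied to each row. -/
theorem isSmallDisplacement_of_supD_lt (hn : 1 ≤ n) {τ : Eucl n → Eucl n} (hτ : ContDiff ℝ 2 τ)
    (hD : supD τ ≠ ⊤) {δ : ℝ} (hδ : n * (supD τ).toReal ≤ δ) (hδ2 : δ ≤ 1 / 2) :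
    IsSmallDisplacement δ τ := by
  have hdiff : Differentiable ℝ τ := hτ.differentiable (by norm_num)
  refine ⟨hdiff, fun x => le_trans ?_ hδ, hδ2⟩
  have hd0 : 0 ≤ (supD τ).toReal := ENNReal.toReal_nonneg
  have hent : ∀ i j, |fderiv ℝ τ x (EuclideanSpace.single j (1 : ℝ)) i| ≤ (supD τ).toReal := by
    intro i j
    have h1 : ‖partialDeriv j (fun y => τ y i) x‖ₑ ≤ supD τ :=
      le_iSup_of_le x (le_iSup_of_le i (le_iSup_of_le j le_rfl))
    have h2 : partialDeriv j (fun y => τ y i) x =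
        fderiv ℝ τ x (EuclideanSpace.single j (1 : ℝ)) i := by
      have := (((EuclideanSpace.proj i : Eucl n →L[ℝ] ℝ).hasFDerivAt).comp x
        (hdiff x).hasFDerivAt).fderiv
      unfold partialDeriv
      rw [show (fun y => τ y i) = (EuclideanSpace.proj i : Eucl n →L[ℝ] ℝ) ∘ τ from rfl, this]
      rfl
    rw [h2] at h1
    have := ENNReal.toReal_mono hD h1
    simpa using this
  refine ContinuousLinearMap.opNorm_le_bound _ (by positivity) fun v => ?_
  have hv : v = ∑ j, v j • EuclideanSpace.single j (1 : ℝ) := by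
    conv_lhs => rw [← (EuclideanSpace.basisFun (Fin n) ℝ).sum_repr v]
    simp
  set d := (supD τ).toReal
  have hcoord : ∀ i, (fderiv ℝ τ x v i) ^ 2 ≤ n * d ^ 2 * ‖v‖ ^ 2 := by
    intro i
    have e : fderiv ℝ τ x v i =
        ∑ j, v j * fderiv ℝ τ x (EuclideanSpace.single j (1 : ℝ)) i := by
      conv_lhs => rw [hv]
      simp [map_sum]
    rw [e]
    refine (Finset.sum_mul_sq_le_sq_mul_sq _ _ _).trans ?_
    have e2 : ∑ j, v j ^ 2 = ‖v‖ ^ 2 := by rw [EuclideanSpace.norm_sq_eq]; simp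
    rw [e2, mul_comm]
    refine mul_le_mul_of_nonneg_right ?_ (sq_nonneg _)
    calc _ ≤ ∑ _j : Fin n, d ^ 2 := Finset.sum_le_sum fun j _ => by
            rw [← sq_abs]; gcongr; exact hent i j
      _ = _ := by simp
  refine (pow_le_pow_iff_left₀ (norm_nonneg _) (by positivity) two_ne_zero).1 ?_
  rw [EuclideanSpace.norm_sq_eq]
  calc _ ≤ ∑ _i : Fin n, n * d ^ 2 * ‖v‖ ^ 2 := Finset.sum_le_sum fun i _ => by
          rw [Real.norm_eq_abs, sq_abs]; exact hcoord i
    _ = _ := by simp; ring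

end Derivatives

/-! ### A single layer of the cascade -/

section Layers

variable {n : ℕ}

/-- One layer `|f ∗ ψ_{l,R}|` of the cascade. -/
noncomputable def layer (ψ : Eucl n → ℂ) (l : ℝ) (R : RotGroup n) (f : Eucl n → ℂ) (x : Eucl n) :
    ℂ :=
  ((‖convC f (dilRotWavelet ψ l R) x‖ : ℝ) : ℂ)

theorem cascade_succ (ψ : Eucl n → ℂ) (m : ℕ) (l : Fin (m + 1) → ℝ) (R : Fin (m + 1) → RotGroup n)
    (f : Eucl n → ℂ) : cascade ψ (m + 1) l R f =
      cascade ψ m (Fin.tail l) (Fin.tail R) (layer ψ (l 0) (R 0) f) := rfl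

theorem measurable_rotAct_inv {β : Type*} [MeasurableSpace β] {R : β → RotGroup n}
    (hR : Measurable R) {x : β → Eucl n} (hx : Measurable x) :
    Measurable fun b => rotAct (R b)⁻¹ (x b) := by
  have h : Measurable fun p : RotGroup n × Eucl n => rotAct p.1⁻¹ p.2 :=
    continuous_rotAct_inv.measurable
  have h' := h.comp (hR.prodMk hx)
  exact h'

theorem measurable_dilRotWavelet {ψ : Eucl n → ℂ} (hψ : Measurable ψ) {β : Type*}
    [MeasurableSpace β] {l : β → ℝ} (hl : Measurable l) {R : β → RotGroup n} (hR : Measurable R)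
    {x : β → Eucl n} (hx : Measurable x) :
    Measurable fun b => dilRotWavelet ψ (l b) (R b) (x b) := by
  unfold dilRotWavelet
  have hr : Measurable fun b => (l b)⁻¹ • rotAct (R b)⁻¹ (x b) :=
    hl.inv.smul (measurable_rotAct_inv hR hx)
  exact (Complex.measurable_ofReal.comp (hl.pow_const _)).mul (hψ.comp hr)

theorem measurable_layer {ψ : Eucl n → ℂ} (hψ : Measurable ψ) {β : Type*} [MeasurableSpace β]
    {l : β → ℝ} (hl : Measurable l) {R : β → RotGroup n} (hR : Measurable R)
    {F : β → Eucl n → ℂ} (hF : Measurable (Function.uncurry F)) :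
    Measurable (Function.uncurry fun b => layer ψ (l b) (R b) (F b)) := by
  have hz : Measurable fun q : (β × Eucl n) × Eucl n => q.1.2 - q.2 :=
    (measurable_snd.comp measurable_fst).sub measurable_snd
  have hb : Measurable fun q : (β × Eucl n) × Eucl n => q.1.1 :=
    measurable_fst.comp measurable_fst
  have hF' : Measurable fun q : (β × Eucl n) × Eucl n => F q.1.1 q.2 :=
    hF.comp (hb.prodMk measurable_snd)
  have h1 : Measurable fun q : (β × Eucl n) × Eucl n =>
      dilRotWavelet ψ (l q.1.1) (R q.1.1) (q.1.2 - q.2) :=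
    measurable_dilRotWavelet hψ (hl.comp hb) (hR.comp hb) hz
  have h2 : Measurable fun p : β × Eucl n => ∫ z, F p.1 z *
      dilRotWavelet ψ (l p.1) (R p.1) (p.2 - z) :=
    ((hF'.mul h1).stronglyMeasurable.integral_prod_right).measurable
  have e : (Function.uncurry fun b => layer ψ (l b) (R b) (F b)) = fun p : β × Eucl n =>
      ((‖∫ z, F p.1 z * dilRotWavelet ψ (l p.1) (R p.1) (p.2 - z)‖ : ℝ) : ℂ) := rfl
  rw [e]
  exact Complex.measurable_ofReal.comp h2.norm

theorem measurable_cascade {ψ : Eucl n → ℂ} (hψ : Measurable ψ) {β : Type*} [MeasurableSpace β]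
    (m : ℕ) : ∀ {l : β → Fin m → ℝ} (_ : Measurable l) {R : β → Fin m → RotGroup n}
    (_ : Measurable R) {F : β → Eucl n → ℂ} (_ : Measurable (Function.uncurry F)),
    Measurable (Function.uncurry fun b => cascade ψ m (l b) (R b) (F b)) := by
  induction m with
  | zero => intro l _ R _ F hF; exact hF
  | succ m ih =>
    intro l hl R hR F hF
    have hl0 : Measurable fun b => l b 0 := (measurable_pi_apply 0).comp hl
    have hR0 : Measurable fun b => R b 0 := (measurable_pi_apply 0).comp hR
    refine ih (l := fun b => Fin.tail (l b)) (R := fun b => Fin.tail (R b)) ?_ ?_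
      (measurable_layer hψ hl0 hR0 hF)
    · exact measurable_pi_iff.2 fun i => (measurable_pi_apply i.succ).comp hl
    · exact measurable_pi_iff.2 fun i => (measurable_pi_apply i.succ).comp hR

theorem rotAct_smul (R : RotGroup n) (c : ℝ) (x : Eucl n) : rotAct R (c • x) = c • rotAct R x :=
  (rotIsometry R).map_smul c x

/-- The normalisations `l^(-n/2)` and `l^(-n)` differ by `l^(n/2)`. After squaring this is `l ^ n`,
which turns `dl / l^(n+1)` into `dl / l`. -/
theorem convC_dilRotWavelet_eq (ψ : Eucl n → ℂ) {l : ℝ} (hl : 0 < l) (R : RotGroup n)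
    (f : Eucl n → ℂ) (x : Eucl n) :
    convC f (dilRotWavelet ψ l R) x =
      ((l ^ ((n : ℝ) / 2) : ℝ) : ℂ) * dilConv (fun y => ψ (rotAct R⁻¹ y)) l f x := by
  have hr : l ^ (-(n : ℝ) / 2) = l ^ ((n : ℝ) / 2) * (l ^ n)⁻¹ := by
    rw [← Real.rpow_natCast l n, ← Real.rpow_neg hl.le, ← Real.rpow_add hl]
    congr 1; ring
  unfold convC convolution dilConv
  rw [← integral_const_mul]
  refine integral_congr_ae (Filter.Eventually.of_forall fun z => ?_)
  simp only [ContinuousLinearMap.mul_apply', dilRotWavelet, dilate, rotAct_smul, hr]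
  push_cast
  ring

/-- The squared `L²` norm with values in `[0,∞]`. -/
noncomputable def eNormSq (g : Eucl n → ℂ) : ℝ≥0∞ := ∫⁻ x, ‖g x‖ₑ ^ 2

/-- The modulus is 1-Lipschitz. The two evaluation points `x`, `y` are kept distinct so that the
bound covers both differences of inputs and commutators. -/
theorem ofReal_pow_mul_dilConv (ψ : Eucl n → ℂ) {l : ℝ} (hl : 0 < l) (R : RotGroup n)
    (f h : Eucl n → ℂ) (x y : Eucl n) :
    ‖layer ψ l R f x - layer ψ l R h y‖ₑ ^ 2 ≤ ENNReal.ofReal (l ^ n) *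
      ‖dilConv (fun y => ψ (rotAct R⁻¹ y)) l f x - dilConv (fun y => ψ (rotAct R⁻¹ y)) l h y‖ₑ ^ 2 := by
  have h1 : ‖layer ψ l R f x - layer ψ l R h y‖ ≤ l ^ ((n : ℝ) / 2) *
      ‖dilConv (fun y => ψ (rotAct R⁻¹ y)) l f x -
        dilConv (fun y => ψ (rotAct R⁻¹ y)) l h y‖ := by
    unfold layer
    rw [← Complex.ofReal_sub, Complex.norm_real, Real.norm_eq_abs]
    refine (abs_norm_sub_norm_le _ _).trans ?_
    rw [convC_dilRotWavelet_eq ψ hl, convC_dilRotWavelet_eq ψ hl, ← mul_sub, norm_mul,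
      Complex.norm_real, Real.norm_of_nonneg (by positivity)]
  have h2 := ENNReal.ofReal_le_ofReal (pow_le_pow_left₀ (norm_nonneg _) h1 2)
  rw [mul_pow, ENNReal.ofReal_mul (by positivity), ENNReal.ofReal_pow (norm_nonneg _),
    ENNReal.ofReal_pow (norm_nonneg _), ofReal_norm, ofReal_norm] at h2
  refine h2.trans (le_of_eq ?_)
  congr 2
  rw [← Real.rpow_natCast (l ^ ((n : ℝ) / 2)), ← Real.rpow_mul hl.le, ← Real.rpow_natCast l n]
  congr 1
  push_cast; ring

instance instSigmaFiniteScaleMeasure : SigmaFinite (scaleMeasure n) := by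
  unfold scaleMeasure; infer_instance

theorem ae_pos_scaleMeasure : ∀ᵐ t ∂scaleMeasure n, 0 < t := by
  have h : scaleMeasure n ≪ volume.restrict (Set.Ioi 0) := withDensity_absolutelyContinuous _ _
  exact h.ae_le (ae_restrict_mem measurableSet_Ioi)

theorem lintegral_scaleMeasure_mul {φ : ℝ → ℝ≥0∞} (hφ : Measurable φ) :
    ∫⁻ t, ENNReal.ofReal (t ^ n) * φ t ∂scaleMeasure n = ∫⁻ t, φ t ∂logMeasure := by
  have h1 : Measurable fun t : ℝ => ENNReal.ofReal (1 / t ^ (n + 1)) := by fun_prop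
  have h2 : Measurable fun t : ℝ => ENNReal.ofReal (t ^ n) * φ t := by fun_prop
  rw [lintegral_logMeasure hφ]
  unfold scaleMeasure
  rw [lintegral_withDensity_eq_lintegral_mul _ h1 h2]
  refine setLIntegral_congr_fun measurableSet_Ioi fun t ht => ?_
  have ht' : (0 : ℝ) < t := ht
  simp only [Pi.mul_apply]
  rw [← mul_assoc, ← ENNReal.ofReal_mul (by positivity)]
  congr 2
  field_simp
  ring

theorem eNormSq_add_le {g h : Eucl n → ℂ} (hg : Measurable g) (hh : Measurable h) :
    eNormSq (fun x => g x + h x) ≤ 2 * eNormSq g + 2 * eNormSq h := by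
  have m1 : Measurable fun x => ‖g x‖ₑ ^ 2 := by fun_prop
  have m2 : Measurable fun x => ‖h x‖ₑ ^ 2 := by fun_prop
  unfold eNormSq
  rw [← lintegral_const_mul _ m1, ← lintegral_const_mul _ m2, ← lintegral_add_left (by fun_prop)]
  exact lintegral_mono fun x => enorm_add_sq_le _ _

theorem eNormSq_sub_ne_top {g h : Eucl n → ℂ} (hg : Measurable g) (hh : Measurable h)
    (hg2 : eNormSq g ≠ ⊤) (hh2 : eNormSq h ≠ ⊤) : eNormSq (fun x => g x - h x) ≠ ⊤ := by
  have h1 := eNormSq_add_le hg hh.neg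
  have h2 : eNormSq (-h) = eNormSq h := by simp [eNormSq]
  rw [h2] at h1
  refine ne_top_of_le_ne_top ?_ ((le_of_eq ?_).trans h1)
  · finiteness
  · simp [sub_eq_add_neg]

theorem measurable_eNormSq {β : Type*} [MeasurableSpace β] {F : β → Eucl n → ℂ}
    (hF : Measurable (Function.uncurry F)) : Measurable fun b => eNormSq (F b) :=
  (hF.enorm.pow_const 2).lintegral_prod_right

/-- The `L²` operator constant of a layer. -/
noncomputable def layerConst (n : ℕ) (B : ℝ) : ℝ≥0∞ :=
  ENNReal.ofReal ((2 ^ (n + 1) * B) ^ 2) * IsSquareKernel.sqConst n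

theorem layerConst_ne_top (n : ℕ) (B : ℝ) : layerConst n B ≠ ⊤ :=
  ENNReal.mul_ne_top ENNReal.ofReal_ne_top (IsSquareKernel.sqConst_ne_top n)

/-- The `L²` operator constant of a layer at a fixed scale. -/
noncomputable def fixedScaleConst (n : ℕ) (B l : ℝ) : ℝ≥0∞ :=
  ENNReal.ofReal (l ^ n) * (ENNReal.ofReal (2 ^ (n + 1) * B) * bumpMass n) ^ 2

theorem fixedScaleConst_ne_top (n : ℕ) (B l : ℝ) : fixedScaleConst n B l ≠ ⊤ := by
  have := bumpMass_ne_top n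
  unfold fixedScaleConst
  finiteness

namespace IsSmoothWavelet

variable {B : ℝ} {ψ : Eucl n → ℂ}

theorem dilConv_sub (h : IsSmoothWavelet B ψ) {f g : Eucl n → ℂ} (hf : Measurable f)
    (hf2 : eNormSq f ≠ ⊤) (hg : Measurable g) (hg2 : eNormSq g ≠ ⊤) {t : ℝ} (ht : 0 < t)
    (x : Eucl n) :
    dilConv ψ t (fun z => f z - g z) x = dilConv ψ t f x - dilConv ψ t g x := by
  unfold dilConv
  simp only [mul_sub]
  exact integral_sub
    (integrable_kernel_mul hf hf2 ht x (h.measurable_dilate_sub t x)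
      (h.isSquareKernel.size t ht x))
    (integrable_kernel_mul hg hg2 ht x (h.measurable_dilate_sub t x)
      (h.isSquareKernel.size t ht x))

/-- Schur's test at one fixed scale. Together with `fixedScaleConst` it supplies only finiteness at
given scales and does not enter the final constant. -/
theorem eNormSq_dilConv_le (h : IsSmoothWavelet B ψ) {f : Eucl n → ℂ} (hf : Measurable f)
    {t : ℝ} (ht : 0 < t) :
    eNormSq (dilConv ψ t f) ≤ (ENNReal.ofReal (2 ^ (n + 1) * B) * bumpMass n) ^ 2 * eNormSq f := by
  have hD : (0 : ℝ) ≤ 2 ^ (n + 1) * B := mul_nonneg (by positivity) h.nonneg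
  have hk : Measurable (Function.uncurry fun x u : Eucl n =>
      ENNReal.ofReal (2 ^ (n + 1) * B) * ENNReal.ofReal (bump t (x - u))) :=
    ((((measurable_bump_right t).comp (measurable_fst.sub measurable_snd))).ennreal_ofReal).const_mul _
  have h1 : ∀ x : Eucl n, ∫⁻ u, ENNReal.ofReal (2 ^ (n + 1) * B) *
      ENNReal.ofReal (bump t (x - u)) ≤ ENNReal.ofReal (2 ^ (n + 1) * B) * bumpMass n := fun x => by
    rw [lintegral_const_mul' _ _ ENNReal.ofReal_ne_top, lintegral_bump_sub_left ht]
  have h2 : ∀ u : Eucl n, ∫⁻ x, ENNReal.ofReal (2 ^ (n + 1) * B) *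
      ENNReal.ofReal (bump t (x - u)) ≤ ENNReal.ofReal (2 ^ (n + 1) * B) * bumpMass n := fun u => by
    rw [lintegral_const_mul' _ _ ENNReal.ofReal_ne_top, lintegral_bump_sub_right ht]
  have h3 := lintegral_sq_lintegral_mul_le volume volume hk (Filter.Eventually.of_forall h1)
    (Filter.Eventually.of_forall h2) hf.enorm
  rw [← sq] at h3
  refine le_trans (lintegral_mono fun x => ?_) h3
  refine pow_le_pow_left' ?_ 2
  unfold dilConv
  refine (enorm_integral_le_lintegral_enorm _).trans (lintegral_mono fun u => ?_)
  rw [enorm_mul, ← ENNReal.ofReal_mul hD]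
  refine mul_le_mul_left ?_ _
  rw [← ofReal_norm]
  exact ENNReal.ofReal_le_ofReal (h.isSquareKernel.size t ht x u)

theorem measurable_layer' (h : IsSmoothWavelet B ψ) (l : ℝ) (R : RotGroup n) {f : Eucl n → ℂ}
    (hf : Measurable f) : Measurable (layer ψ l R f) := by
  have h1 : Measurable (Function.uncurry fun _ : Unit => layer ψ l R f) :=
    measurable_layer h.measurable measurable_const measurable_const (hf.comp measurable_snd)
  have h2 : Measurable fun x : Eucl n => ((), x) := measurable_const.prodMk measurable_id
  have h3 := h1.comp h2
  exact h3

theorem eNormSq_layer_le (h : IsSmoothWavelet B ψ) {l : ℝ} (hl : 0 < l) (R : RotGroup n)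
    {f : Eucl n → ℂ} (hf : Measurable f) :
    eNormSq (layer ψ l R f) ≤ fixedScaleConst n B l * eNormSq f := by
  have h1 : ∀ x, ‖layer ψ l R f x‖ₑ ^ 2 ≤ ENNReal.ofReal (l ^ n) *
      ‖dilConv (fun y => ψ (rotAct R⁻¹ y)) l f x‖ₑ ^ 2 := fun x => by
    simpa [layer, convC, convolution, dilConv] using ofReal_pow_mul_dilConv ψ hl R f 0 x x
  refine (lintegral_mono h1).trans ?_
  rw [lintegral_const_mul' _ _ ENNReal.ofReal_ne_top, fixedScaleConst, mul_assoc]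
  exact mul_le_mul_right ((h.comp_rotAct R⁻¹).eNormSq_dilConv_le hf hl) _

/-- Although a layer is nonlinear, removing the modulus reduces the difference to the linear
transform of `f - g`, to which the square function estimate applies. -/
theorem lintegral_eNormSq_layer_sub_le (h : IsSmoothWavelet B ψ) (R : RotGroup n)
    {f g : Eucl n → ℂ} (hf : Measurable f) (hf2 : eNormSq f ≠ ⊤) (hg : Measurable g)
    (hg2 : eNormSq g ≠ ⊤) :
    ∫⁻ l, eNormSq (fun x => layer ψ l R f x - layer ψ l R g x) ∂scaleMeasure n ≤
      layerConst n B * eNormSq (fun x => f x - g x) := by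
  have hR := h.comp_rotAct R⁻¹
  have hfg : Measurable fun x => f x - g x := hf.sub hg
  have hm : Measurable fun l => eNormSq (dilConv (fun y => ψ (rotAct R⁻¹ y)) l
      (fun x => f x - g x)) := measurable_eNormSq (measurable_dilConv hR.measurable hfg)
  refine le_trans (lintegral_mono_ae ?_) ((lintegral_scaleMeasure_mul hm).trans_le
    (hR.lintegral_dilConv_sq_le hfg (eNormSq_sub_ne_top hf hg hf2 hg2)))
  filter_upwards [ae_pos_scaleMeasure] with l hl
  unfold eNormSq
  rw [← lintegral_const_mul' _ _ ENNReal.ofReal_ne_top]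
  refine lintegral_mono fun x => ?_
  rw [hR.dilConv_sub hf hf2 hg hg2 hl]
  exact ofReal_pow_mul_dilConv ψ hl R f g x x

theorem lintegral_eNormSq_layer_le (h : IsSmoothWavelet B ψ) (R : RotGroup n)
    {f : Eucl n → ℂ} (hf : Measurable f) (hf2 : eNormSq f ≠ ⊤) :
    ∫⁻ l, eNormSq (layer ψ l R f) ∂scaleMeasure n ≤ layerConst n B * eNormSq f := by
  have h0 : ∀ l x, layer ψ l R 0 x = 0 := fun l x => by simp [layer, convC, convolution]
  have h1 := h.lintegral_eNormSq_layer_sub_le R hf hf2 (g := 0) measurable_const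
    (by simp [eNormSq])
  simp only [h0, Pi.zero_apply, sub_zero] at h1
  exact h1

theorem lintegral_eNormSq_layer_commutator_le (h : IsSmoothWavelet B ψ) (hn : 1 ≤ n) {δ : ℝ}
    {τ : Eucl n → Eucl n} (hτ : IsSmallDisplacement δ τ) (R : RotGroup n)
    {f : Eucl n → ℂ} (hf : Measurable f) (hf2 : eNormSq f ≠ ⊤) :
    ∫⁻ l, eNormSq (fun x => layer ψ l R (deform τ f) x - layer ψ l R f (x - τ x)) ∂scaleMeasure n ≤
      ENNReal.ofReal ((B * δ) ^ 2) * commConst n * eNormSq f := by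
  have hR := h.comp_rotAct R⁻¹
  have hfg : Measurable (deform τ f) := by
    have m := hf.comp hτ.measurable_map
    exact m
  have m1 : Measurable fun p : ℝ × Eucl n =>
      dilConv (fun y => ψ (rotAct R⁻¹ y)) p.1 (deform τ f) p.2 :=
    measurable_dilConv hR.measurable hfg
  have m0 : Measurable fun p : ℝ × Eucl n => dilConv (fun y => ψ (rotAct R⁻¹ y)) p.1 f p.2 :=
    measurable_dilConv hR.measurable hf
  have m2 : Measurable fun p : ℝ × Eucl n =>
      dilConv (fun y => ψ (rotAct R⁻¹ y)) p.1 f (p.2 - τ p.2) := by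
    have hg : Measurable fun p : ℝ × Eucl n => p.2 - τ p.2 := hτ.measurable_map.comp measurable_snd
    have m := m0.comp (measurable_fst.prodMk hg)
    exact m
  have hm : Measurable fun l => eNormSq fun x => dilConv (fun y => ψ (rotAct R⁻¹ y)) l
      (deform τ f) x - dilConv (fun y => ψ (rotAct R⁻¹ y)) l f (x - τ x) :=
    measurable_eNormSq (m1.sub m2)
  refine le_trans (lintegral_mono_ae ?_) ((lintegral_scaleMeasure_mul hm).trans_le
    (hR.lintegral_commutator_sq_le hn hτ hf hf2))
  filter_upwards [ae_pos_scaleMeasure] with l hl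
  unfold eNormSq
  rw [← lintegral_const_mul' _ _ ENNReal.ofReal_ne_top]
  exact lintegral_mono fun x => ofReal_pow_mul_dilConv ψ hl R _ f x (x - τ x)

end IsSmoothWavelet

end Layers

/-! ### Lipschitz and commutator bounds for the cascade -/

section CascadeEstimates

variable {n : ℕ}

theorem lintegral_pi_fin_succ (ν : Measure ℝ) [SigmaFinite ν] {m : ℕ}
    {G : (Fin (m + 1) → ℝ) → ℝ≥0∞} (hG : Measurable G) :
    ∫⁻ l, G l ∂(Measure.pi fun _ : Fin (m + 1) => ν) =
      ∫⁻ s, (∫⁻ l, G (Fin.cons s l) ∂(Measure.pi fun _ : Fin m => ν)) ∂ν := by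
  have h := (measurePreserving_piFinSuccAbove (fun _ : Fin (m + 1) => ν) 0).symm
  rw [← h.lintegral_comp hG]
  have h2 : Measurable fun p : ℝ × (Fin m → ℝ) =>
      G ((MeasurableEquiv.piFinSuccAbove (fun _ : Fin (m + 1) => ℝ) 0).symm p) :=
    hG.comp (MeasurableEquiv.measurable _)
  rw [lintegral_prod _ h2.aemeasurable]
  refine lintegral_congr fun s => lintegral_congr fun l => ?_
  congr 1
  exact Fin.insertNth_zero' s l

theorem measurable_fin_cons {m : ℕ} {α β : Type*} [MeasurableSpace α] [MeasurableSpace β]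
    {f : β → α} (hf : Measurable f) {g : β → Fin m → α} (hg : Measurable g) :
    Measurable fun b => (Fin.cons (f b) (g b) : Fin (m + 1) → α) := by
  refine measurable_pi_iff.2 fun i => ?_
  refine Fin.cases ?_ (fun j => ?_) i
  · simpa using hf
  · have h := (measurable_pi_apply j).comp hg
    simp only [Fin.cons_succ]
    exact h

/-- The constant in the commutator estimate for the cascade. -/
noncomputable def cascadeCommConst (n : ℕ) (B : ℝ) : ℕ → ℝ≥0∞
  | 0 => 0
  | m + 1 => 2 * (layerConst n B ^ m * (ENNReal.ofReal (B ^ 2) * IsSmoothWavelet.commConst n)) +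
      2 * (cascadeCommConst n B m * layerConst n B)

theorem cascadeCommConst_ne_top (n : ℕ) (B : ℝ) (m : ℕ) : cascadeCommConst n B m ≠ ⊤ := by
  have h1 := layerConst_ne_top n B
  have h2 := IsSmoothWavelet.commConst_ne_top n
  induction m with
  | zero => simp [cascadeCommConst]
  | succ m ih => unfold cascadeCommConst; finiteness

namespace IsSmoothWavelet

variable {B : ℝ} {ψ : Eucl n → ℂ}

theorem measurable_cascade_apply (h : IsSmoothWavelet B ψ) {m : ℕ} (l : Fin m → ℝ)
    (R : Fin m → RotGroup n) {f : Eucl n → ℂ} (hf : Measurable f) :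
    Measurable (cascade ψ m l R f) := by
  have h1 : Measurable (Function.uncurry fun _ : Unit => cascade ψ m l R f) :=
    measurable_cascade h.measurable m measurable_const measurable_const (hf.comp measurable_snd)
  have h2 : Measurable fun x : Eucl n => ((), x) := measurable_const.prodMk measurable_id
  have h3 := h1.comp h2
  exact h3

theorem measurable_cascade_scale (h : IsSmoothWavelet B ψ) {m : ℕ}
    (R : Fin m → RotGroup n) {f : Eucl n → ℂ} (hf : Measurable f) :
    Measurable (Function.uncurry fun l => cascade ψ m l R f) :=
  measurable_cascade h.measurable m measurable_id measurable_const (hf.comp measurable_snd)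

theorem eNormSq_layer_ne_top (h : IsSmoothWavelet B ψ) {l : ℝ} (hl : 0 < l) (R : RotGroup n)
    {f : Eucl n → ℂ} (hf : Measurable f) (hf2 : eNormSq f ≠ ⊤) : eNormSq (layer ψ l R f) ≠ ⊤ :=
  ne_top_of_le_ne_top (ENNReal.mul_ne_top (fixedScaleConst_ne_top n B l) hf2)
    (h.eNormSq_layer_le hl R hf)

theorem eNormSq_cascade_le (h : IsSmoothWavelet B ψ) (m : ℕ) :
    ∀ {l : Fin m → ℝ} (_ : ∀ i, 0 < l i) (R : Fin m → RotGroup n) {f : Eucl n → ℂ}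
      (_ : Measurable f),
      eNormSq (cascade ψ m l R f) ≤ (∏ i, fixedScaleConst n B (l i)) * eNormSq f := by
  induction m with
  | zero => intro l _ R f _; simp [cascade]
  | succ m ih =>
    intro l hl R f hf
    rw [cascade_succ, Fin.prod_univ_succ]
    refine (ih (fun i => hl i.succ) (Fin.tail R) (h.measurable_layer' _ _ hf)).trans ?_
    refine (mul_le_mul_right (h.eNormSq_layer_le (hl 0) (R 0) hf) _).trans (le_of_eq ?_)
    ring

/-- Induction on the number of layers: with the first scale fixed, the remaining layers are
Lipschitz, and the first one costs one more factor `layerConst`. -/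
theorem lintegral_eNormSq_cascade_sub_le (h : IsSmoothWavelet B ψ) (m : ℕ) :
    ∀ (R : Fin m → RotGroup n) {f g : Eucl n → ℂ} (_ : Measurable f) (_ : eNormSq f ≠ ⊤)
      (_ : Measurable g) (_ : eNormSq g ≠ ⊤),
      ∫⁻ l, eNormSq (fun x => cascade ψ m l R f x - cascade ψ m l R g x)
        ∂(Measure.pi fun _ : Fin m => scaleMeasure n) ≤
          layerConst n B ^ m * eNormSq (fun x => f x - g x) := by
  induction m with
  | zero => intro R f g _ _ _ _; simp [cascade]
  | succ m ih =>
    intro R f g hf hf2 hg hg2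
    have hm : Measurable fun l => eNormSq (fun x =>
        cascade ψ (m + 1) l R f x - cascade ψ (m + 1) l R g x) :=
      measurable_eNormSq ((h.measurable_cascade_scale R hf).sub (h.measurable_cascade_scale R hg))
    rw [lintegral_pi_fin_succ _ hm]
    calc _ ≤ ∫⁻ s, layerConst n B ^ m *
          eNormSq (fun x => layer ψ s (R 0) f x - layer ψ s (R 0) g x) ∂scaleMeasure n := by
          refine lintegral_mono_ae ?_
          filter_upwards [ae_pos_scaleMeasure] with s hs
          simp only [cascade_succ, Fin.tail_cons, Fin.cons_zero]
          exact ih (Fin.tail R) (h.measurable_layer' s (R 0) hf)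
            (h.eNormSq_layer_ne_top hs _ hf hf2) (h.measurable_layer' s (R 0) hg)
            (h.eNormSq_layer_ne_top hs _ hg hg2)
      _ ≤ _ := by
          rw [lintegral_const_mul' _ _ (by have := layerConst_ne_top n B; finiteness), pow_succ,
            mul_assoc]
          exact mul_le_mul_right (h.lintegral_eNormSq_layer_sub_le (R 0) hf hf2 hg hg2) _

theorem cascade_zero_fun (ψ : Eucl n → ℂ) (m : ℕ) : ∀ (l : Fin m → ℝ) (R : Fin m → RotGroup n)
    (x : Eucl n), cascade ψ m l R (fun _ => 0) x = 0 := by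
  induction m with
  | zero => intro l R x; rfl
  | succ m ih =>
    intro l R x
    have h0 : layer ψ (l 0) (R 0) (fun _ => 0) = fun _ => 0 := by
      funext y; simp [layer, convC, convolution]
    rw [cascade_succ, h0, ih]

theorem lintegral_eNormSq_cascade_le (h : IsSmoothWavelet B ψ) (m : ℕ)
    (R : Fin m → RotGroup n) {f : Eucl n → ℂ} (hf : Measurable f) (hf2 : eNormSq f ≠ ⊤) :
    ∫⁻ l, eNormSq (cascade ψ m l R f) ∂(Measure.pi fun _ : Fin m => scaleMeasure n) ≤
      layerConst n B ^ m * eNormSq f := by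
  have h1 := h.lintegral_eNormSq_cascade_sub_le m R hf hf2 (g := fun _ => 0) measurable_const
    (by simp [eNormSq])
  simp only [cascade_zero_fun, sub_zero] at h1
  exact h1

/-- Telescoping over layers. With `L = deform τ`, `u` the first layer of `f` and `v` that of `L f`,
the commutator is `(S v - S (L u)) + (S (L u) - L (S u))`, where `S` denotes the remaining layers.
The Lipschitz bound with the one-layer commutator handles the first difference, and induction
handles the second. -/
theorem lintegral_eNormSq_cascade_commutator_le (h : IsSmoothWavelet B ψ) (hn : 1 ≤ n) {δ : ℝ}
    {τ : Eucl n → Eucl n} (hτ : IsSmallDisplacement δ τ) (m : ℕ) :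
    ∀ (R : Fin m → RotGroup n) {f : Eucl n → ℂ} (_ : Measurable f) (_ : eNormSq f ≠ ⊤),
      ∫⁻ l, eNormSq (fun x => cascade ψ m l R (deform τ f) x - cascade ψ m l R f (x - τ x))
        ∂(Measure.pi fun _ : Fin m => scaleMeasure n) ≤
          cascadeCommConst n B m * (ENNReal.ofReal (δ ^ 2) * eNormSq f) := by
  have hK := layerConst_ne_top n B
  have hg := hτ.measurable_map
  have hdef : ∀ {f : Eucl n → ℂ}, Measurable f → Measurable (deform τ f) := fun hf => by
    have m := hf.comp hg
    exact m
  have hdef2 : ∀ {f : Eucl n → ℂ}, eNormSq f ≠ ⊤ → eNormSq (deform τ f) ≠ ⊤ := fun hf2 =>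
    ne_top_of_le_ne_top (ENNReal.mul_ne_top ENNReal.ofReal_ne_top hf2)
      (hτ.lintegral_comp_le hn _)
  have hcomp : ∀ {β : Type} [MeasurableSpace β] {F : β → Eucl n → ℂ},
      Measurable (Function.uncurry F) →
      Measurable (Function.uncurry fun b => deform τ (F b)) := fun {β} _ {F} hF => by
    have hg' : Measurable fun p : β × Eucl n => p.2 - τ p.2 := hg.comp measurable_snd
    have m := hF.comp (measurable_fst.prodMk hg')
    exact m
  induction m with
  | zero => intro R f _ _; simp [cascade, deform, eNormSq]
  | succ m ih =>
    intro R f hf hf2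
    have hm : Measurable fun l => eNormSq (fun x =>
        cascade ψ (m + 1) l R (deform τ f) x - deform τ (cascade ψ (m + 1) l R f) x) :=
      measurable_eNormSq ((h.measurable_cascade_scale R (hdef hf)).sub
        (hcomp (h.measurable_cascade_scale R hf)))
    refine (lintegral_pi_fin_succ _ hm).trans_le ?_
    have mL : ∀ {f : Eucl n → ℂ}, Measurable f →
        Measurable (Function.uncurry fun s => layer ψ s (R 0) f) := fun hf =>
      measurable_layer h.measurable measurable_id measurable_const (hf.comp measurable_snd)
    have mA : Measurable fun s => eNormSq (fun x =>
        layer ψ s (R 0) (deform τ f) x - deform τ (layer ψ s (R 0) f) x) :=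
      measurable_eNormSq ((mL (hdef hf)).sub (hcomp (mL hf)))
    have mB : Measurable fun s => eNormSq (layer ψ s (R 0) f) := measurable_eNormSq (mL hf)
    -- The two summands, each doubled by `(a + b)² ≤ 2a² + 2b²`, reproduce the recursion defining
    -- `cascadeCommConst`.
    calc _ ≤ ∫⁻ s, (2 * layerConst n B ^ m * eNormSq (fun x =>
            layer ψ s (R 0) (deform τ f) x - deform τ (layer ψ s (R 0) f) x) +
          2 * cascadeCommConst n B m * ENNReal.ofReal (δ ^ 2) * eNormSq (layer ψ s (R 0) f))
            ∂scaleMeasure n := by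
          refine lintegral_mono_ae ?_
          filter_upwards [ae_pos_scaleMeasure] with s hs
          simp only [cascade_succ, Fin.tail_cons, Fin.cons_zero]
          set u := layer ψ s (R 0) f with hu
          set v := layer ψ s (R 0) (deform τ f) with hv
          have hum : Measurable u := h.measurable_layer' s (R 0) hf
          have hu2 : eNormSq u ≠ ⊤ := h.eNormSq_layer_ne_top hs _ hf hf2
          have hvm : Measurable v := h.measurable_layer' s (R 0) (hdef hf)
          have hv2 : eNormSq v ≠ ⊤ := h.eNormSq_layer_ne_top hs _ (hdef hf) (hdef2 hf2)
          have hum' := hdef hum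
          have h1 := h.lintegral_eNormSq_cascade_sub_le m (Fin.tail R) hvm hv2 hum' (hdef2 hu2)
          have h2 := ih (Fin.tail R) hum hu2
          have mc1 := h.measurable_cascade_scale (Fin.tail R) hvm
          have mc2 := h.measurable_cascade_scale (Fin.tail R) hum'
          have mc3 := hcomp (h.measurable_cascade_scale (Fin.tail R) hum)
          have m1 : Measurable fun l => eNormSq (fun x =>
              cascade ψ m l (Fin.tail R) v x - cascade ψ m l (Fin.tail R) (deform τ u) x) :=
            measurable_eNormSq (mc1.sub mc2)
          have m2 : Measurable fun l => eNormSq (fun x =>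
              cascade ψ m l (Fin.tail R) (deform τ u) x -
                deform τ (cascade ψ m l (Fin.tail R) u) x) :=
            measurable_eNormSq (mc2.sub mc3)
          calc _ ≤ ∫⁻ l, (2 * eNormSq (fun x =>
                  cascade ψ m l (Fin.tail R) v x - cascade ψ m l (Fin.tail R) (deform τ u) x) +
                2 * eNormSq (fun x => cascade ψ m l (Fin.tail R) (deform τ u) x -
                  deform τ (cascade ψ m l (Fin.tail R) u) x))
                  ∂(Measure.pi fun _ : Fin m => scaleMeasure n) := by
                refine lintegral_mono fun l => ?_
                have e1 := h.measurable_cascade_apply l (Fin.tail R) hvm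
                have e2 := h.measurable_cascade_apply l (Fin.tail R) hum'
                have e3 := hdef (h.measurable_cascade_apply l (Fin.tail R) hum)
                have e4 := eNormSq_add_le (e1.sub e2) (e2.sub e3)
                refine (le_of_eq ?_).trans e4
                congr 1
                funext x
                simp [deform]
            _ ≤ _ := by
                rw [lintegral_add_left (m1.const_mul 2), lintegral_const_mul _ m1,
                  lintegral_const_mul _ m2, mul_assoc, mul_assoc 2, mul_assoc 2, mul_assoc]
                exact add_le_add (mul_le_mul_right h1 _) (mul_le_mul_right h2 _)
      _ ≤ _ := by
          rw [lintegral_add_left (mA.const_mul _), lintegral_const_mul _ mA,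
            lintegral_const_mul _ mB]
          have h1 := h.lintegral_eNormSq_layer_commutator_le hn hτ (R 0) hf hf2
          have h2 := h.lintegral_eNormSq_layer_le (R 0) hf hf2
          refine (add_le_add (mul_le_mul_right h1 _) (mul_le_mul_right h2 _)).trans (le_of_eq ?_)
          rw [mul_pow, ENNReal.ofReal_mul (sq_nonneg _)]
          simp only [cascadeCommConst]
          ring

end IsSmoothWavelet

end CascadeEstimates

/-! ### Comparing squared norms along a fixed path of rotations -/

section PathEstimate

variable {n : ℕ}

theorem normSqL2_eq_toReal {g : Eucl n → ℂ} (hg : AEStronglyMeasurable g) :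
    normSqL2 g = (eNormSq g).toReal := by
  unfold normSqL2 eNormSq
  rw [integral_eq_lintegral_of_nonneg_ae (Filter.Eventually.of_forall fun x => sq_nonneg _)
    (hg.norm.pow 2)]
  congr 1
  refine lintegral_congr fun x => ?_
  rw [ENNReal.ofReal_pow (norm_nonneg _), ofReal_norm]

theorem enorm_toReal_sub_toReal_le {x y e : ℝ≥0∞} (hx : x ≠ ⊤) (hy : y ≠ ⊤) (h1 : x ≤ y + e)
    (h2 : y ≤ x + e) : ‖x.toReal - y.toReal‖ₑ ≤ e := by
  rcases eq_or_ne e ⊤ with rfl | he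
  · exact le_top
  lift x to NNReal using hx
  lift y to NNReal using hy
  lift e to NNReal using he
  norm_cast at h1 h2
  rw [← ofReal_norm, ENNReal.ofReal_le_iff_le_toReal ENNReal.coe_ne_top, Real.norm_eq_abs, abs_le]
  have h1' : (x : ℝ) ≤ y + e := by exact_mod_cast h1
  have h2' : (y : ℝ) ≤ x + e := by exact_mod_cast h2
  simp only [ENNReal.coe_toReal]
  constructor <;> linarith

/-- Young's inequality `2 ‖c‖ ‖b - c‖ ≤ δ ‖c‖² + δ⁻¹ ‖b - c‖²`. -/
theorem enorm_sq_le_add {δ : ℝ} (hδ : 0 < δ) (b c : ℂ) :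
    ‖b‖ₑ ^ 2 ≤ ‖c‖ₑ ^ 2 + (ENNReal.ofReal (1 + 1 / δ) * ‖b - c‖ₑ ^ 2 +
      ENNReal.ofReal δ * ‖c‖ₑ ^ 2) := by
  have h1 : ‖b‖ ^ 2 ≤ ‖c‖ ^ 2 + ((1 + 1 / δ) * ‖b - c‖ ^ 2 + δ * ‖c‖ ^ 2) := by
    have ht : ‖b‖ ≤ ‖c‖ + ‖b - c‖ := norm_le_norm_add_norm_sub' b c
    have h2 : ‖b‖ ^ 2 ≤ (‖c‖ + ‖b - c‖) ^ 2 := pow_le_pow_left₀ (norm_nonneg _) ht 2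
    have h3 : 0 ≤ (δ * ‖c‖ - ‖b - c‖) ^ 2 / δ := by positivity
    have h4 : (δ * ‖c‖ - ‖b - c‖) ^ 2 / δ =
        δ * ‖c‖ ^ 2 - 2 * ‖c‖ * ‖b - c‖ + 1 / δ * ‖b - c‖ ^ 2 := by
      field_simp; ring
    nlinarith
  have h2 := ENNReal.ofReal_le_ofReal h1
  simp only [← ofReal_norm]
  rw [← ENNReal.ofReal_pow (norm_nonneg _), ← ENNReal.ofReal_pow (norm_nonneg _),
    ← ENNReal.ofReal_pow (norm_nonneg _), ← ENNReal.ofReal_mul (by positivity),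
    ← ENNReal.ofReal_mul hδ.le, ← ENNReal.ofReal_add (by positivity) (by positivity),
    ← ENNReal.ofReal_add (by positivity) (by positivity)]
  exact h2

theorem eNormSq_le_add {δ : ℝ} (hδ : 0 < δ) {b c : Eucl n → ℂ} (hb : Measurable b)
    (hc : Measurable c) :
    eNormSq b ≤ eNormSq c + (ENNReal.ofReal (1 + 1 / δ) * eNormSq (fun x => b x - c x) +
      ENNReal.ofReal δ * eNormSq c) := by
  have m1 : Measurable fun x => ‖c x‖ₑ ^ 2 := by fun_prop
  have m2 : Measurable fun x => ‖b x - c x‖ₑ ^ 2 := by fun_prop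
  unfold eNormSq
  rw [← lintegral_const_mul _ m1, ← lintegral_const_mul _ m2,
    ← lintegral_add_left (m2.const_mul _), ← lintegral_add_left m1]
  exact lintegral_mono fun x => enorm_sq_le_add hδ _ _

/-- The reverse comparison with the same error, expressed through `c` and not `b`. It uses `‖c‖² ≤
‖b‖² + 2 ‖c‖ ‖b - c‖`, so that both directions share one bound. -/
theorem enorm_sq_le_add' {δ : ℝ} (hδ : 0 < δ) (b c : ℂ) :
    ‖c‖ₑ ^ 2 ≤ ‖b‖ₑ ^ 2 + (ENNReal.ofReal (1 + 1 / δ) * ‖b - c‖ₑ ^ 2 +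
      ENNReal.ofReal δ * ‖c‖ₑ ^ 2) := by
  have h1 : ‖c‖ ^ 2 ≤ ‖b‖ ^ 2 + ((1 + 1 / δ) * ‖b - c‖ ^ 2 + δ * ‖c‖ ^ 2) := by
    have ht : ‖c‖ ≤ ‖b‖ + ‖b - c‖ := norm_le_norm_add_norm_sub b c
    have h3 : 0 ≤ (δ * ‖c‖ - ‖b - c‖) ^ 2 / δ := by positivity
    have h4 : (δ * ‖c‖ - ‖b - c‖) ^ 2 / δ =
        δ * ‖c‖ ^ 2 - 2 * ‖c‖ * ‖b - c‖ + 1 / δ * ‖b - c‖ ^ 2 := by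
      field_simp; ring
    have h5 : ‖c‖ ^ 2 ≤ ‖b‖ ^ 2 + 2 * ‖c‖ * ‖b - c‖ := by
      nlinarith [norm_nonneg b, norm_nonneg c, norm_nonneg (b - c), sq_nonneg (‖b‖ - ‖c‖)]
    nlinarith [sq_nonneg ‖b - c‖]
  have h2 := ENNReal.ofReal_le_ofReal h1
  simp only [← ofReal_norm]
  rw [← ENNReal.ofReal_pow (norm_nonneg _), ← ENNReal.ofReal_pow (norm_nonneg _),
    ← ENNReal.ofReal_pow (norm_nonneg _), ← ENNReal.ofReal_mul (by positivity),
    ← ENNReal.ofReal_mul hδ.le, ← ENNReal.ofReal_add (by positivity) (by positivity),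
    ← ENNReal.ofReal_add (by positivity) (by positivity)]
  exact h2

theorem eNormSq_le_add' {δ : ℝ} (hδ : 0 < δ) {b c : Eucl n → ℂ} (hb : Measurable b)
    (hc : Measurable c) :
    eNormSq c ≤ eNormSq b + (ENNReal.ofReal (1 + 1 / δ) * eNormSq (fun x => b x - c x) +
      ENNReal.ofReal δ * eNormSq c) := by
  have m1 : Measurable fun x => ‖c x‖ₑ ^ 2 := by fun_prop
  have m2 : Measurable fun x => ‖b x - c x‖ₑ ^ 2 := by fun_prop
  have m3 : Measurable fun x => ‖b x‖ₑ ^ 2 := by fun_prop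
  calc eNormSq c ≤ ∫⁻ x, (‖b x‖ₑ ^ 2 + (ENNReal.ofReal (1 + 1 / δ) * ‖b x - c x‖ₑ ^ 2 +
        ENNReal.ofReal δ * ‖c x‖ₑ ^ 2)) := lintegral_mono fun x => enorm_sq_le_add' hδ _ _
    _ = _ := by
        rw [lintegral_add_left m3, lintegral_add_left (m2.const_mul _), lintegral_const_mul _ m2,
          lintegral_const_mul _ m1]
        rfl

namespace IsSmallDisplacement

variable {δ : ℝ} {τ : Eucl n → Eucl n}

theorem measurable_deform (h : IsSmallDisplacement δ τ) {a : Eucl n → ℂ} (ha : Measurable a) :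
    Measurable (deform τ a) := by
  have m := ha.comp h.measurable_map
  exact m

theorem eNormSq_deform_le (h : IsSmallDisplacement δ τ) (hn : 1 ≤ n) (a : Eucl n → ℂ) :
    eNormSq (deform τ a) ≤ ENNReal.ofReal (detConst n) * eNormSq a :=
  h.lintegral_comp_le hn fun y => ‖a y‖ₑ ^ 2

/-- The Jacobian in the change of variables is at most `1 + detConst n * δ`. The error is again
measured by the deformed function. -/
theorem eNormSq_le_deform (h : IsSmallDisplacement δ τ) (hn : 1 ≤ n) {a : Eucl n → ℂ}
    (ha : Measurable a) :
    eNormSq a ≤ eNormSq (deform τ a) + ENNReal.ofReal (detConst n * δ) * eNormSq (deform τ a) := by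
  have hC := one_le_detConst n
  have hδ := h.nonneg
  have m1 : Measurable fun x => ‖deform τ a x‖ₑ ^ 2 := (h.measurable_deform ha).enorm.pow_const 2
  unfold eNormSq
  rw [h.lintegral_eq hn, ← lintegral_const_mul _ m1, ← lintegral_add_left m1]
  refine lintegral_mono fun x => ?_
  have h1 : ENNReal.ofReal (displacementJac τ x) ≤ 1 + ENNReal.ofReal (detConst n * δ) := by
    rw [← ENNReal.ofReal_one, ← ENNReal.ofReal_add zero_le_one (by positivity)]
    exact ENNReal.ofReal_le_ofReal (by linarith [(abs_le.1 (h.abs_jac_sub_one_le x)).2])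
  refine (mul_le_mul_left h1 _).trans (le_of_eq ?_)
  rw [add_mul, one_mul]
  rfl

theorem eNormSq_deform_le_add (h : IsSmallDisplacement δ τ) (hn : 1 ≤ n) {a : Eucl n → ℂ}
    (ha : Measurable a) :
    eNormSq (deform τ a) ≤ eNormSq a + ENNReal.ofReal (detConst n * δ) * eNormSq (deform τ a) := by
  have hC := one_le_detConst n
  have hδ := h.nonneg
  have m1 : Measurable fun x => ‖deform τ a x‖ₑ ^ 2 := (h.measurable_deform ha).enorm.pow_const 2
  unfold eNormSq
  rw [h.lintegral_eq hn (fun y => ‖a y‖ₑ ^ 2), ← lintegral_const_mul _ m1,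
    ← lintegral_add_right _ (m1.const_mul _)]
  refine lintegral_mono fun x => ?_
  have h1 : 1 ≤ ENNReal.ofReal (displacementJac τ x) + ENNReal.ofReal (detConst n * δ) := by
    rw [← ENNReal.ofReal_one, ← ENNReal.ofReal_add (h.jac_pos x).le (by positivity)]
    exact ENNReal.ofReal_le_ofReal (by linarith [(abs_le.1 (h.abs_jac_sub_one_le x)).1])
  refine (le_of_eq (one_mul _).symm).trans ((mul_le_mul_left h1 _).trans (le_of_eq ?_))
  rw [add_mul]
  rfl

/-- With `c = deform τ a` as intermediate term: `‖a‖²` and `‖c‖²` differ by the Jacobian error, and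
`‖b‖²` and `‖c‖²` by Young's inequality. -/
theorem enorm_normSqL2_sub_le (h : IsSmallDisplacement δ τ) (hn : 1 ≤ n) (hδ : 0 < δ)
    {a b : Eucl n → ℂ} (ha : Measurable a) (ha2 : eNormSq a ≠ ⊤) (hb : Measurable b)
    (hb2 : eNormSq b ≠ ⊤) :
    ‖normSqL2 a - normSqL2 b‖ₑ ≤
      ENNReal.ofReal (1 + 1 / δ) * eNormSq (fun x => b x - a (x - τ x)) +
        ENNReal.ofReal δ * (ENNReal.ofReal ((1 + detConst n) * detConst n) * eNormSq a) := by
  have hC := one_le_detConst n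
  have hc : Measurable (deform τ a) := h.measurable_deform ha
  have hc2 := h.eNormSq_deform_le hn a
  set c := deform τ a with hcdef
  set e := ENNReal.ofReal (1 + 1 / δ) * eNormSq (fun x => b x - c x) +
      ENNReal.ofReal δ * eNormSq c + ENNReal.ofReal (detConst n * δ) * eNormSq c with he
  have h1 : eNormSq a ≤ eNormSq b + e := by
    refine (h.eNormSq_le_deform hn ha).trans ?_
    rw [he, ← add_assoc]
    exact add_le_add (eNormSq_le_add' hδ hb hc) le_rfl
  have h2 : eNormSq b ≤ eNormSq a + e := by
    refine (eNormSq_le_add hδ hb hc).trans ?_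
    refine (add_le_add (h.eNormSq_deform_le_add hn ha) le_rfl).trans (le_of_eq ?_)
    rw [he]; ring
  rw [normSqL2_eq_toReal ha.aestronglyMeasurable, normSqL2_eq_toReal hb.aestronglyMeasurable]
  refine (enorm_toReal_sub_toReal_le ha2 hb2 h1 h2).trans ?_
  rw [he, add_assoc]
  refine add_le_add le_rfl ?_
  rw [← add_mul, ← ENNReal.ofReal_add hδ.le (by positivity)]
  refine (mul_le_mul_right hc2 _).trans (le_of_eq ?_)
  rw [← mul_assoc, ← mul_assoc, ← ENNReal.ofReal_mul (by positivity), ← ENNReal.ofReal_mul hδ.le]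
  congr 2
  ring

end IsSmallDisplacement

/-- The constant in the stability estimate along a fixed path of rotations. -/
noncomputable def pathConst (n : ℕ) (B : ℝ) (m : ℕ) : ℝ≥0∞ :=
  2 * cascadeCommConst n B m +
    ENNReal.ofReal ((1 + detConst n) * detConst n) * layerConst n B ^ m

theorem pathConst_ne_top (n : ℕ) (B : ℝ) (m : ℕ) : pathConst n B m ≠ ⊤ := by
  have h1 := layerConst_ne_top n B
  have h2 := cascadeCommConst_ne_top n B m
  unfold pathConst
  finiteness

theorem ae_forall_pos_scaleMeasure (m : ℕ) :
    ∀ᵐ l ∂(Measure.pi fun _ : Fin m => scaleMeasure n), ∀ i, 0 < l i :=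
  Filter.eventually_all.2 fun i =>
    (Measure.tendsto_eval_ae_ae (μ := fun _ : Fin m => scaleMeasure n) (i := i)).eventually
      ae_pos_scaleMeasure

namespace IsSmoothWavelet

variable {B : ℝ} {ψ : Eucl n → ℂ}

theorem eNormSq_cascade_ne_top (h : IsSmoothWavelet B ψ) {m : ℕ} {l : Fin m → ℝ}
    (hl : ∀ i, 0 < l i) (R : Fin m → RotGroup n) {f : Eucl n → ℂ} (hf : Measurable f)
    (hf2 : eNormSq f ≠ ⊤) : eNormSq (cascade ψ m l R f) ≠ ⊤ :=
  ne_top_of_le_ne_top (ENNReal.mul_ne_top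
    (ENNReal.prod_ne_top fun i _ => fixedScaleConst_ne_top n B (l i)) hf2)
    (h.eNormSq_cascade_le m hl R hf)

theorem lintegral_enorm_normSqL2_cascade_sub_le (h : IsSmoothWavelet B ψ) (hn : 1 ≤ n) {δ : ℝ}
    (hδ : 0 < δ) {τ : Eucl n → Eucl n} (hτ : IsSmallDisplacement δ τ) (m : ℕ)
    (R : Fin m → RotGroup n) {f : Eucl n → ℂ} (hf : Measurable f) (hf2 : eNormSq f ≠ ⊤) :
    ∫⁻ l, ‖normSqL2 (cascade ψ m l R f) - normSqL2 (cascade ψ m l R (deform τ f))‖ₑ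
      ∂(Measure.pi fun _ : Fin m => scaleMeasure n) ≤
        ENNReal.ofReal δ * (pathConst n B m * eNormSq f) := by
  have hdf := hτ.measurable_deform hf
  have hdf2 : eNormSq (deform τ f) ≠ ⊤ :=
    ne_top_of_le_ne_top (ENNReal.mul_ne_top ENNReal.ofReal_ne_top hf2)
      (hτ.eNormSq_deform_le hn f)
  have mA : Measurable fun l => eNormSq (cascade ψ m l R f) :=
    measurable_eNormSq (h.measurable_cascade_scale R hf)
  calc _ ≤ ∫⁻ l, (ENNReal.ofReal (1 + 1 / δ) *
          eNormSq (fun x => cascade ψ m l R (deform τ f) x - cascade ψ m l R f (x - τ x)) +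
        ENNReal.ofReal δ * ENNReal.ofReal ((1 + detConst n) * detConst n) *
          eNormSq (cascade ψ m l R f)) ∂(Measure.pi fun _ : Fin m => scaleMeasure n) := by
        refine lintegral_mono_ae ?_
        filter_upwards [ae_forall_pos_scaleMeasure m] with l hl
        rw [mul_assoc]
        exact hτ.enorm_normSqL2_sub_le hn hδ (h.measurable_cascade_apply l R hf)
          (h.eNormSq_cascade_ne_top hl R hf hf2) (h.measurable_cascade_apply l R hdf)
          (h.eNormSq_cascade_ne_top hl R hdf hdf2)
    _ ≤ _ := by
        rw [lintegral_add_right _ (mA.const_mul _), lintegral_const_mul _ mA,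
          lintegral_const_mul' _ _ ENNReal.ofReal_ne_top]
        refine (add_le_add (mul_le_mul_right
          (h.lintegral_eNormSq_cascade_commutator_le hn hτ m R hf hf2) _)
          (mul_le_mul_right (h.lintegral_eNormSq_cascade_le m R hf hf2) _)).trans ?_
        -- The commutator is quadratic in `δ`, and the Young weight `1/δ` brings it down to first
        -- order; `δ ≤ 1/2` absorbs the remaining `δ²`.
        have e : ENNReal.ofReal (1 + 1 / δ) * ENNReal.ofReal (δ ^ 2) ≤ ENNReal.ofReal δ * 2 := by
          rw [← ENNReal.ofReal_mul (by positivity), ← ENNReal.ofReal_ofNat 2,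
            ← ENNReal.ofReal_mul hδ.le]
          refine ENNReal.ofReal_le_ofReal ?_
          have : (1 + 1 / δ) * δ ^ 2 = δ ^ 2 + δ := by field_simp
          nlinarith [hτ.le_half]
        calc _ = (ENNReal.ofReal (1 + 1 / δ) * ENNReal.ofReal (δ ^ 2)) *
                (cascadeCommConst n B m * eNormSq f) +
              ENNReal.ofReal δ * (ENNReal.ofReal ((1 + detConst n) * detConst n) *
                layerConst n B ^ m * eNormSq f) := by ring
          _ ≤ (ENNReal.ofReal δ * 2) * (cascadeCommConst n B m * eNormSq f) +
              ENNReal.ofReal δ * (ENNReal.ofReal ((1 + detConst n) * detConst n) *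
                layerConst n B ^ m * eNormSq f) := add_le_add (mul_le_mul_left e _) le_rfl
          _ = _ := by unfold pathConst; ring

end IsSmoothWavelet

end PathEstimate

/-! ### Integration over rotations and independence of representatives -/

section RotationAverage

variable {n : ℕ} {B : ℝ} {ψ : Eucl n → ℂ}

/-- The path of rotations `R₁, R₂R₁, …, R_mR₁`. -/
def rotPath {k : ℕ} (R₁ : RotGroup n) (R : Fin k → RotGroup n) : Fin (k + 1) → RotGroup n :=
  Fin.cons R₁ (fun i => R i * R₁)

theorem measurable_rotPath {k : ℕ} {β : Type*} [MeasurableSpace β] {R₁ : β → RotGroup n}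
    (hR₁ : Measurable R₁) {R : β → Fin k → RotGroup n} (hR : Measurable R) :
    Measurable fun b => rotPath (R₁ b) (R b) := by
  have h1 : Measurable fun b => fun i => R b i * R₁ b := by
    refine measurable_pi_iff.2 fun i => ?_
    have h2 : Measurable fun b => R b i := (measurable_pi_apply i).comp hR
    exact h2.mul hR₁
  exact measurable_fin_cons hR₁ h1

theorem IsSmoothWavelet.measurable_normSqL2_cascade (h : IsSmoothWavelet B ψ) {β : Type*}
    [MeasurableSpace β] {m : ℕ} {l : β → Fin m → ℝ} (hl : Measurable l)
    {R : β → Fin m → RotGroup n} (hR : Measurable R) {f : Eucl n → ℂ} (hf : Measurable f) :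
    Measurable fun b => normSqL2 (cascade ψ m (l b) (R b) f) := by
  have h1 : (fun b => normSqL2 (cascade ψ m (l b) (R b) f)) = fun b =>
      (eNormSq (cascade ψ m (l b) (R b) f)).toReal := by
    funext b
    exact normSqL2_eq_toReal (h.measurable_cascade_apply _ _ hf).aestronglyMeasurable
  have h2 : Measurable (Function.uncurry fun _ : β => f) := hf.comp measurable_snd
  rw [h1]
  exact (measurable_eNormSq (measurable_cascade h.measurable m hl hR h2)).ennreal_toReal

/-- At fixed positive scales the fixed-scale bound is uniform in `R₁`, and `μ` is finite.
Integrability is what allows the difference of the two scattering integrals to be written as one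
integral. -/
theorem IsSmoothWavelet.integrable_normSqL2_cascade (h : IsSmoothWavelet B ψ)
    (μ : Measure (RotGroup n)) [IsFiniteMeasure μ] {k : ℕ} {l : Fin (k + 1) → ℝ}
    (hl : ∀ i, 0 < l i) (R : Fin k → RotGroup n) {f : Eucl n → ℂ} (hf : Measurable f)
    (hf2 : eNormSq f ≠ ⊤) :
    Integrable (fun R₁ => normSqL2 (cascade ψ (k + 1) l (rotPath R₁ R) f)) μ := by
  have hm : Measurable fun R₁ => normSqL2 (cascade ψ (k + 1) l (rotPath R₁ R) f) :=
    h.measurable_normSqL2_cascade measurable_const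
      (measurable_rotPath measurable_id measurable_const) hf
  have hC : (∏ i, fixedScaleConst n B (l i)) * eNormSq f ≠ ⊤ := ENNReal.mul_ne_top
    (ENNReal.prod_ne_top fun i _ => fixedScaleConst_ne_top n B (l i)) hf2
  refine Integrable.of_bound hm.aestronglyMeasurable
    ((∏ i, fixedScaleConst n B (l i)) * eNormSq f).toReal (Filter.Eventually.of_forall fun R₁ => ?_)
  rw [normSqL2_eq_toReal (h.measurable_cascade_apply _ _ hf).aestronglyMeasurable,
    Real.norm_of_nonneg ENNReal.toReal_nonneg]
  exact ENNReal.toReal_mono hC (h.eNormSq_cascade_le _ hl _ hf)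

theorem IsSmoothWavelet.normL1_rotInvScattering_sub_le (h : IsSmoothWavelet B ψ) (hn : 1 ≤ n)
    (μ : Measure (RotGroup n)) [IsFiniteMeasure μ] (k : ℕ) {δ : ℝ}
    (hδ : 0 < δ) {τ : Eucl n → Eucl n} (hτ : IsSmallDisplacement δ τ) {f : Eucl n → ℂ}
    (hf : Measurable f) (hf2 : eNormSq f ≠ ⊤) :
    normL1 μ k (fun l R =>
        rotInvScattering μ ψ k f l R - rotInvScattering μ ψ k (deform τ f) l R) ≤
      ENNReal.ofReal δ * (pathConst n B (k + 1) * μ Set.univ ^ (k + 1) * eNormSq f) := by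
  have hdf := hτ.measurable_deform hf
  have hdf2 : eNormSq (deform τ f) ≠ ⊤ :=
    ne_top_of_le_ne_top (ENNReal.mul_ne_top ENNReal.ofReal_ne_top hf2)
      (hτ.eNormSq_deform_le hn f)
  set G : (Fin (k + 1) → ℝ) → (Fin k → RotGroup n) → RotGroup n → ℝ≥0∞ := fun l R R₁ =>
    ‖normSqL2 (cascade ψ (k + 1) l (rotPath R₁ R) f) -
      normSqL2 (cascade ψ (k + 1) l (rotPath R₁ R) (deform τ f))‖ₑ with hG
  have mG : ∀ {β : Type} [MeasurableSpace β] {l : β → Fin (k + 1) → ℝ}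
      {R : β → Fin k → RotGroup n} {R₁ : β → RotGroup n}, Measurable l → Measurable R →
      Measurable R₁ → Measurable fun b => G (l b) (R b) (R₁ b) := by
    intro β _ l R R₁ hl hR hR₁
    have hp := measurable_rotPath hR₁ hR
    exact ((h.measurable_normSqL2_cascade hl hp hf).sub
      (h.measurable_normSqL2_cascade hl hp hdf)).enorm
  have mH : Measurable fun p : (Fin (k + 1) → ℝ) × (Fin k → RotGroup n) =>
      ∫⁻ R₁, G p.1 p.2 R₁ ∂μ := by
    have m := mG (measurable_fst.comp measurable_fst) (measurable_snd.comp measurable_fst)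
      (measurable_snd (α := (Fin (k + 1) → ℝ) × (Fin k → RotGroup n)) (β := RotGroup n))
    exact m.lintegral_prod_right'
  unfold normL1
  calc _ ≤ ∫⁻ l, (∫⁻ R, (∫⁻ R₁, G l R R₁ ∂μ) ∂(Measure.pi fun _ : Fin k => μ))
        ∂(Measure.pi fun _ : Fin (k + 1) => scaleMeasure n) := by
        refine lintegral_mono_ae ?_
        filter_upwards [ae_forall_pos_scaleMeasure (k + 1)] with l hl
        refine lintegral_mono fun R => ?_
        unfold rotInvScattering
        refine (le_of_eq ?_).trans (enorm_integral_le_lintegral_enorm _)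
        exact congrArg enorm (integral_sub (h.integrable_normSqL2_cascade μ hl R hf hf2)
          (h.integrable_normSqL2_cascade μ hl R hdf hdf2)).symm
    -- The scales are moved innermost, since the path estimate holds for each fixed path with a
    -- bound independent of it. Each of the `k + 1` rotations then contributes a factor `μ
    -- Set.univ`.
    _ = ∫⁻ R, (∫⁻ l, (∫⁻ R₁, G l R R₁ ∂μ) ∂(Measure.pi fun _ : Fin (k + 1) => scaleMeasure n))
        ∂(Measure.pi fun _ : Fin k => μ) := lintegral_lintegral_swap mH.aemeasurable
    _ = ∫⁻ R, (∫⁻ R₁, (∫⁻ l, G l R R₁ ∂(Measure.pi fun _ : Fin (k + 1) => scaleMeasure n)) ∂μ)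
        ∂(Measure.pi fun _ : Fin k => μ) := by
        refine lintegral_congr fun R => lintegral_lintegral_swap ?_
        exact (mG measurable_fst measurable_const measurable_snd).aemeasurable
    _ ≤ ∫⁻ _R, (∫⁻ _R₁, ENNReal.ofReal δ * (pathConst n B (k + 1) * eNormSq f) ∂μ)
        ∂(Measure.pi fun _ : Fin k => μ) :=
        lintegral_mono fun R => lintegral_mono fun R₁ =>
          h.lintegral_enorm_normSqL2_cascade_sub_le hn hδ hτ (k + 1) (rotPath R₁ R) hf hf2
    _ = _ := by
        rw [lintegral_const, lintegral_const, Measure.pi_univ]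
        simp only [Finset.prod_const, Finset.card_univ, Fintype.card_fin]
        ring

theorem convC_congr_ae {f g : Eucl n → ℂ} (hfg : f =ᵐ[volume] g) (φ : Eucl n → ℂ) :
    convC f φ = convC g φ := by
  funext x
  refine integral_congr_ae ?_
  filter_upwards [hfg] with y hy
  rw [hy]

/-- With at least one layer, `f` enters only through a convolution. This permits a Borel
representative of `f`. -/
theorem rotInvScattering_congr_ae (μ : Measure (RotGroup n)) (ψ : Eucl n → ℂ) (k : ℕ)
    {f g : Eucl n → ℂ} (hfg : f =ᵐ[volume] g) :
    rotInvScattering μ ψ k f = rotInvScattering μ ψ k g := by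
  funext l R
  unfold rotInvScattering
  refine congrArg (fun F : RotGroup n → ℝ => ∫ R₁, F R₁ ∂μ) (funext fun R₁ => ?_)
  simp only [cascade, convC_congr_ae hfg]

/-- By `lintegral_comp_le` applied to indicators, preimages of null sets under `x ↦ x - τ x` are
null. -/
theorem IsSmallDisplacement.deform_congr_ae {δ : ℝ} {τ : Eucl n → Eucl n}
    (h : IsSmallDisplacement δ τ) (hn : 1 ≤ n) {f g : Eucl n → ℂ} (hfg : f =ᵐ[volume] g) :
    deform τ f =ᵐ[volume] deform τ g := by
  have hq : Measure.QuasiMeasurePreserving (fun x => x - τ x) volume volume := by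
    refine ⟨h.measurable_map, Measure.AbsolutelyContinuous.mk fun s hs h0 => ?_⟩
    rw [Measure.map_apply h.measurable_map hs]
    have h1 := h.lintegral_comp_le hn (s.indicator 1)
    rw [lintegral_indicator_one hs, h0, mul_zero] at h1
    rw [← lintegral_indicator_one (h.measurable_map hs)]
    exact le_antisymm h1 (zero_le)
  exact hq.ae_eq_comp hfg

end RotationAverage

/-! ### The stability theorem -/

theorem mainTheorem11 (n k : ℕ) (hn : 1 ≤ n)
    (μ : Measure (RotGroup n)) (hμ : μ.IsHaarMeasure) (A : ℝ) :
    ∃ C : ℝ, 0 < C ∧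
      ∀ ψ : Eucl n → ℂ, IsDecayingWavelet n A ψ →
      ∀ τ : Eucl n → Eucl n, ContDiff ℝ 2 τ →
        supD τ < ENNReal.ofReal (1 / (2 * (n : ℝ))) →
        supDelta τ ≠ ⊤ → supD2 τ ≠ ⊤ →
      ∀ f : Eucl n → ℂ, MemLp f 2 volume →
        normL1 μ k (fun l R =>
            rotInvScattering μ ψ k f l R - rotInvScattering μ ψ k (deform τ f) l R)
          ≤ ENNReal.ofReal (C * deformationSize τ * normSqL2 f) := by
  have := RotGroup.isFiniteMeasure μ
  have hn0 : (0 : ℝ) < n := by exact_mod_cast hn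
  set M := pathConst n ((n ^ 2 + 1) * A) (k + 1) * μ Set.univ ^ (k + 1) with hM
  have hMtop : M ≠ ⊤ :=
    ENNReal.mul_ne_top (pathConst_ne_top _ _ _) (ENNReal.pow_ne_top (measure_ne_top μ _))
  -- The factor `n` comes from bounding the operator norm of `Dτ` by its entries; the summand 1 only
  -- ensures positivity.
  refine ⟨M.toReal * n + 1, by positivity, fun ψ hψ τ hτ hD _ _ f hf => ?_⟩
  have hDtop : supD τ ≠ ⊤ := ne_top_of_lt hD
  set d := (supD τ).toReal with hd
  have hd0 : 0 ≤ d := ENNReal.toReal_nonneg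
  have hd1 : n * d < 1 / 2 := by
    have h1 : d < 1 / (2 * n) := (ENNReal.lt_ofReal_iff_toReal_lt hDtop).1 hD
    calc n * d < n * (1 / (2 * n)) := mul_lt_mul_of_pos_left h1 hn0
      _ = 1 / 2 := by field_simp
  obtain ⟨g, hg, hfg⟩ := hf.1.aemeasurable
  have hnorm : normSqL2 f = normSqL2 g := by
    refine integral_congr_ae ?_
    filter_upwards [hfg] with x hx
    rw [hx]
  have hg2 : eNormSq g ≠ ⊤ := by
    have h1 := (hf.ae_eq hfg).integrable_norm_pow (by norm_num)
    have h2 := h1.2.ne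
    simpa [eNormSq] using h2
  -- The path estimate divides by `δ`, so it is used for `δ` strictly above `n * d`. The limit `δ ↓
  -- n * d` also covers `d = 0`.
  have key : ∀ δ, n * d < δ → δ < 1 / 2 → normL1 μ k (fun l R =>
      rotInvScattering μ ψ k f l R - rotInvScattering μ ψ k (deform τ f) l R) ≤
        ENNReal.ofReal δ * (M * eNormSq g) := by
    intro δ hδ1 hδ2
    have hs := isSmallDisplacement_of_supD_lt hn hτ hDtop hδ1.le hδ2.le
    rw [rotInvScattering_congr_ae μ ψ k hfg,
      rotInvScattering_congr_ae μ ψ k (hs.deform_congr_ae hn hfg)]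
    exact hψ.isSmoothWavelet.normL1_rotInvScattering_sub_le hn μ k
      ((mul_nonneg hn0.le hd0).trans_lt hδ1) hs hg hg2
  have hX : M * eNormSq g ≠ ⊤ := ENNReal.mul_ne_top hMtop hg2
  have hlim : Filter.Tendsto (fun δ : ℝ => ENNReal.ofReal δ * (M * eNormSq g))
      (nhdsWithin (n * d) (Set.Ioi (n * d))) (nhds (ENNReal.ofReal (n * d) * (M * eNormSq g))) :=
    ENNReal.Tendsto.mul_const ((ENNReal.continuous_ofReal.tendsto _).mono_left
      nhdsWithin_le_nhds) (Or.inr hX)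
  have hmem : ∀ᶠ δ in nhdsWithin (n * d) (Set.Ioi (n * d)), δ ∈ Set.Ioo (n * d) (1 / 2) :=
    Ioo_mem_nhdsGT hd1
  refine (ge_of_tendsto hlim (hmem.mono fun δ hδ => key δ hδ.1 hδ.2)).trans ?_
  have hgn : eNormSq g = ENNReal.ofReal (normSqL2 g) := by
    rw [normSqL2_eq_toReal hg.aestronglyMeasurable, ENNReal.ofReal_toReal hg2]
  have hnn : 0 ≤ normSqL2 g := integral_nonneg fun x => sq_nonneg _
  -- The only place where the right-hand side of the theorem is enlarged: its squared term is
  -- dropped as nonnegative.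
  have hsize : d ≤ deformationSize τ := by
    unfold deformationSize
    exact le_add_of_nonneg_right (sq_nonneg _)
  have hMr : M = ENNReal.ofReal M.toReal := (ENNReal.ofReal_toReal hMtop).symm
  rw [hnorm, hgn]
  nth_rewrite 1 [hMr]
  rw [← ENNReal.ofReal_mul ENNReal.toReal_nonneg,
    ← ENNReal.ofReal_mul (by positivity)]
  refine ENNReal.ofReal_le_ofReal ?_
  calc n * d * (M.toReal * normSqL2 g) = (M.toReal * n) * d * normSqL2 g := by ring
    _ ≤ (M.toReal * n + 1) * deformationSize τ * normSqL2 g := by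
        gcongr
        linarith
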